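/- Setting. Let $m\ge 1$ and let $E_0,\dots,E_m$ be disjoint nondegenerate continua in $\mathbb C_\infty=\mathbb C\cup\{\infty\}$, with $E_1,\dots,E_m$ bounded, such that $\Omega=\mathbb C_\infty\setminus\bigcup_{j=0}^m E_j$ is a domain, every $\partial E_j$ is a Jordan curve, and $\partial\Omega$ is piecewise regular: with finitely many exceptions, near each boundary point $\Omega$ lies on one side of a $C^1$ arc, so that an exterior normal $n$ is defined. Let $u$ be the harmonic solution of the Dirichlet problem $u=0$ on $E_0$, $u=1$ on $E_1,\dots,E_m$; it is continuous on $\overline\Omega$ and, up to finitely many exceptional boundary points, its gradient extends continuously to $\partial\Omega$. Cuts. Let $\gamma_0$ be a curve of steepest ascent of $u$ from $E_0$ to one of the $E_j$, $j\ge1$. Every further cut $\gamma_k$ consists of two curves of steepest ascent of $u$ that start at a common saddle point of $u$ and end on two different continua $E_i$, $E_j$, $i,j\ge 1$; every saddle point of $u$ in $\Omega$ is used, and cuts may overlap. Assume that the cut domain $\tilde\Omega=\Omega\setminus\bigcup_k\gamma_k$ is simply connected, with oriented boundary given by the boundary values $\psi|_{\partial\mathbb D}$ (run counterclockwise) of a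 conformal map $\psi:\mathbb D\to\tilde\Omega$ that extends continuously to $\overline{\mathbb D}$; thus the two sides of a cut are distinguished. The oriented boundary consists of alternately traversed sides of cuts and arcs of the curves $\partial E_j$, no point of $\bigcup_j\partial E_j$ being traversed twice in the interiors of these arcs: $$c_0=\gamma_0^+,\ a_0,\ c_1,\ a_1,\ \dots,\ a_{J-1},\ c_J=\gamma_0^-,\ a_J,$$ where $J\ge1$, $a_J\subset\partial E_0$, and each of $a_0,\dots,a_{J-1}$ lies on some $\partial E_j$ with $j\ge1$. Here $\gamma_0^+$ is the side of $\gamma_0$ that is traversed from $E_0$ into the domain, and $\tilde z$ is its starting point, the intersection point of $E_0$ and $\gamma_0^+$. Jumps. Let $\Gamma_0$ be a closed regular contour line of $u$, viewed as a regular arc of a level line of $u$ that leads in $\tilde\Omega$ from $\gamma_0^+$ to $\gamma_0^-$, and put $$d=\int_{\Gamma_0}|\nabla u|\,ds .$$ For $0\le i<J$ let $\Gamma_i'$ be a regular arc of a level line of $u$ that leads in $\tilde\Omega$ from the side $c_i$ to the side $c_{i+1}$, and put $d_i=\int_{\Gamma_i'}|\nabla u|\,ds$. Conjugate problem. A harmonic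 solution of the conjugate Dirichlet–Neumann problem is a harmonic function $\tilde u$ on $\tilde\Omega$ that is continuous up to the oriented boundary, with $\tilde u=0$ on $\gamma_0^+$, $\tilde u=1$ on $\gamma_0^-$, $\tilde u=\frac1d\sum_{i<p}d_i$ on $c_p$ for $0<p<J$, and such that, at all but finitely many points of $\bigcup_j\partial E_j$, its gradient extends continuously to the boundary point and $\partial\tilde u/\partial n=0$ there. Lemma. Let $v$ be the harmonic conjugate of $u$ in $\tilde\Omega$ (i.e. $u+iv$ is holomorphic in $\tilde\Omega$) with $v(\tilde z)=0$, i.e. $v\circ\psi$ has limit $0$ at the point of $\partial\mathbb D$ corresponding to $\tilde z$ on $\gamma_0^+$. Then the conjugate Dirichlet–Neumann problem has a harmonic solution, every harmonic solution $\tilde u$ of it satisfies $v=d\,\tilde u$ in $\tilde\Omega$, and $\varphi=u+iv$ is univalent in $\tilde\Omega$. -/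

import Mathlib

open Set Filter Topology Metric MeasureTheory
open scoped Gradient OnePoint

noncomputable section

namespace MultConn

/-! The extended complex plane is `OnePoint ℂ`; functions on it are read in the chart `z`
near a finite point and in the chart `1 / z` near `∞`. -/

/-- A function on the extended plane, read in the chart `z ↦ 1 / z` around `∞`. -/
def atInfty {α : Type*} (f : OnePoint ℂ → α) : ℂ → α :=
  fun z => if z = 0 then f ∞ else f ((z⁻¹ : ℂ) : OnePoint ℂ)

/-- The part of a subset of the extended plane that lies in the finite plane. -/
def finitePart (S : Set (OnePoint ℂ)) : Set ℂ := {z | (z : OnePoint ℂ) ∈ S}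

/-- The Euclidean gradient of `u` at a finite point. -/
def grad (u : OnePoint ℂ → ℝ) (z : ℂ) : ℂ := ∇ (fun w : ℂ => u (w : OnePoint ℂ)) z

/-- `f` is harmonic on the open set `S` of the extended plane. -/
def HarmonicOn (f : OnePoint ℂ → ℝ) (S : Set (OnePoint ℂ)) : Prop :=
  (∀ z : ℂ, (z : OnePoint ℂ) ∈ S →
    InnerProductSpace.HarmonicAt (fun w : ℂ => f (w : OnePoint ℂ)) z) ∧
  (∞ ∈ S → InnerProductSpace.HarmonicAt (atInfty f) 0)

/-- `f` is holomorphic on the open set `S` of the extended plane. -/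
def HolomorphicOn (f : OnePoint ℂ → ℂ) (S : Set (OnePoint ℂ)) : Prop :=
  (∀ z : ℂ, (z : OnePoint ℂ) ∈ S →
    DifferentiableAt ℂ (fun w : ℂ => f (w : OnePoint ℂ)) z) ∧
  (∞ ∈ S → DifferentiableAt ℂ (atInfty f) 0)

/-- The function `u + i v`. -/
def complexPotential (u v : OnePoint ℂ → ℝ) (p : OnePoint ℂ) : ℂ :=
  (u p : ℂ) + (v p : ℂ) * Complex.I

/-- `v` is a harmonic conjugate of `u` on the open set `S`: `u + i v` is holomorphic there. -/
def IsHarmonicConjugate (u v : OnePoint ℂ → ℝ) (S : Set (OnePoint ℂ)) : Prop :=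
  HolomorphicOn (complexPotential u v) S

/-- `p` is a critical point of `u` (for harmonic `u`, a saddle point). -/
def IsCriticalPt (u : OnePoint ℂ → ℝ) (p : OnePoint ℂ) : Prop :=
  (∃ z : ℂ, p = (z : OnePoint ℂ) ∧ grad u z = 0) ∨ (p = ∞ ∧ ∇ (atInfty u) 0 = 0)

/-! ### Multiply connected domains -/

/-- Near the finite boundary point `z` the set `Ω` lies on one side of a regular (`C¹`) arc,
namely `Ω = {ρ < 0}` there with `∇ρ ≠ 0`, and `n = ∇ρ / |∇ρ|` is its exterior unit normal. -/
def IsExteriorNormal (Ω : Set (OnePoint ℂ)) (z n : ℂ) : Prop :=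
  ∃ ρ : ℂ → ℝ, ContDiffAt ℝ 1 ρ z ∧ ρ z = 0 ∧ ∇ ρ z ≠ 0 ∧
    (∀ᶠ w : ℂ in 𝓝 z, (w : OnePoint ℂ) ∈ Ω ↔ ρ w < 0) ∧ n = ‖∇ ρ z‖⁻¹ • ∇ ρ z

/-- The complement of `E₀ ∪ … ∪ E_m` in the extended plane. -/
def domain {m : ℕ} (E : Fin (m + 1) → Set (OnePoint ℂ)) : Set (OnePoint ℂ) := (⋃ j, E j)ᶜ

/-- `E₀, …, E_m` are disjoint nondegenerate continua in the extended plane, `E₁, …, E_m` are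
bounded, their complement is a domain, and its boundary consists of piecewise regular Jordan
curves: each `∂E_j` is a Jordan curve, and there is an exterior normal at all boundary points
with finitely many exceptions. -/
structure IsMultiplyConnected {m : ℕ} (E : Fin (m + 1) → Set (OnePoint ℂ)) : Prop where
  isClosed : ∀ j, IsClosed (E j)
  isConnected : ∀ j, IsConnected (E j)
  nondegenerate : ∀ j, (E j).Nontrivial
  disjoint : Pairwise fun i j => Disjoint (E i) (E j)
  bounded : ∀ j, j ≠ 0 → ∞ ∉ E j
  domain_connected : IsConnected (domain E)
  jordan : ∀ j, ∃ β : Circle → OnePoint ℂ,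
    Continuous β ∧ Function.Injective β ∧ range β = frontier (E j)
  regular : ∃ S : Set (OnePoint ℂ), S.Finite ∧ ∀ p ∈ frontier (domain E) \ S,
    ∃ z n : ℂ, p = (z : OnePoint ℂ) ∧ IsExteriorNormal (domain E) z n

/-- `u` is the harmonic solution of the Dirichlet problem with values `0` on `E₀` and `1` on
`E₁, …, E_m`. It is continuous on the closed domain and differentiable up to the boundary (the
gradient has a limit) with at most finitely many exceptional boundary points, e.g. corners. -/
structure IsPotential {m : ℕ} (E : Fin (m + 1) → Set (OnePoint ℂ)) (u : OnePoint ℂ → ℝ) :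
    Prop where
  harmonic : HarmonicOn u (domain E)
  continuousOn : ContinuousOn u (closure (domain E))
  eq_zero : ∀ p ∈ E 0, u p = 0
  eq_one : ∀ j, j ≠ 0 → ∀ p ∈ E j, u p = 1
  differentiable : ∃ S : Set (OnePoint ℂ), S.Finite ∧ ∀ p ∈ frontier (domain E) \ S,
    ∃ z g : ℂ, p = (z : OnePoint ℂ) ∧
      Tendsto (grad u) (𝓝[finitePart (domain E)] z) (𝓝 g)

/-! ### Cuts -/

/-- `c` restricted to `[0,1]` is a curve of steepest ascent of `u` whose interior lies in `Ω`:
with finitely many exceptional parameters (such as passages through saddle points or `∞`) its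
velocity is a positive multiple of the nonzero vector `∇u`. -/
structure IsAscentCurve (u : OnePoint ℂ → ℝ) (Ω : Set (OnePoint ℂ)) (c : ℝ → OnePoint ℂ) :
    Prop where
  continuousOn : ContinuousOn c (Icc 0 1)
  mem : ∀ t ∈ Ioo (0 : ℝ) 1, c t ∈ Ω
  ascent : ∃ (T : Set ℝ) (f : ℝ → ℂ), T.Finite ∧ ∀ t ∈ Ioo (0 : ℝ) 1 \ T,
    c t = (f t : OnePoint ℂ) ∧ grad u (f t) ≠ 0 ∧
      ∃ r : ℝ, 0 < r ∧ HasDerivAt f (r • grad u (f t)) t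

/-- The cuts: the cut `γ₀` is a steepest ascent curve from `E₀` to one of the other continua;
every further cut consists of two steepest ascent curves which start at a common saddle point
and end on different continua `E_i`, `E_j`, `i, j ≥ 1`. Every saddle point of `u` is used.
Cuts may overlap, and several cuts may pass through the same saddle point. -/
structure Cuts {m : ℕ} (E : Fin (m + 1) → Set (OnePoint ℂ)) (u : OnePoint ℂ → ℝ) where
  γ₀ : ℝ → OnePoint ℂ
  γ₀_ascent : IsAscentCurve u (domain E) γ₀
  γ₀_zero : γ₀ 0 ∈ E 0
  γ₀_one : ∃ j, j ≠ 0 ∧ γ₀ 1 ∈ E j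
  /-- number of the further cuts -/
  num : ℕ
  saddle : Fin num → OnePoint ℂ
  saddle_mem : ∀ k, saddle k ∈ domain E
  saddle_critical : ∀ k, IsCriticalPt u (saddle k)
  saddle_all : ∀ p ∈ domain E, IsCriticalPt u p → ∃ k, saddle k = p
  /-- the two halves of a cut -/
  α : Fin num → ℝ → OnePoint ℂ
  β : Fin num → ℝ → OnePoint ℂ
  α_ascent : ∀ k, IsAscentCurve u (domain E) (α k)
  β_ascent : ∀ k, IsAscentCurve u (domain E) (β k)
  α_zero : ∀ k, α k 0 = saddle k
  β_zero : ∀ k, β k 0 = saddle k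
  ends : ∀ k, ∃ i j, i ≠ 0 ∧ j ≠ 0 ∧ i ≠ j ∧ α k 1 ∈ E i ∧ β k 1 ∈ E j

/-- The union of all cuts. -/
def Cuts.carrier {m : ℕ} {E : Fin (m + 1) → Set (OnePoint ℂ)} {u : OnePoint ℂ → ℝ}
    (C : Cuts E u) : Set (OnePoint ℂ) :=
  C.γ₀ '' Icc 0 1 ∪ ⋃ k, (C.α k '' Icc 0 1 ∪ C.β k '' Icc 0 1)

/-- The domain of the conjugate problem: the domain with all cuts removed. -/
def Cuts.cutDomain {m : ℕ} {E : Fin (m + 1) → Set (OnePoint ℂ)} {u : OnePoint ℂ → ℝ}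
    (C : Cuts E u) : Set (OnePoint ℂ) :=
  domain E \ C.carrier

/-- The point of the unit circle with argument `t`. -/
def circlePt (t : ℝ) : ℂ := Complex.exp ((t : ℂ) * Complex.I)

/-- The positively oriented boundary of the simply connected cut domain, in which the two sides
of a cut are distinguished: `ψ` is a conformal map of the unit disk onto the cut domain with a
continuous extension to the closed disk, and the oriented boundary is `t ↦ ψ (exp (i t))` for `t`
from `θ 0` to `θ 0 + 2π`. It consists of alternately traversed sides of cuts
`[θ (2p), θ (2p+1)]` and segments `[θ (2p+1), θ (2p+2)]` of the curves `∂E_j`, for `p = 0, …, J`.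
The segment number `J`, which closes up the boundary, is the one on `∂E₀`; hence the side number
`0` starts on `∂E₀` and the side number `J` ends there, i.e. they are `γ₀⁺` and `γ₀⁻`, and
`ψ (exp (i θ 0))` is the intersection point of `E₀` and `γ₀⁺`. -/
structure OrientedBoundary {m : ℕ} {E : Fin (m + 1) → Set (OnePoint ℂ)} {u : OnePoint ℂ → ℝ}
    (C : Cuts E u) where
  ψ : ℂ → OnePoint ℂ
  continuousOn : ContinuousOn ψ (closedBall 0 1)
  bijOn : BijOn ψ (ball 0 1) C.cutDomain
  conformal : ∀ ζ ∈ ball (0 : ℂ) 1, ψ ζ ≠ ∞ →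
    ∃ f : ℂ → ℂ, DifferentiableAt ℂ f ζ ∧ ∀ᶠ w in 𝓝 ζ, ψ w = (f w : OnePoint ℂ)
  /-- number of the jumps -/
  J : ℕ
  J_pos : 1 ≤ J
  θ : ℕ → ℝ
  θ_lt : ∀ k ≤ 2 * J + 1, θ k < θ (k + 1)
  θ_close : θ (2 * J + 2) = θ 0 + 2 * Real.pi
  /-- sides of cuts run in the domain -/
  cut_side : ∀ p ≤ J, ∀ t ∈ Ioo (θ (2 * p)) (θ (2 * p + 1)), ψ (circlePt t) ∈ domain E ∩ C.carrier
  /-- the segment number `p` lies on `∂E_j` with `j = label p` -/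
  label : ℕ → Fin (m + 1)
  segment : ∀ p ≤ J, ∀ t ∈ Icc (θ (2 * p + 1)) (θ (2 * p + 2)), ψ (circlePt t) ∈ E (label p)
  label_last : label J = 0
  label_ne : ∀ p < J, label p ≠ 0
  /-- no point of `∂E_j` is traversed twice -/
  segment_inj : ∀ p ≤ J, ∀ q ≤ J, ∀ s ∈ Ioo (θ (2 * p + 1)) (θ (2 * p + 2)),
    ∀ t ∈ Ioo (θ (2 * q + 1)) (θ (2 * q + 2)), ψ (circlePt s) = ψ (circlePt t) → s = t

/-! ### Contour segments and jumps -/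

/-- A segment of a contour line `u = const` in the domain: a regular `C¹` arc `σ` which leads
from the cut side number `p` to the cut side number `q` and otherwise runs in the cut domain;
`τ` is the same arc in the closed disk, recording which sides of the cuts it joins. -/
structure ContourSegment {m : ℕ} {E : Fin (m + 1) → Set (OnePoint ℂ)} {u : OnePoint ℂ → ℝ}
    {C : Cuts E u} (B : OrientedBoundary C) (p q : ℕ) where
  σ : ℝ → ℂ
  smooth : ContDiffOn ℝ 1 σ (Icc 0 1)
  regular : ∀ t ∈ Icc (0 : ℝ) 1, derivWithin σ (Icc 0 1) t ≠ 0
  level : ℝ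
  on_level : ∀ t ∈ Icc (0 : ℝ) 1, u (σ t : OnePoint ℂ) = level
  τ : ℝ → ℂ
  τ_continuousOn : ContinuousOn τ (Icc 0 1)
  τ_mem : ∀ t ∈ Ioo (0 : ℝ) 1, τ t ∈ ball (0 : ℂ) 1
  τ_zero : ∃ a ∈ Ioo (B.θ (2 * p)) (B.θ (2 * p + 1)), τ 0 = circlePt a
  τ_one : ∃ b ∈ Ioo (B.θ (2 * q)) (B.θ (2 * q + 1)), τ 1 = circlePt b
  ψ_τ : ∀ t ∈ Icc (0 : ℝ) 1, B.ψ (τ t) = (σ t : OnePoint ℂ)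

/-- `∫ |∇u| ds` over the contour segment. -/
def ContourSegment.flux {m : ℕ} {E : Fin (m + 1) → Set (OnePoint ℂ)} {u : OnePoint ℂ → ℝ}
    {C : Cuts E u} {B : OrientedBoundary C} {p q : ℕ} (Γ : ContourSegment B p q) : ℝ :=
  ∫ t in (0 : ℝ)..1, ‖grad u (Γ.σ t)‖ * ‖derivWithin Γ.σ (Icc 0 1) t‖

/-! ### The conjugate problem -/

/-- Dirichlet data of the conjugate problem on the cut side number `p`: `0` on `γ₀⁺` and `1` on
`γ₀⁻`, and in between the cumulative sum of the jumps reached so far, divided by `d`. -/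
def dirichletData {J : ℕ} (jump : Fin J → ℝ) (d : ℝ) (p : ℕ) : ℝ :=
  if p = 0 then 0 else if p = J then 1
  else (∑ i ∈ Finset.univ.filter (fun i : Fin J => (i : ℕ) < p), jump i) / d

/-- `w` is a harmonic solution of the conjugate Dirichlet–Neumann problem with Dirichlet data
`data p` on the cut side number `p` and `∂w/∂n = 0` on the curves `∂E_j`: it is harmonic in the
cut domain, continuous up to its boundary (with the two sides of a cut distinguished), and with
at most finitely many exceptional points `w` is differentiable up to `∂E_j` with vanishing
normal derivative. -/
structure IsConjugateSolution {m : ℕ} {E : Fin (m + 1) → Set (OnePoint ℂ)}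
    {u : OnePoint ℂ → ℝ} {C : Cuts E u} (B : OrientedBoundary C) (data : ℕ → ℝ)
    (w : OnePoint ℂ → ℝ) : Prop where
  harmonic : HarmonicOn w C.cutDomain
  dirichlet : ∃ W : ℂ → ℝ, ContinuousOn W (closedBall 0 1) ∧
    (∀ ζ ∈ ball (0 : ℂ) 1, W ζ = w (B.ψ ζ)) ∧
    ∀ p ≤ B.J, ∀ t ∈ Icc (B.θ (2 * p)) (B.θ (2 * p + 1)), W (circlePt t) = data p
  neumann : ∃ S : Set (OnePoint ℂ), S.Finite ∧ ∀ p ∈ frontier (domain E) \ S,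
    ∃ z n g : ℂ, p = (z : OnePoint ℂ) ∧ IsExteriorNormal (domain E) z n ∧
      Tendsto (grad w) (𝓝[finitePart C.cutDomain] z) (𝓝 g) ∧ inner ℝ g n = 0

end MultConn

end

/-!
The conformal map `ψ` pulls the complex potential `u + i v` back to a holomorphic function on the
unit disk whose real part `u ∘ ψ` is continuous on the closed disk with values in `[0, 1]`.
Everything follows from the boundary values of `v ∘ ψ` on the circle.

*Boundary values.* On a side of a cut, `v` agrees up to a constant with a conjugate function that is
holomorphic across the cut; on the cuts the values of such a function form a null set, because its
derivative along steepest ascent curves vanishes (`IsAscentCurve.volume_image_im_eq_zero`), so by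
continuity `v` is constant on each side (`OrientedBoundary.exists_tendsto_cut_local`). On a boundary
segment, where `u` is `0` or `1`, the limit of the gradient yields a limit of `v` at the regular
points (`HasConeAt.exists_hasExpansionAt`). The exceptional points and the corners are removable:
after subtracting a constant, the function is real or purely imaginary at the nearby boundary points
and has bounded real part, so its square extends by reflection (`exists_tendsto_sq`). Hence `v ∘ ψ`
extends continuously to the closed disk. As `u` is maximal on `∂E_j` for `j ≥ 1` and minimal on
`∂E₀`, reflection also shows that the boundary values of `v` increase along the segments on the
former and decrease along the segment on the latter (`OrientedBoundary.exists_extension`).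

*Jumps.* Along a contour segment `v` has derivative `± |∇u| |σ'|` with a constant sign, hence the
values of `v` on the two sides it joins differ by the flux up to sign
(`ContourSegment.abs_sub_eq_flux`), and the sign is known by monotonicity. So `v` takes the value
`d` times the Dirichlet datum on each side (`OrientedBoundary.side_eq_dirichletData`).

*Conjugate problem.* At a regular boundary point `∇u` is normal to the boundary since `u` has an
extremum there, hence `∇v = i ∇u` is tangential and `v / d` is a solution. For uniqueness, a
conjugate of any solution has a gradient with normal limits on `∂E_j` and therefore locally constant
boundary values off finitely many points (`exists_tendsto_const_of_normal_gradient`). The difference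
of `v` and `d` times the solution vanishes on the sides of the cuts, and elsewhere on the circle its
conjugate is locally constant; by reflection it has no boundary maximum there
(`nonpos_of_mixed_boundary`).

*Univalence.* The boundary values of `v` increase on one arc of the circle and decrease on the
complementary one. This forces univalence (`injOn_of_unimodal_boundary`): on a strip, with the two
arcs as its sides, the imaginary part increases from left to right on the sides, hence inside by the
Phragmén–Lindelöf principle, so that the derivative takes values in the upper half-plane.
-/

noncomputable section

namespace MultConn

/-! ### Boundary behaviour of holomorphic functions on the upper half-plane -/

/-- The open upper half-plane. -/
abbrev upper : Set ℂ := {z | 0 < z.im}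

theorem isOpen_upper : IsOpen upper := isOpen_lt continuous_const Complex.continuous_im

theorem closure_upper : closure upper = {z : ℂ | 0 ≤ z.im} := by
  exact Complex.closure_setOfPred_lt_im 0

theorem ofReal_mem_closure_upper (x : ℝ) : (x : ℂ) ∈ closure upper := by
  rw [closure_upper]; simp

instance nhdsWithin_upper_neBot (x : ℝ) : (𝓝[upper] (x : ℂ)).NeBot :=
  mem_closure_iff_nhdsWithin_neBot.1 (ofReal_mem_closure_upper x)

/-- A continuous function on a disk which is holomorphic off the real axis is holomorphic. -/
theorem differentiableOn_ball_of_off_real {g : ℂ → ℂ} {c : ℂ} {r : ℝ}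
    (hc : ContinuousOn g (ball c r))
    (hd : ∀ z ∈ ball c r, z.im ≠ 0 → DifferentiableAt ℂ g z) :
    DifferentiableOn ℂ g (ball c r) := by
  refine (Complex.isConservativeOn_and_continuousOn_iff_isDifferentiableOn isOpen_ball).1 ⟨?_, hc⟩
  -- A rectangle whose interior misses the real axis satisfies Cauchy's theorem.
  have key : ∀ z w : ℂ, Complex.Rectangle z w ⊆ ball c r → (0 ≤ z.im ∧ 0 ≤ w.im ∨ z.im ≤ 0 ∧ w.im ≤ 0) →
      (∫ x : ℝ in z.re..w.re, g (x + z.im * Complex.I)) -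
      (∫ x : ℝ in z.re..w.re, g (x + w.im * Complex.I)) +
      Complex.I • (∫ y : ℝ in z.im..w.im, g (w.re + y * Complex.I)) -
      Complex.I • (∫ y : ℝ in z.im..w.im, g (z.re + y * Complex.I)) = 0 := by
    intro z w hzw h
    refine Complex.integral_boundary_rect_eq_zero_of_continuousOn_of_differentiableOn g z w
      (hc.mono hzw) ?_
    intro p hp
    have hp' : p ∈ Complex.Rectangle z w := by
      rw [Complex.mem_reProdIm] at hp
      exact Complex.mem_reProdIm.2 ⟨Ioo_subset_Icc_self hp.1, Ioo_subset_Icc_self hp.2⟩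
    refine (hd p (hzw hp') ?_).differentiableWithinAt
    have := (Complex.mem_reProdIm.1 hp).2
    rcases h with h | h
    · have := this.1; have := le_min h.1 h.2; exact ne_of_gt (by linarith)
    · have := this.2; have := max_le h.1 h.2; exact ne_of_lt (by linarith)
  intro z w hzw
  rw [← add_eq_zero_iff_eq_neg, Complex.wedgeIntegral_add_wedgeIntegral_eq]
  by_cases h : 0 ≤ z.im ∧ 0 ≤ w.im ∨ z.im ≤ 0 ∧ w.im ≤ 0
  · exact key z w hzw h
  -- Otherwise the rectangle is cut in two along the real axis.
  have h0 : (0 : ℝ) ∈ uIcc z.im w.im := by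
    rw [mem_uIcc]
    by_contra hh
    apply h
    by_cases h1 : 0 ≤ z.im <;> by_cases h2 : 0 ≤ w.im <;> grind
  have hsub1 : Complex.Rectangle z (w.re : ℂ) ⊆ Complex.Rectangle z w := by
    intro p hp
    have hp := Complex.mem_reProdIm.1 hp
    refine Complex.mem_reProdIm.2 ⟨by simpa using hp.1, ?_⟩
    have h2 := hp.2
    simp only [Complex.ofReal_im] at h2
    exact uIcc_subset_uIcc left_mem_uIcc h0 h2
  have hsub2 : Complex.Rectangle (z.re : ℂ) w ⊆ Complex.Rectangle z w := by
    intro p hp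
    have hp := Complex.mem_reProdIm.1 hp
    refine Complex.mem_reProdIm.2 ⟨by simpa using hp.1, ?_⟩
    have h2 := hp.2
    simp only [Complex.ofReal_im] at h2
    exact uIcc_subset_uIcc h0 right_mem_uIcc h2
  have e1 := key z (w.re : ℂ) (hsub1.trans hzw) (by simp [le_total])
  have e2 := key (z.re : ℂ) w (hsub2.trans hzw) (by simp [le_total])
  simp only [Complex.ofReal_im, Complex.ofReal_re] at e1 e2
  have hcont : ∀ a ∈ uIcc z.re w.re, ∀ s ∈ uIcc z.im w.im, ∀ t ∈ uIcc z.im w.im,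
      IntervalIntegrable (fun y : ℝ => g (a + y * Complex.I)) volume s t := by
    intro a ha s hs t ht
    refine ContinuousOn.intervalIntegrable ?_
    refine hc.comp (by fun_prop) ?_
    intro y hy
    refine hzw (Complex.mem_reProdIm.2 ⟨by simpa using ha, ?_⟩)
    simpa using uIcc_subset_uIcc hs ht hy
  rw [← intervalIntegral.integral_add_adjacent_intervals
      (hcont w.re right_mem_uIcc _ left_mem_uIcc 0 h0) (hcont w.re right_mem_uIcc 0 h0 _ right_mem_uIcc),
    ← intervalIntegral.integral_add_adjacent_intervals
      (hcont z.re left_mem_uIcc _ left_mem_uIcc 0 h0) (hcont z.re left_mem_uIcc 0 h0 _ right_mem_uIcc)]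
  simp only [smul_add] at e1 e2 ⊢
  linear_combination e1 + e2

/-- **Schwarz reflection.** A holomorphic function on the upper part of a symmetric open set `O`
which has real boundary values on the real axis extends holomorphically to `O`. -/
theorem exists_reflection {O : Set ℂ} (hO : IsOpen O)
    (hsymm : ∀ z ∈ O, (starRingEnd ℂ) z ∈ O) {f : ℂ → ℂ}
    (hf : DifferentiableOn ℂ f (O ∩ upper))
    (hlim : ∀ x : ℝ, (x : ℂ) ∈ O → ∃ y : ℝ, Tendsto f (𝓝[upper] (x : ℂ)) (𝓝 (y : ℂ))) :
    ∃ F : ℂ → ℂ, DifferentiableOn ℂ F O ∧ EqOn F f (O ∩ upper) ∧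
      ∀ z ∈ O, F ((starRingEnd ℂ) z) = (starRingEnd ℂ) (F z) := by
  have hfd : ∀ z ∈ O ∩ upper, DifferentiableAt ℂ f z := fun z hz =>
    hf.differentiableAt ((hO.inter isOpen_upper).mem_nhds hz)
  set g := extendFrom upper f with hg
  have hgc : ContinuousOn g (O ∩ {z : ℂ | 0 ≤ z.im}) := by
    refine continuousOn_extendFrom (fun z hz => closure_upper ▸ hz.2) ?_
    rintro z ⟨hzO, hz⟩
    rcases (show 0 ≤ z.im from hz).eq_or_lt with h | h
    · have : z = (z.re : ℂ) := Complex.ext (by simp) (by simp [← h])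
      obtain ⟨y, hy⟩ := hlim z.re (this ▸ hzO)
      exact ⟨y, by rwa [← this] at hy⟩
    · exact ⟨f z, (hfd z ⟨hzO, h⟩).continuousAt.tendsto.mono_left nhdsWithin_le_nhds⟩
  have hgf : EqOn g f (O ∩ upper) := fun z hz =>
    extendFrom_eq (subset_closure hz.2)
      ((hfd z hz).continuousAt.tendsto.mono_left nhdsWithin_le_nhds)
  have hgre : ∀ x : ℝ, (x : ℂ) ∈ O → (starRingEnd ℂ) (g x) = g x := by
    intro x hx
    obtain ⟨y, hy⟩ := hlim x hx
    rw [hg, extendFrom_eq (ofReal_mem_closure_upper x) hy, Complex.conj_ofReal]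
  set F : ℂ → ℂ := fun z => if 0 ≤ z.im then g z else (starRingEnd ℂ) (g ((starRingEnd ℂ) z)) with hF
  have hFu : ∀ z : ℂ, 0 ≤ z.im → F z = g z := fun z hz => by simp [hF, hz]
  have hFl : ∀ z ∈ O, z.im ≤ 0 → F z = (starRingEnd ℂ) (g ((starRingEnd ℂ) z)) := by
    intro z hzO hz
    rcases hz.eq_or_lt with h | h
    · have : z = (z.re : ℂ) := Complex.ext (by simp) (by simp [h])
      rw [hFu z h.ge, this, Complex.conj_ofReal, hgre _ (this ▸ hzO)]
    · simp [hF, not_le.2 h]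
  have hFc : ContinuousOn F O := by
    have h1 : ContinuousOn F (O ∩ {z : ℂ | 0 ≤ z.im}) := hgc.congr fun z hz => hFu z hz.2
    have h2 : ContinuousOn F (O ∩ {z : ℂ | z.im ≤ 0}) := by
      refine ContinuousOn.congr (f := fun z => (starRingEnd ℂ) (g ((starRingEnd ℂ) z))) ?_
        fun z hz => hFl z hz.1 hz.2
      refine Complex.continuous_conj.comp_continuousOn (hgc.comp Complex.continuous_conj.continuousOn ?_)
      intro z hz
      exact ⟨hsymm z hz.1, by simpa using hz.2⟩
    intro z hz
    have : O = (O ∩ {z : ℂ | 0 ≤ z.im}) ∪ (O ∩ {z : ℂ | z.im ≤ 0}) := by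
      ext w; simp only [mem_union, mem_inter_iff, mem_ofPred_eq]
      constructor
      · intro h; rcases le_total 0 w.im with h' | h' <;> simp [h, h']
      · rintro (h | h) <;> exact h.1
    -- both pieces are relatively closed in `O`
    have hcl1 : IsClosed {z : ℂ | 0 ≤ z.im} := isClosed_le continuous_const Complex.continuous_im
    have hcl2 : IsClosed {z : ℂ | z.im ≤ 0} := isClosed_le Complex.continuous_im continuous_const
    have cw : ∀ A : Set ℂ, IsClosed A → ContinuousOn F (O ∩ A) → ContinuousWithinAt F (O ∩ A) z := by
      intro A hA hcA
      by_cases hzA : z ∈ A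
      · exact hcA z ⟨hz, hzA⟩
      · refine continuousWithinAt_of_notMem_closure fun h => hzA ?_
        exact hA.closure_eq ▸ closure_mono inter_subset_right h
    rw [this]
    exact (cw _ hcl1 h1).union (cw _ hcl2 h2)
  have hFd : ∀ z ∈ O, z.im ≠ 0 → DifferentiableAt ℂ F z := by
    intro z hz him
    rcases lt_or_gt_of_ne him with h | h
    · have e : F =ᶠ[𝓝 z] fun w => (starRingEnd ℂ) (f ((starRingEnd ℂ) w)) := by
        filter_upwards [hO.mem_nhds hz, (isOpen_lt Complex.continuous_im continuous_const).mem_nhds h]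
          with w hw hw'
        have hw'' : w.im < 0 := hw'
        rw [hFl w hw hw''.le, hgf ⟨hsymm w hw, by simpa using hw''⟩]
      refine DifferentiableAt.congr_of_eventuallyEq ?_ e
      have := (hfd ((starRingEnd ℂ) z) ⟨hsymm z hz, by simpa using h⟩).conj_conj
      simpa [Function.comp_def] using this
    · have e : F =ᶠ[𝓝 z] f := by
        filter_upwards [hO.mem_nhds hz, isOpen_upper.mem_nhds h] with w hw hw'
        have hw'' : 0 < w.im := hw'
        rw [hFu w hw''.le, hgf ⟨hw, hw'⟩]
      exact (hfd z ⟨hz, h⟩).congr_of_eventuallyEq e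
  refine ⟨F, ?_, fun z hz => ?_, fun z hz => ?_⟩
  · intro z hz
    obtain ⟨r, hr, hrO⟩ := Metric.isOpen_iff.1 hO z hz
    have := differentiableOn_ball_of_off_real (hFc.mono hrO) (fun w hw => hFd w (hrO hw))
    exact (this.differentiableAt (ball_mem_nhds z hr)).differentiableWithinAt
  · rw [hFu z (le_of_lt hz.2), hgf hz]
  · rcases le_total 0 z.im with h | h
    · rw [hFu z h, hFl _ (hsymm z hz) (by simpa using h), Complex.conj_conj]
    · rw [hFl z hz h, hFu _ (by simpa using h), Complex.conj_conj]

/-- A holomorphic function whose real part is bounded above has no singularity: its values omit a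
half-plane, hence it has no pole and no essential singularity. -/
theorem exists_tendsto_of_re_le {F : ℂ → ℂ} {c : ℂ} {M : ℝ}
    (hd : ∀ᶠ z in 𝓝[≠] c, DifferentiableAt ℂ F z) (hM : ∀ᶠ z in 𝓝[≠] c, (F z).re ≤ M) :
    ∃ l, Tendsto F (𝓝[≠] c) (𝓝 l) := by
  set h : ℂ → ℂ := fun z => (F z - (M + 1))⁻¹ with hh
  have hne : ∀ᶠ z in 𝓝[≠] c, 1 ≤ ‖F z - (M + 1)‖ ∧ (F z - (M + 1)).re < 0 := by
    filter_upwards [hM] with z hz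
    have h1 : (F z - (M + 1)).re ≤ -1 := by simp; linarith
    refine ⟨?_, by linarith⟩
    have := Complex.abs_re_le_norm (F z - (M + 1))
    rw [abs_of_neg (by linarith)] at this
    linarith
  have hhd : ∀ᶠ z in 𝓝[≠] c, DifferentiableAt ℂ h z := by
    filter_upwards [hd, hne] with z hz hz'
    refine (hz.sub_const _).inv ?_
    intro h0; rw [h0] at hz'; simp at hz'
  have hb : IsBoundedUnder (· ≤ ·) (𝓝[≠] c) fun z => ‖h z - h c‖ := by
    refine ⟨1 + ‖h c‖, ?_⟩
    rw [eventually_map]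
    filter_upwards [hne] with z hz
    have : ‖h z‖ ≤ 1 := by
      rw [hh]; simp only [norm_inv]; exact inv_le_one_of_one_le₀ hz.1
    linarith [norm_sub_le (h z) (h c)]
  have hl := Complex.tendsto_limUnder_of_differentiable_on_punctured_nhds_of_bounded_under hhd hb
  set l := limUnder (𝓝[≠] c) h with hldef
  have hFh : ∀ᶠ z in 𝓝[≠] c, F z = (h z)⁻¹ + (M + 1) := by
    filter_upwards with z
    simp [hh]
  by_cases hl0 : l = 0
  · exfalso
    set h' := Function.update h c l with hh'
    have hEq : ∀ᶠ z in 𝓝[≠] c, h' z = h z := by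
      filter_upwards [self_mem_nhdsWithin] with z hz
      exact Function.update_of_ne hz _ _
    have hcont : ContinuousAt h' c := continuousAt_update_same.2 hl
    have hd' : ∀ᶠ z in 𝓝[≠] c, DifferentiableAt ℂ h' z := by
      filter_upwards [hhd, self_mem_nhdsWithin] with z hz hzc
      refine hz.congr_of_eventuallyEq ?_
      filter_upwards [isOpen_ne.mem_nhds hzc] with w hw
      exact Function.update_of_ne hw _ _
    have han := Complex.analyticAt_of_differentiable_on_punctured_nhds_of_continuousAt hd' hcont
    have hneg : ∀ᶠ z in 𝓝[≠] c, (h' z).re < 0 := by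
      filter_upwards [hEq, hne] with z hz hz'
      rw [hz, hh]
      simp only [Complex.inv_re]
      exact div_neg_of_neg_of_pos hz'.2 (Complex.normSq_pos.2 fun h0 => by simp [h0] at hz')
    have hc0 : h' c = 0 := by rw [hh', Function.update_self, hl0]
    rcases han.eventually_constant_or_nhds_le_map_nhds with hco | hmap
    · have : ∀ᶠ z in 𝓝[≠] c, (h' z).re = 0 := by
        filter_upwards [hco.filter_mono nhdsWithin_le_nhds] with z hz
        rw [hz, hc0]; simp
      obtain ⟨z, h1, h2⟩ := (this.and hneg).exists
      linarith
    · have h2 : ∀ᶠ z in 𝓝 c, (h' z).re ≤ 0 := by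
        rw [eventually_nhdsWithin_iff] at hneg
        filter_upwards [hneg] with z hz
        by_cases hzc : z = c
        · rw [hzc, hc0]; simp
        · exact (hz hzc).le
      have h3 : ∀ᶠ w in 𝓝 (h' c), w.re ≤ 0 := hmap h2
      rw [hc0] at h3
      have h4 : Tendsto (fun t : ℝ => (t : ℂ)) (𝓝[>] 0) (𝓝 0) := by
        have : Continuous fun t : ℝ => (t : ℂ) := Complex.continuous_ofReal
        simpa using (this.tendsto 0).mono_left nhdsWithin_le_nhds
      obtain ⟨t, ht, ht'⟩ := ((h4.eventually h3).and self_mem_nhdsWithin).exists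
      simp at ht
      exact absurd ht (not_le.2 ht')
  · refine ⟨l⁻¹ + (M + 1), ?_⟩
    refine Tendsto.congr' (hFh.mono fun z hz => hz.symm) ?_
    exact (hl.inv₀ hl0).add_const _

/-- A holomorphic function on a half-disk with real boundary values off the centre and with real
part bounded above has a limit at the centre. -/
theorem exists_tendsto_of_real_boundary {f : ℂ → ℂ} {x₀ r M : ℝ} (hr : 0 < r)
    (hf : DifferentiableOn ℂ f (ball (x₀ : ℂ) r ∩ upper))
    (hM : ∀ z ∈ ball (x₀ : ℂ) r ∩ upper, (f z).re ≤ M)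
    (hlim : ∀ x : ℝ, x ≠ x₀ → |x - x₀| < r →
      ∃ y : ℝ, Tendsto f (𝓝[upper] (x : ℂ)) (𝓝 (y : ℂ))) :
    ∃ l, Tendsto f (𝓝[upper] (x₀ : ℂ)) (𝓝 l) := by
  set O : Set ℂ := ball (x₀ : ℂ) r \ {(x₀ : ℂ)} with hOdef
  have hO : IsOpen O := isOpen_ball.sdiff isClosed_singleton
  have hsymm : ∀ z ∈ O, (starRingEnd ℂ) z ∈ O := by
    rintro z ⟨hz, hz'⟩
    refine ⟨?_, fun h => hz' ?_⟩
    · rw [mem_ball, dist_eq_norm] at hz ⊢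
      rw [← Complex.norm_conj]; simpa using hz
    · rw [mem_singleton_iff] at h ⊢
      rw [← Complex.conj_conj z, h, Complex.conj_ofReal]
  have hOn : ∀ x : ℝ, (x : ℂ) ∈ O → x ≠ x₀ ∧ |x - x₀| < r := by
    rintro x ⟨hx, hx'⟩
    refine ⟨fun h => hx' (by simp [h]), ?_⟩
    rw [mem_ball, dist_eq_norm, ← Complex.ofReal_sub, Complex.norm_real] at hx
    exact hx
  obtain ⟨F, hFd, hFf, hFs⟩ := exists_reflection hO hsymm
    (hf.mono (inter_subset_inter_left _ sdiff_subset))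
    (fun x hx => hlim x (hOn x hx).1 (hOn x hx).2)
  have hb1 : ∀ z ∈ O, 0 < z.im → (F z).re ≤ M := fun z hz h => by
    rw [hFf ⟨hz, h⟩]; exact hM z ⟨hz.1, h⟩
  have hb : ∀ z ∈ O, (F z).re ≤ M := by
    intro z hz
    rcases lt_trichotomy z.im 0 with h | h | h
    · have := hb1 _ (hsymm z hz) (by simpa using h)
      rwa [hFs z hz, Complex.conj_re] at this
    · have hz' : z = (z.re : ℂ) := Complex.ext (by simp) (by simp [h])
      have hc : Tendsto F (𝓝[upper] z) (𝓝 (F z)) :=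
        ((hFd.differentiableAt (hO.mem_nhds hz)).continuousAt).tendsto.mono_left nhdsWithin_le_nhds
      rw [hz'] at hc ⊢
      refine le_of_tendsto ((Complex.continuous_re.tendsto _).comp hc) ?_
      filter_upwards [self_mem_nhdsWithin, mem_nhdsWithin_of_mem_nhds (hO.mem_nhds (hz' ▸ hz))]
        with w hw hw'
      exact hb1 w hw' hw
    · exact hb1 z hz h
  have hOnhds : O ∈ 𝓝[≠] (x₀ : ℂ) := by
    rw [hOdef, sdiff_eq]
    exact inter_mem (mem_nhdsWithin_of_mem_nhds (ball_mem_nhds _ hr)) self_mem_nhdsWithin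
  obtain ⟨l, hl⟩ := exists_tendsto_of_re_le (F := F) (c := x₀) (M := M)
    (by filter_upwards [hOnhds] with z hz using hFd.differentiableAt (hO.mem_nhds hz))
    (by filter_upwards [hOnhds] with z hz using hb z hz)
  have hle : 𝓝[upper] (x₀ : ℂ) ≤ 𝓝[≠] (x₀ : ℂ) :=
    nhdsWithin_mono _ fun z hz h => by
      have hz : 0 < z.im := hz
      rw [mem_singleton_iff.1 h] at hz
      simp at hz
  refine ⟨l, (hl.mono_left hle).congr' ?_⟩
  filter_upwards [hle hOnhds, self_mem_nhdsWithin] with z hz hz'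
  exact hFf ⟨hz, hz'⟩

/-- Boundary limits at points accumulating at `x₀` are cluster values at `x₀`. -/
theorem frequently_upper_of_frequently {x₀ : ℝ} {s : Set ℝ} {P : ℂ → Prop}
    (h : ∃ᶠ x in 𝓝[s] x₀, ∃ᶠ z in 𝓝[upper] ((x : ℝ) : ℂ), P z) :
    ∃ᶠ z in 𝓝[upper] (x₀ : ℂ), P z := by
  intro hn
  refine h ?_
  have h1 : ∀ᶠ y in 𝓝 (x₀ : ℂ), ∀ᶠ z in 𝓝[upper] y, ¬ P z :=
    eventually_nhds_nhdsWithin.2 hn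
  have h2 : ∀ᶠ x in 𝓝 x₀, ∀ᶠ z in 𝓝[upper] ((x : ℝ) : ℂ), ¬ P z :=
    (Complex.continuous_ofReal.tendsto x₀).eventually h1
  filter_upwards [h2.filter_mono nhdsWithin_le_nhds] with x hx hx'
  exact hx' hx

/-- If at each boundary point near `x₀` a function with bounded real part has a limit which is
real or purely imaginary, then its square has a limit at `x₀`: the square is real on the boundary
and its real part is bounded above. -/
theorem exists_tendsto_sq {f : ℂ → ℂ} {x₀ r M : ℝ} (hr : 0 < r)
    (hf : DifferentiableOn ℂ f (ball (x₀ : ℂ) r ∩ upper))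
    (hM : ∀ z ∈ ball (x₀ : ℂ) r ∩ upper, |(f z).re| ≤ M)
    (hlim : ∀ x : ℝ, x ≠ x₀ → |x - x₀| < r →
      ∃ w : ℂ, Tendsto f (𝓝[upper] (x : ℂ)) (𝓝 w) ∧ (w.re = 0 ∨ w.im = 0)) :
    ∃ l, Tendsto (fun z => f z ^ 2) (𝓝[upper] (x₀ : ℂ)) (𝓝 l) := by
  refine exists_tendsto_of_real_boundary (M := M ^ 2) hr (hf.pow 2) ?_ ?_
  · intro z hz
    have := sq_le_sq' (neg_le_of_abs_le (hM z hz)) (le_of_abs_le (hM z hz))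
    rw [sq (f z), Complex.mul_re]
    nlinarith [sq_nonneg (f z).im]
  · intro x hx hx'
    obtain ⟨w, hw, h⟩ := hlim x hx hx'
    refine ⟨(w ^ 2).re, ?_⟩
    have : (((w ^ 2).re : ℝ) : ℂ) = w ^ 2 := by
      apply Complex.ext
      · simp
      · rw [sq, Complex.mul_im]; rcases h with h | h <;> simp [h]
    rw [this]
    exact hw.pow 2

/-- At a corner, where the real part vanishes on one side and the imaginary part on the other,
the function tends to `0`. -/
theorem tendsto_zero_of_corner {f : ℂ → ℂ} {x₀ r M : ℝ} (hr : 0 < r)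
    (hf : DifferentiableOn ℂ f (ball (x₀ : ℂ) r ∩ upper))
    (hM : ∀ z ∈ ball (x₀ : ℂ) r ∩ upper, |(f z).re| ≤ M)
    (hlim : ∀ x : ℝ, x ≠ x₀ → |x - x₀| < r →
      ∃ w : ℂ, Tendsto f (𝓝[upper] (x : ℂ)) (𝓝 w) ∧ (w.re = 0 ∨ w.im = 0))
    (hre : Tendsto (fun z => (f z).re) (𝓝[upper] (x₀ : ℂ)) (𝓝 0))
    {s : Set ℝ} (him : ∃ᶠ x in 𝓝[s] x₀, Tendsto (fun z => (f z).im) (𝓝[upper] ((x : ℝ) : ℂ)) (𝓝 0)) :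
    Tendsto f (𝓝[upper] (x₀ : ℂ)) (𝓝 0) := by
  obtain ⟨l, hl⟩ := exists_tendsto_sq hr hf hM hlim
  have h1 : Tendsto (fun z => (f z).im ^ 2) (𝓝[upper] (x₀ : ℂ)) (𝓝 (0 ^ 2 - l.re)) := by
    refine ((hre.pow 2).sub ((Complex.continuous_re.tendsto _).comp hl)).congr fun z => ?_
    simp only [Function.comp, sq (f z), Complex.mul_re]; ring
  have h2 : 0 ^ 2 - l.re = 0 := by
    refine le_antisymm (le_of_forall_pos_le_add fun ε hε => ?_)
      (ge_of_tendsto' h1 fun z => sq_nonneg _)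
    have : ∃ᶠ z in 𝓝[upper] (x₀ : ℂ), (f z).im ^ 2 < ε := by
      refine frequently_upper_of_frequently (him.mono fun x hx => ?_)
      have h3 := hx.pow 2
      exact (h3.eventually (gt_mem_nhds (by simpa using hε))).frequently
    have := isClosed_Iic.mem_of_frequently_of_tendsto (this.mono fun z hz => mem_Iic.2 hz.le) h1
    simpa using this
  rw [h2] at h1
  have h3 : Tendsto (fun z => (f z).im) (𝓝[upper] (x₀ : ℂ)) (𝓝 0) := by
    have := h1.sqrt
    simp only [Real.sqrt_sq_eq_abs, Real.sqrt_zero] at this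
    exact (tendsto_zero_iff_abs_tendsto_zero _).2 this
  rw [tendsto_zero_iff_norm_tendsto_zero]
  refine squeeze_zero (fun z => norm_nonneg _) (fun z => Complex.norm_le_abs_re_add_abs_im (f z)) ?_
  simpa using hre.abs.add h3.abs

/-- An isolated exceptional boundary point of an arc on which the real part vanishes is
removable. -/
theorem exists_tendsto_of_re_eq_zero {f : ℂ → ℂ} {x₀ r M : ℝ} (hr : 0 < r)
    (hf : DifferentiableOn ℂ f (ball (x₀ : ℂ) r ∩ upper))
    (hM : ∀ z ∈ ball (x₀ : ℂ) r ∩ upper, |(f z).re| ≤ M)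
    (hlim : ∀ x : ℝ, x ≠ x₀ → |x - x₀| < r →
      ∃ w : ℂ, Tendsto f (𝓝[upper] (x : ℂ)) (𝓝 w) ∧ w.re = 0) :
    ∃ l, Tendsto f (𝓝[upper] (x₀ : ℂ)) (𝓝 l) := by
  obtain ⟨l, hl⟩ := exists_tendsto_sq hr hf hM fun x hx hx' => by
    obtain ⟨w, hw, h⟩ := hlim x hx hx'
    exact ⟨w, hw, Or.inl h⟩
  -- `f` is recovered from `f ^ 2` and `(f - i) ^ 2`
  obtain ⟨l', hl'⟩ := exists_tendsto_sq (f := fun z => f z - Complex.I) (M := M) hr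
    (hf.sub_const _) (by simpa using hM) fun x hx hx' => by
    obtain ⟨w, hw, h⟩ := hlim x hx hx'
    exact ⟨w - Complex.I, hw.sub_const _, Or.inl (by simpa using h)⟩
  refine ⟨(l - l' - 1) / (2 * Complex.I), ?_⟩
  refine (((hl.sub hl').sub_const 1).div_const (2 * Complex.I)).congr fun z => ?_
  field_simp
  ring_nf
  simp [Complex.I_sq]

/-- If the real part is bounded and the boundary limits have imaginary part `c₁` to the left and
`c₂` to the right of `x₀`, then `c₁ = c₂` and there is a limit at `x₀`:
a jump would turn `exp (π (f - i c₁) / (c₂ - c₁))` into a function which is real on the boundary,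
is bounded and bounded away from `0`, and changes sign at `x₀`. -/
theorem exists_tendsto_of_im_locally_const {f : ℂ → ℂ} {x₀ r M c₁ c₂ : ℝ} (hr : 0 < r)
    (hf : DifferentiableOn ℂ f (ball (x₀ : ℂ) r ∩ upper))
    (hM : ∀ z ∈ ball (x₀ : ℂ) r ∩ upper, |(f z).re| ≤ M)
    (hl : ∀ x : ℝ, x < x₀ → |x - x₀| < r →
      ∃ w : ℂ, Tendsto f (𝓝[upper] (x : ℂ)) (𝓝 w) ∧ w.im = c₁)
    (hr' : ∀ x : ℝ, x₀ < x → |x - x₀| < r →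
      ∃ w : ℂ, Tendsto f (𝓝[upper] (x : ℂ)) (𝓝 w) ∧ w.im = c₂) :
    c₁ = c₂ ∧ ∃ l, Tendsto f (𝓝[upper] (x₀ : ℂ)) (𝓝 l) := by
  have hleft : ∃ᶠ x in 𝓝[<] x₀, |x - x₀| < r ∧ x < x₀ := by
    refine Eventually.frequently ?_
    filter_upwards [self_mem_nhdsWithin, mem_nhdsWithin_of_mem_nhds (ball_mem_nhds x₀ hr)]
      with x hx hx'
    exact ⟨by simpa [Real.dist_eq] using hx', hx⟩
  have hright : ∃ᶠ x in 𝓝[>] x₀, |x - x₀| < r ∧ x₀ < x := by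
    refine Eventually.frequently ?_
    filter_upwards [self_mem_nhdsWithin, mem_nhdsWithin_of_mem_nhds (ball_mem_nhds x₀ hr)]
      with x hx hx'
    exact ⟨by simpa [Real.dist_eq] using hx', hx⟩
  have hc : c₁ = c₂ := by
    by_contra hne
    have hne' : c₂ - c₁ ≠ 0 := sub_ne_zero.2 (Ne.symm hne)
    set a : ℝ := Real.pi / (c₂ - c₁) with ha
    have hre : ∀ w : ℂ, ((a : ℂ) * (w - c₁ * Complex.I)).re = a * w.re := by intro w; simp
    have him : ∀ w : ℂ, ((a : ℂ) * (w - c₁ * Complex.I)).im = a * (w.im - c₁) := by intro w; simp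
    set g : ℂ → ℂ := fun z => Complex.exp ((a : ℂ) * (f z - c₁ * Complex.I)) with hg
    have hM' : ∀ z ∈ ball (x₀ : ℂ) r ∩ upper, |a * (f z).re| ≤ |a| * M := fun z hz => by
      rw [abs_mul]; exact mul_le_mul_of_nonneg_left (hM z hz) (abs_nonneg _)
    have hMw : ∀ x : ℝ, |x - x₀| < r → ∀ w, Tendsto f (𝓝[upper] (x : ℂ)) (𝓝 w) →
        Real.exp (-(|a| * M)) ≤ Real.exp (a * w.re) := by
      intro x hx w hw
      have h1 : |a * w.re| ≤ |a| * M := by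
        have h2 : Tendsto (fun z => |a * (f z).re|) (𝓝[upper] (x : ℂ)) (𝓝 |a * w.re|) :=
          (((Complex.continuous_re.tendsto w).comp hw).const_mul a).abs
        refine le_of_tendsto h2 ?_
        have hxb : (x : ℂ) ∈ ball (x₀ : ℂ) r := by
          rw [mem_ball, dist_eq_norm, ← Complex.ofReal_sub, Complex.norm_real]; exact hx
        filter_upwards [self_mem_nhdsWithin, mem_nhdsWithin_of_mem_nhds (isOpen_ball.mem_nhds hxb)]
          with z hz hz'
        exact hM' z ⟨hz', hz⟩
      exact Real.exp_le_exp.2 (neg_le_of_abs_le h1)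
    have hgl : ∀ x : ℝ, |x - x₀| < r → ∀ w, Tendsto f (𝓝[upper] (x : ℂ)) (𝓝 w) →
        Tendsto g (𝓝[upper] (x : ℂ)) (𝓝 (Complex.exp ((a : ℂ) * (w - c₁ * Complex.I)))) :=
      fun x hx w hw => (Complex.continuous_exp.tendsto _).comp ((hw.sub_const _).const_mul _)
    have e1 : ∀ w : ℂ, w.im = c₁ →
        Complex.exp ((a : ℂ) * (w - c₁ * Complex.I)) = ((Real.exp (a * w.re) : ℝ) : ℂ) := by
      intro w hw
      rw [Complex.ofReal_exp]; congr 1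
      apply Complex.ext
      · rw [hre]; simp
      · rw [him, hw]; simp
    have e2 : ∀ w : ℂ, w.im = c₂ →
        Complex.exp ((a : ℂ) * (w - c₁ * Complex.I)) = ((-Real.exp (a * w.re) : ℝ) : ℂ) := by
      intro w hw
      have : (a : ℂ) * (w - c₁ * Complex.I) = ((a * w.re : ℝ) : ℂ) + Real.pi * Complex.I := by
        apply Complex.ext
        · rw [hre]; simp
        · have : a * (c₂ - c₁) = Real.pi := by rw [ha]; field_simp
          rw [him, hw, this]; simp
      rw [this, Complex.exp_add, Complex.exp_pi_mul_I]
      push_cast; ring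
    obtain ⟨l, hl'⟩ := exists_tendsto_of_real_boundary (f := g) (M := Real.exp (|a| * M)) hr
      (((hf.sub_const _).const_mul _).cexp)
      (by
        intro z hz
        refine (Complex.re_le_norm _).trans ?_
        rw [hg]; simp only
        rw [Complex.norm_exp, hre]
        exact Real.exp_le_exp.2 (le_of_abs_le (hM' z hz)))
      (by
        intro x hx hx'
        rcases lt_or_gt_of_ne hx with h | h
        · obtain ⟨w, hw, hwc⟩ := hl x h hx'
          exact ⟨_, e1 w hwc ▸ hgl x hx' w hw⟩
        · obtain ⟨w, hw, hwc⟩ := hr' x h hx'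
          exact ⟨_, e2 w hwc ▸ hgl x hx' w hw⟩)
    have hlre : Tendsto (fun z => (g z).re) (𝓝[upper] (x₀ : ℂ)) (𝓝 l.re) :=
      (Complex.continuous_re.tendsto _).comp hl'
    set m := Real.exp (-(|a| * M)) with hm
    have hmpos : 0 < m := Real.exp_pos _
    have h1 : m / 2 ≤ l.re := by
      have : ∃ᶠ z in 𝓝[upper] (x₀ : ℂ), m / 2 < (g z).re := by
        refine frequently_upper_of_frequently (hleft.mono fun x hx => ?_)
        obtain ⟨w, hw, hwc⟩ := hl x hx.2 hx.1
        have h3 := (Complex.continuous_re.tendsto _).comp (hgl x hx.1 w hw)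
        rw [e1 w hwc, Complex.ofReal_re] at h3
        exact (h3.eventually (lt_mem_nhds (by linarith [hMw x hx.1 w hw]))).frequently
      exact isClosed_Ici.mem_of_frequently_of_tendsto (this.mono fun z hz => mem_Ici.2 hz.le) hlre
    have h2 : l.re ≤ -(m / 2) := by
      have : ∃ᶠ z in 𝓝[upper] (x₀ : ℂ), (g z).re < -(m / 2) := by
        refine frequently_upper_of_frequently (hright.mono fun x hx => ?_)
        obtain ⟨w, hw, hwc⟩ := hr' x hx.2 hx.1
        have h3 := (Complex.continuous_re.tendsto _).comp (hgl x hx.1 w hw)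
        rw [e2 w hwc, Complex.ofReal_re] at h3
        exact (h3.eventually (gt_mem_nhds (by linarith [hMw x hx.1 w hw]))).frequently
      exact isClosed_Iic.mem_of_frequently_of_tendsto (this.mono fun z hz => mem_Iic.2 hz.le) hlre
    linarith
  refine ⟨hc, ?_⟩
  obtain ⟨l, hl'⟩ := exists_tendsto_of_real_boundary (f := fun z => f z - c₁ * Complex.I) (M := M) hr
    (hf.sub_const _) (fun z hz => by simpa using le_of_abs_le (hM z hz)) fun x hx hx' => by
      have : ∃ w : ℂ, Tendsto f (𝓝[upper] (x : ℂ)) (𝓝 w) ∧ w.im = c₁ := by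
        rcases lt_or_gt_of_ne hx with h | h
        · exact hl x h hx'
        · rw [hc]; exact hr' x h hx'
      obtain ⟨w, hw, hwc⟩ := this
      refine ⟨w.re, ?_⟩
      have e : ((w.re : ℝ) : ℂ) = w - c₁ * Complex.I := by
        apply Complex.ext <;> simp [hwc]
      rw [e]
      exact hw.sub_const _
  exact ⟨l + c₁ * Complex.I, (hl'.add_const (c₁ * Complex.I)).congr fun z => by ring⟩

/-- Reflection for a function whose boundary values on a real interval are real. -/
theorem exists_reflection_ball {f : ℂ → ℂ} {x₀ r : ℝ}
    (hf : DifferentiableOn ℂ f (ball (x₀ : ℂ) r ∩ upper))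
    (hlim : ∀ x : ℝ, |x - x₀| < r → ∃ y : ℝ, Tendsto f (𝓝[upper] (x : ℂ)) (𝓝 (y : ℂ))) :
    ∃ F : ℂ → ℂ, DifferentiableOn ℂ F (ball (x₀ : ℂ) r) ∧ EqOn F f (ball (x₀ : ℂ) r ∩ upper) ∧
      ∀ z ∈ ball (x₀ : ℂ) r, F ((starRingEnd ℂ) z) = (starRingEnd ℂ) (F z) := by
  refine exists_reflection isOpen_ball ?_ hf ?_
  · intro z hz
    rw [mem_ball, dist_eq_norm] at hz ⊢
    rw [← Complex.norm_conj]; simpa using hz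
  · intro x hx
    rw [mem_ball, dist_eq_norm, ← Complex.ofReal_sub, Complex.norm_real] at hx
    exact hlim x hx

/-- Where the real part vanishes on the boundary and is nonpositive inside, the boundary values
of the imaginary part are nondecreasing. -/
theorem hasDerivAt_im_boundary_nonneg {f : ℂ → ℂ} {x₀ r : ℝ} (hr : 0 < r) {V : ℝ → ℝ}
    (hf : DifferentiableOn ℂ f (ball (x₀ : ℂ) r ∩ upper))
    (hneg : ∀ z ∈ ball (x₀ : ℂ) r ∩ upper, (f z).re ≤ 0)
    (hlim : ∀ x : ℝ, |x - x₀| < r → Tendsto f (𝓝[upper] (x : ℂ)) (𝓝 (V x * Complex.I))) :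
    ∃ V' : ℝ, 0 ≤ V' ∧ HasDerivAt V V' x₀ := by
  obtain ⟨F, hFd, hFf, -⟩ := exists_reflection_ball (f := fun z => -Complex.I * f z) (hf.const_mul _)
    fun x hx => ⟨V x, by
      have := (hlim x hx).const_mul (-Complex.I)
      convert this using 2
      ring_nf; simp⟩
  have hFx : ∀ x : ℝ, |x - x₀| < r → F x = V x := by
    intro x hx
    have hxb : (x : ℂ) ∈ ball (x₀ : ℂ) r := by
      rw [mem_ball, dist_eq_norm, ← Complex.ofReal_sub, Complex.norm_real]; exact hx
    have h1 : Tendsto F (𝓝[upper] (x : ℂ)) (𝓝 (F x)) :=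
      ((hFd.differentiableAt (isOpen_ball.mem_nhds hxb)).continuousAt).tendsto.mono_left
        nhdsWithin_le_nhds
    have h2 : Tendsto F (𝓝[upper] (x : ℂ)) (𝓝 (-Complex.I * (V x * Complex.I))) := by
      refine ((hlim x hx).const_mul (-Complex.I)).congr' ?_
      filter_upwards [self_mem_nhdsWithin, mem_nhdsWithin_of_mem_nhds (isOpen_ball.mem_nhds hxb)]
        with z hz hz'
      exact (hFf ⟨hz', hz⟩).symm
    rw [tendsto_nhds_unique h1 h2]
    ring_nf; simp
  have hd : HasDerivAt F (deriv F x₀) (x₀ : ℂ) :=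
    (hFd.differentiableAt (ball_mem_nhds _ hr)).hasDerivAt
  refine ⟨(deriv F x₀).re, ?_, ?_⟩
  · -- the imaginary part of `F` is nonnegative above the axis and vanishes on it
    have hline : HasDerivAt (fun y : ℝ => (x₀ : ℂ) + y * Complex.I) Complex.I 0 := by
      simpa using ((Complex.ofRealCLM.hasDerivAt (x := (0 : ℝ))).mul_const Complex.I).const_add (x₀ : ℂ)
    have hd' : HasDerivAt F (deriv F x₀) ((x₀ : ℂ) + ((0 : ℝ) : ℂ) * Complex.I) := by simpa using hd
    have hc : HasDerivAt (fun y : ℝ => F ((x₀ : ℂ) + y * Complex.I)) (deriv F x₀ * Complex.I) 0 :=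
      hd'.comp (0 : ℝ) hline
    have hc2 : HasDerivAt (fun y : ℝ => (F ((x₀ : ℂ) + y * Complex.I)).im) (deriv F x₀).re 0 := by
      have := Complex.imCLM.hasFDerivAt.comp_hasDerivAt (0 : ℝ) hc
      simpa [Function.comp_def] using this
    have hs := hasDerivAt_iff_tendsto_slope.1 hc2
    have hs' : Tendsto (slope (fun y : ℝ => (F ((x₀ : ℂ) + y * Complex.I)).im) 0) (𝓝[>] 0)
        (𝓝 (deriv F x₀).re) := hs.mono_left (nhdsWithin_mono _ fun y hy => ne_of_gt hy)
    refine ge_of_tendsto hs' ?_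
    filter_upwards [Ioo_mem_nhdsGT hr] with y hy
    have hyb : (x₀ : ℂ) + y * Complex.I ∈ ball (x₀ : ℂ) r ∩ upper := by
      refine ⟨?_, by simpa using hy.1⟩
      rw [mem_ball, dist_eq_norm]; simp [abs_of_pos hy.1, hy.2]
    have h1 := hneg _ hyb
    rw [slope_def_field, hFf hyb]
    have h2 : F ((x₀ : ℂ) + ((0 : ℝ) : ℂ) * Complex.I) = V x₀ := by
      simpa using hFx x₀ (by simpa using hr)
    rw [h2]
    simp only [neg_mul, Complex.neg_im, Complex.mul_im, Complex.I_re, Complex.I_im, zero_mul,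
      one_mul, zero_add, Complex.ofReal_im, sub_zero]
    exact div_nonneg (by linarith) hy.1.le
  · have h1 : HasDerivAt (fun x : ℝ => (F (x : ℂ)).re) (deriv F x₀).re x₀ := hd.real_of_complex
    refine h1.congr_of_eventuallyEq ?_
    filter_upwards [ball_mem_nhds x₀ hr] with x hx
    rw [hFx x (by simpa [Real.dist_eq] using hx), Complex.ofReal_re]

/-! ### The unit disk seen from the upper half-plane -/

/-- The covering `z ↦ exp (i z)` of the punctured unit disk by the upper half-plane; it maps the
real axis to the unit circle and serves as a chart of the closed disk near boundary points. -/
def discChart (z : ℂ) : ℂ := Complex.exp (z * Complex.I)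

theorem discChart_ofReal (t : ℝ) : discChart t = circlePt t := rfl

theorem differentiable_discChart : Differentiable ℂ discChart := by
  unfold discChart; fun_prop

theorem discChart_mem_ball {z : ℂ} : discChart z ∈ ball (0 : ℂ) 1 ↔ z ∈ upper := by
  rw [mem_ball_zero_iff, discChart, Complex.norm_exp, Real.exp_lt_one_iff]
  simp

theorem discChart_preimage_ball : discChart ⁻¹' ball 0 1 = upper := by
  ext z; exact discChart_mem_ball

theorem map_discChart_nhdsWithin (t : ℝ) :
    map discChart (𝓝[upper] (t : ℂ)) = 𝓝[ball 0 1] (circlePt t) := by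
  have hd : HasStrictDerivAt discChart (Complex.exp (t * Complex.I) * Complex.I) (t : ℂ) := by
    have h := (hasStrictDerivAt_id (t : ℂ)).mul_const Complex.I
    rw [one_mul] at h
    exact h.cexp
  have hmap := hd.map_nhds_eq (mul_ne_zero (Complex.exp_ne_zero _) Complex.I_ne_zero)
  rw [nhdsWithin, ← discChart_preimage_ball, Filter.map_inf_principal_preimage, hmap,
    discChart_ofReal, nhdsWithin]

theorem tendsto_comp_discChart {α : Type*} {f : ℂ → α} {l : Filter α} {t : ℝ} :
    Tendsto (fun z => f (discChart z)) (𝓝[upper] (t : ℂ)) l ↔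
      Tendsto f (𝓝[ball 0 1] (circlePt t)) l := by
  rw [← map_discChart_nhdsWithin, tendsto_map'_iff]; rfl

theorem norm_circlePt (t : ℝ) : ‖circlePt t‖ = 1 := Complex.norm_exp_ofReal_mul_I t

theorem circlePt_mem_closedBall (t : ℝ) : circlePt t ∈ closedBall (0 : ℂ) 1 := by
  simp [norm_circlePt]

theorem continuous_circlePt : Continuous circlePt := by unfold circlePt; fun_prop

theorem exists_circlePt_eq {ζ : ℂ} (h : ‖ζ‖ = 1) : ∃ t : ℝ, circlePt t = ζ :=
  ⟨ζ.arg, by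
    have := Complex.norm_mul_exp_arg_mul_I ζ
    rwa [h, Complex.ofReal_one, one_mul] at this⟩

theorem circlePt_add_two_pi (t : ℝ) : circlePt (t + 2 * Real.pi) = circlePt t := by
  simp only [circlePt, Complex.ofReal_add, add_mul, Complex.exp_add]
  simp [Complex.exp_two_pi_mul_I]

theorem exists_circlePt_eq_Ico {ζ : ℂ} (h : ‖ζ‖ = 1) (a : ℝ) :
    ∃ t ∈ Ico a (a + 2 * Real.pi), circlePt t = ζ := by
  obtain ⟨s, hs⟩ := exists_circlePt_eq h
  have hp : Function.Periodic circlePt (2 * Real.pi) := circlePt_add_two_pi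
  obtain ⟨t, ht, e⟩ := hp.exists_mem_Ico Real.two_pi_pos s a
  exact ⟨t, ht, e ▸ hs⟩

theorem differentiableOn_comp_discChart {f : ℂ → ℂ} (hf : DifferentiableOn ℂ f (ball 0 1)) :
    DifferentiableOn ℂ (fun z => f (discChart z)) upper :=
  hf.comp differentiable_discChart.differentiableOn fun _ hz => discChart_mem_ball.2 hz

/-- If the real part of a holomorphic function on a connected open set has an interior maximum,
it is constant. -/
theorem re_eq_of_isMaxOn {f : ℂ → ℂ} {U : Set ℂ} {c : ℂ} (hU : IsPreconnected U) (ho : IsOpen U)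
    (hf : DifferentiableOn ℂ f U) (hc : c ∈ U) (hm : ∀ z ∈ U, (f z).re ≤ (f c).re) :
    ∀ z ∈ U, (f z).re = (f c).re := by
  have h : EqOn (fun z => Complex.exp (f z)) (Function.const ℂ (Complex.exp (f c))) U := by
    refine Complex.eqOn_of_isPreconnected_of_isMaxOn_norm hU ho hf.cexp hc ?_
    intro z hz
    simp only [mem_ofPred_eq, Function.comp_apply, Complex.norm_exp]
    exact Real.exp_le_exp.2 (hm z hz)
  intro z hz
  have h1 := congrArg norm (h hz)
  simp only [Function.const_apply, Complex.norm_exp] at h1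
  exact Real.exp_injective h1

/-- Maximum principle for a mixed boundary value problem in the disk. Where the conjugate
function is locally constant on the circle, the solution continues by reflection, so that it
cannot have a positive maximum there. -/
theorem nonpos_of_mixed_boundary {f : ℂ → ℂ} {h : ℂ → ℝ} (hf : DifferentiableOn ℂ f (ball 0 1))
    (hc : ContinuousOn h (closedBall 0 1)) (hre : ∀ ζ ∈ ball (0 : ℂ) 1, (f ζ).re = h ζ)
    (hbd : ∀ t : ℝ, h (circlePt t) = 0 ∨ ∃ r > 0, ∃ c₁ c₂ : ℝ,
      (∀ x : ℝ, x < t → |x - t| < r →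
        Tendsto (fun ζ => (f ζ).im) (𝓝[ball 0 1] (circlePt x)) (𝓝 c₁)) ∧
      (∀ x : ℝ, t < x → |x - t| < r →
        Tendsto (fun ζ => (f ζ).im) (𝓝[ball 0 1] (circlePt x)) (𝓝 c₂)))
    (hex : ∃ t, h (circlePt t) = 0) :
    ∀ ζ ∈ closedBall (0 : ℂ) 1, h ζ ≤ 0 := by
  obtain ⟨ζ₀, hζ₀, hmax⟩ := (isCompact_closedBall (0 : ℂ) 1).exists_isMaxOn
    ⟨0, by simp⟩ hc
  by_contra! hcon
  obtain ⟨ζ₁, hζ₁, hpos⟩ := hcon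
  have hM : 0 < h ζ₀ := hpos.trans_le (hmax hζ₁)
  -- the maximum is not attained inside
  have hin : ∀ ζ ∈ ball (0 : ℂ) 1, h ζ ≠ h ζ₀ := by
    intro ζ hζ he
    have hconst := re_eq_of_isMaxOn (convex_ball (0 : ℂ) 1).isPreconnected isOpen_ball hf hζ
      fun z hz => by
        rw [hre z hz, hre ζ hζ, he]; exact hmax (ball_subset_closedBall hz)
    obtain ⟨t, ht⟩ := hex
    have h1 : Tendsto h (𝓝[ball 0 1] (circlePt t)) (𝓝 0) := by
      have := (hc _ (circlePt_mem_closedBall t)).mono_left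
        (nhdsWithin_mono _ ball_subset_closedBall)
      rwa [ht] at this
    have h2 : Tendsto h (𝓝[ball 0 1] (circlePt t)) (𝓝 (h ζ₀)) := by
      refine tendsto_const_nhds.congr' ?_
      filter_upwards [self_mem_nhdsWithin] with z hz
      rw [← hre z hz, hconst z hz, hre ζ hζ, he]
    have : (𝓝[ball 0 1] (circlePt t)).NeBot := by
      rw [← map_discChart_nhdsWithin]; infer_instance
    exact hM.ne (tendsto_nhds_unique h1 h2)
  have hsph : ‖ζ₀‖ = 1 := by
    by_contra hne
    exact hin ζ₀ (mem_ball_zero_iff.2 (lt_of_le_of_ne (mem_closedBall_zero_iff.1 hζ₀) hne)) rfl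
  obtain ⟨t, rfl⟩ := exists_circlePt_eq hsph
  rcases hbd t with h0 | ⟨r, hr, c₁, c₂, hl, hr'⟩
  · exact hM.ne' h0
  set g : ℂ → ℂ := fun z => f (discChart z) with hg
  have hgd : DifferentiableOn ℂ g upper := differentiableOn_comp_discChart hf
  have hgre : ∀ x : ℝ, Tendsto (fun z => (g z).re) (𝓝[upper] (x : ℂ)) (𝓝 (h (circlePt x))) := by
    intro x
    refine tendsto_comp_discChart (f := fun ζ => (f ζ).re).2 ?_
    refine ((hc _ (circlePt_mem_closedBall x)).mono_left
        (nhdsWithin_mono _ ball_subset_closedBall)).congr' ?_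
    filter_upwards [self_mem_nhdsWithin] with z hz
    exact (hre z hz).symm
  obtain ⟨B, hB⟩ := (isCompact_closedBall (0 : ℂ) 1).exists_bound_of_continuousOn hc
  have hgM : ∀ z ∈ upper, |(g z).re| ≤ B := fun z hz => by
    have := discChart_mem_ball.2 hz
    rw [hg]; simp only
    rw [hre _ this]; exact hB _ (ball_subset_closedBall this)
  have hcomb : ∀ (x c : ℝ), Tendsto (fun ζ => (f ζ).im) (𝓝[ball 0 1] (circlePt x)) (𝓝 c) →
      Tendsto g (𝓝[upper] (x : ℂ)) (𝓝 ((h (circlePt x) : ℂ) + c * Complex.I)) := by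
    intro x c hx
    have h1 := tendsto_comp_discChart (f := fun ζ => (f ζ).im).2 hx
    have h2 := (((Complex.continuous_ofReal.tendsto _).comp (hgre x)).add
      (((Complex.continuous_ofReal.tendsto _).comp h1).mul_const Complex.I))
    exact h2.congr fun z => Complex.re_add_im (g z)
  obtain ⟨hcc, l, hlim⟩ := exists_tendsto_of_im_locally_const (f := g) (x₀ := t) (M := B) (c₁ := c₁)
    (c₂ := c₂) hr
    (hgd.mono inter_subset_right) (fun z hz => hgM z hz.2)
    (fun x hx hx' => ⟨_, hcomb x c₁ (hl x hx hx'), by simp⟩)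
    (fun x hx hx' => ⟨_, hcomb x c₂ (hr' x hx hx'), by simp⟩)
  have hgim : ∀ x : ℝ, |x - t| < r → Tendsto g (𝓝[upper] (x : ℂ)) (𝓝 ((h (circlePt x) : ℂ) + c₁ * Complex.I)) := by
    intro x hx
    rcases lt_trichotomy x t with hxt | hxt | hxt
    · exact hcomb x c₁ (hl x hxt hx)
    · subst hxt
      have h1 : l.re = h (circlePt x) :=
        tendsto_nhds_unique ((Complex.continuous_re.tendsto _).comp hlim) (hgre x)
      have h2 : l.im = c₁ := by
        have h3 : Tendsto (fun z => (g z).im) (𝓝[upper] (x : ℂ)) (𝓝 l.im) :=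
          (Complex.continuous_im.tendsto _).comp hlim
        refine eq_of_forall_dist_le fun ε hε => ?_
        have : ∃ᶠ z in 𝓝[upper] (x : ℂ), dist (g z).im c₁ < ε := by
          refine frequently_upper_of_frequently (s := Iio x) (Eventually.frequently ?_)
          filter_upwards [self_mem_nhdsWithin, mem_nhdsWithin_of_mem_nhds (ball_mem_nhds x hr)]
            with y hy hy'
          have h4 := tendsto_comp_discChart (f := fun ζ => (f ζ).im).2
            (hl y hy (by simpa [Real.dist_eq] using hy'))
          exact (h4.eventually (ball_mem_nhds c₁ hε)).frequently
        have hcl : IsClosed {y : ℝ | dist y c₁ ≤ ε} := isClosed_le (by fun_prop) continuous_const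
        exact hcl.mem_of_frequently_of_tendsto (this.mono fun z hz => le_of_lt hz) h3
      rwa [show ((h (circlePt x) : ℂ) + c₁ * Complex.I) = l by rw [← h1, ← h2, Complex.re_add_im]]
    · exact hcomb x c₁ (by rw [hcc]; exact hr' x hxt hx)
  -- by reflection the boundary maximum becomes an interior one
  obtain ⟨F, hFd, hFg, hFs⟩ := exists_reflection_ball (f := fun z => g z - c₁ * Complex.I) (x₀ := t)
    (r := r) ((hgd.mono inter_subset_right).sub_const _)
    (fun x hx => ⟨h (circlePt x), by simpa using (hgim x hx).sub_const (c₁ * Complex.I)⟩)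
  have hFre : ∀ z ∈ ball (t : ℂ) r ∩ upper, (F z).re = h (discChart z) := by
    intro z hz
    rw [hFg hz, ← hre _ (discChart_mem_ball.2 hz.2)]; simp [hg]
  have hup : ∀ z ∈ ball (t : ℂ) r ∩ upper, (F z).re ≤ h (circlePt t) := by
    intro z hz
    rw [hFre z hz]
    exact hmax (ball_subset_closedBall (discChart_mem_ball.2 hz.2))
  have hFx : ∀ x : ℝ, |x - t| < r → (F x).re = h (circlePt x) := by
    intro x hx
    have hxb : (x : ℂ) ∈ ball (t : ℂ) r := by
      rw [mem_ball, dist_eq_norm, ← Complex.ofReal_sub, Complex.norm_real]; exact hx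
    have h1 : Tendsto (fun z => (F z).re) (𝓝[upper] (x : ℂ)) (𝓝 (F x).re) :=
      (Complex.continuous_re.tendsto _).comp
        ((hFd.differentiableAt (isOpen_ball.mem_nhds hxb)).continuousAt.tendsto.mono_left
          nhdsWithin_le_nhds)
    refine tendsto_nhds_unique h1 ((hgre x).congr' ?_)
    filter_upwards [self_mem_nhdsWithin, mem_nhdsWithin_of_mem_nhds (isOpen_ball.mem_nhds hxb)]
      with z hz hz'
    rw [hFg ⟨hz', hz⟩]; simp
  have hFmax : ∀ z ∈ ball (t : ℂ) r, (F z).re ≤ (F t).re := by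
    intro z hz
    rw [hFx t (by simpa using hr)]
    rcases lt_trichotomy z.im 0 with hz0 | hz0 | hz0
    · have hz2 : (starRingEnd ℂ) z ∈ ball (t : ℂ) r := by
        rw [mem_ball, dist_eq_norm] at hz ⊢
        rw [← Complex.norm_conj]; simpa using hz
      have := hup _ ⟨hz2, by simpa using hz0⟩
      rwa [hFs z hz, Complex.conj_re] at this
    · have hz' : z = (z.re : ℂ) := Complex.ext (by simp) (by simp [hz0])
      rw [hz', mem_ball, dist_eq_norm, ← Complex.ofReal_sub, Complex.norm_real] at hz
      rw [hz', hFx z.re hz]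
      exact hmax (circlePt_mem_closedBall _)
    · exact hup z ⟨hz, hz0⟩
  have hFc := re_eq_of_isMaxOn (convex_ball (t : ℂ) r).isPreconnected isOpen_ball hFd
    (mem_ball_self hr) hFmax
  have hz : (t : ℂ) + ((r / 2 : ℝ) : ℂ) * Complex.I ∈ ball (t : ℂ) r ∩ upper := by
    refine ⟨?_, by simpa using hr⟩
    rw [mem_ball, dist_eq_norm, add_sub_cancel_left, norm_mul, Complex.norm_real, Complex.norm_I,
      Real.norm_of_nonneg (by positivity)]
    linarith
  refine hin _ (discChart_mem_ball.2 hz.2) ?_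
  rw [← hFre _ hz, hFc _ hz.1, hFx t (by simpa using hr)]

/-! ### A univalence criterion -/

/-- The open strip `0 < Im s < π`. -/
abbrev strip : Set ℂ := Complex.im ⁻¹' Ioo 0 Real.pi

theorem convex_strip : Convex ℝ strip :=
  (convex_Ioo (0 : ℝ) Real.pi).linear_preimage Complex.imLm

theorem isOpen_strip : IsOpen strip := isOpen_Ioo.preimage Complex.continuous_im

/-- In a half-plane below the real axis the argument increases from left to right. -/
theorem arg_sub_le_arg_sub {k : ℂ} (hk : 0 < k.im) {x y : ℝ} (hxy : x ≤ y) :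
    ((x : ℂ) - k).arg ≤ ((y : ℂ) - k).arg := by
  by_contra! hlt
  set z := (x : ℂ) - k with hz
  set w := (y : ℂ) - k with hw
  have hzi : z.im = -k.im := by simp [hz]
  have hwi : w.im = -k.im := by simp [hw]
  have hz0 : z ≠ 0 := fun h => by rw [h] at hzi; simp at hzi; linarith
  have hw0 : w ≠ 0 := fun h => by rw [h] at hwi; simp at hwi; linarith
  have h1 : z.arg < 0 := Complex.arg_neg_iff.2 (by linarith)
  have h2 := Complex.neg_pi_lt_arg w
  have hs : 0 < Real.sin (z.arg - w.arg) :=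
    Real.sin_pos_of_pos_of_lt_pi (by linarith) (by linarith)
  rw [Real.sin_sub, Complex.sin_arg, Complex.sin_arg, Complex.cos_arg hz0, Complex.cos_arg hw0,
    hzi, hwi] at hs
  have hre : z.re = x - k.re := by simp [hz]
  have hre' : w.re = y - k.re := by simp [hw]
  have hnz := norm_pos_iff.2 hz0
  have hnw := norm_pos_iff.2 hw0
  have : -k.im / ‖z‖ * (w.re / ‖w‖) - z.re / ‖z‖ * (-k.im / ‖w‖)
      = k.im * (x - y) / (‖z‖ * ‖w‖) := by
    rw [hre, hre']; field_simp; ring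
  rw [this] at hs
  have : k.im * (x - y) / (‖z‖ * ‖w‖) ≤ 0 :=
    div_nonpos_of_nonpos_of_nonneg (mul_nonpos_of_nonneg_of_nonpos hk.le (by linarith))
      (by positivity)
  linarith

/-- A Möbius map of the upper half-plane onto the disk, read on the strip. -/
def stripChart (q k : ℂ) (s : ℂ) : ℂ :=
  q * ((Complex.exp s - k) / (Complex.exp s - (starRingEnd ℂ) k))

section StripChart

variable {q k : ℂ}

theorem sub_conj_ne_zero (hk : 0 < k.im) {w : ℂ} (hw : 0 ≤ w.im) :
    w - (starRingEnd ℂ) k ≠ 0 := by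
  intro h
  have := congrArg Complex.im h
  simp at this
  linarith

theorem exp_im_nonneg {s : ℂ} (hs : s.im ∈ Icc 0 Real.pi) : 0 ≤ (Complex.exp s).im := by
  rw [Complex.exp_im]
  exact mul_nonneg (Real.exp_pos _).le (Real.sin_nonneg_of_mem_Icc hs)

theorem differentiableAt_stripChart (hk : 0 < k.im) {s : ℂ} (hs : s.im ∈ Icc 0 Real.pi) :
    DifferentiableAt ℂ (stripChart q k) s := by
  unfold stripChart
  have := sub_conj_ne_zero hk (exp_im_nonneg hs)
  fun_prop (disch := assumption)

theorem normSq_sub_conj (k w : ℂ) :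
    ‖w - (starRingEnd ℂ) k‖ ^ 2 = ‖w - k‖ ^ 2 + 4 * (w.im * k.im) := by
  simp only [← Complex.normSq_eq_norm_sq, Complex.normSq_apply, Complex.sub_re, Complex.sub_im,
    Complex.conj_re, Complex.conj_im]
  ring

theorem stripChart_mem_closedBall (hq : ‖q‖ = 1) (hk : 0 < k.im) {s : ℂ}
    (hs : s.im ∈ Icc 0 Real.pi) : stripChart q k s ∈ closedBall (0 : ℂ) 1 := by
  have h0 := sub_conj_ne_zero hk (exp_im_nonneg hs)
  rw [mem_closedBall_zero_iff, stripChart, norm_mul, hq, one_mul, norm_div,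
    div_le_one (norm_pos_iff.2 h0)]
  refine le_of_sq_le_sq ?_ (norm_nonneg _)
  rw [normSq_sub_conj]
  have := mul_nonneg (exp_im_nonneg hs) hk.le
  linarith

theorem stripChart_mem_ball (hq : ‖q‖ = 1) (hk : 0 < k.im) {s : ℂ} (hs : s ∈ strip) :
    stripChart q k s ∈ ball (0 : ℂ) 1 := by
  have hs' : s.im ∈ Icc 0 Real.pi := Ioo_subset_Icc_self hs
  have h0 := sub_conj_ne_zero hk (exp_im_nonneg hs')
  rw [mem_ball_zero_iff, stripChart, norm_mul, hq, one_mul, norm_div,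
    div_lt_one (norm_pos_iff.2 h0)]
  refine lt_of_pow_lt_pow_left₀ 2 (norm_nonneg _) ?_
  rw [normSq_sub_conj]
  have h1 : 0 < (Complex.exp s).im := by
    rw [Complex.exp_im]
    exact mul_pos (Real.exp_pos _) (Real.sin_pos_of_mem_Ioo hs)
  have := mul_pos h1 hk
  linarith

theorem exists_stripChart_eq (hq : ‖q‖ = 1) (hk : 0 < k.im) {ζ : ℂ} (hζ : ζ ∈ ball (0 : ℂ) 1) :
    ∃ s ∈ strip, stripChart q k s = ζ := by
  rw [mem_ball_zero_iff] at hζ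
  have hqζ : q - ζ ≠ 0 := by
    intro h
    rw [← sub_eq_zero.1 h, hq] at hζ
    exact lt_irrefl _ hζ
  set w := (q * k - ζ * (starRingEnd ℂ) k) / (q - ζ) with hw
  have hkk : k - (starRingEnd ℂ) k ≠ 0 := fun h => by
    have := congrArg Complex.im h
    simp at this
    linarith
  have hq0 : q ≠ 0 := fun h => by simp [h] at hq
  have h1 : w - (starRingEnd ℂ) k = q * (k - (starRingEnd ℂ) k) / (q - ζ) := by
    rw [hw]; field_simp; ring
  have h2 : w - k = ζ * (k - (starRingEnd ℂ) k) / (q - ζ) := by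
    rw [hw]; field_simp; ring
  have h3 : q * ((w - k) / (w - (starRingEnd ℂ) k)) = ζ := by
    rw [h1, h2]; field_simp
  have him : 0 < w.im := by
    have h4 := normSq_sub_conj k w
    have h5 : ‖w - k‖ < ‖w - (starRingEnd ℂ) k‖ := by
      rw [h1, h2, norm_div, norm_div, norm_mul, norm_mul, hq, one_mul]
      have a1 := norm_pos_iff.2 hkk
      have a2 := norm_pos_iff.2 hqζ
      gcongr
      nlinarith
    have h6 : ‖w - k‖ ^ 2 < ‖w - (starRingEnd ℂ) k‖ ^ 2 :=
      pow_lt_pow_left₀ h5 (norm_nonneg _) two_ne_zero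
    have h7 : 0 < w.im * k.im := by linarith
    exact pos_of_mul_pos_left h7 hk.le
  have hw0 : w ≠ 0 := fun h => by rw [h] at him; simp at him
  refine ⟨Complex.log w, ?_, ?_⟩
  · change (Complex.log w).im ∈ Ioo 0 Real.pi
    rw [Complex.log_im]
    refine ⟨lt_of_le_of_ne (Complex.arg_nonneg_iff.2 him.le) fun h => ?_,
      Complex.arg_lt_pi_iff.2 (Or.inr him.ne')⟩
    have := Complex.arg_eq_zero_iff.1 h.symm
    linarith [this.2]
  · rw [stripChart, Complex.exp_log hw0, h3]

/-- On the boundary of the strip the chart runs through the unit circle. -/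
theorem stripChart_boundary {b : ℝ} (hk : 0 < k.im) {s : ℂ} {w : ℝ} (hs : Complex.exp s = w) :
    stripChart (circlePt b) k s = circlePt (b + 2 * ((w : ℂ) - k).arg) := by
  have h0 : (w : ℂ) - k ≠ 0 := fun h => by
    have := congrArg Complex.im h
    simp at this
    linarith
  have hconj : (w : ℂ) - (starRingEnd ℂ) k = (starRingEnd ℂ) ((w : ℂ) - k) := by simp
  have e := Complex.norm_mul_exp_arg_mul_I ((w : ℂ) - k)
  have e' : (starRingEnd ℂ) ((w : ℂ) - k)
      = ‖(w : ℂ) - k‖ * Complex.exp (-(((w : ℂ) - k).arg * Complex.I)) := by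
    conv_lhs => rw [← e]
    rw [map_mul, Complex.conj_ofReal, ← Complex.exp_conj]
    simp
  have hn : (‖(w : ℂ) - k‖ : ℂ) ≠ 0 := by exact_mod_cast norm_ne_zero_iff.2 h0
  rw [stripChart, hs, hconj, e']
  conv_lhs => enter [2, 1]; rw [← e]
  rw [mul_div_mul_left _ _ hn, ← Complex.exp_sub, circlePt, circlePt, ← Complex.exp_add]
  congr 1
  push_cast
  ring

end StripChart

/-- If the boundary values of the imaginary part of `F` increase on one arc of the circle and
decrease on the complementary arc, then `F` is univalent. The two arcs are mapped to the sides of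
a strip, on which the imaginary part then increases from left to right on both sides, hence inside;
so the derivative takes values in the upper half-plane. -/
theorem injOn_of_unimodal_boundary {F : ℂ → ℂ} (hc : ContinuousOn F (closedBall 0 1))
    (hd : DifferentiableOn ℂ F (ball 0 1)) {a b : ℝ} (hab : a < b) (hba : b < a + 2 * Real.pi)
    (hmono : MonotoneOn (fun t => (F (circlePt t)).im) (Icc a b))
    (hanti : AntitoneOn (fun t => (F (circlePt t)).im) (Icc b (a + 2 * Real.pi)))
    (hlt : (F (circlePt a)).im < (F (circlePt b)).im) : InjOn F (ball 0 1) := by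
  have hpi := Real.pi_pos
  -- the chart sends the left end of the strip to `a` and the right end to `b`
  set κ : ℝ := Real.pi - (b - a) / 2 with hκ
  set k : ℂ := Complex.exp (κ * Complex.I) with hkdef
  have hk : 0 < k.im := by
    rw [hkdef, Complex.exp_ofReal_mul_I_im]
    exact Real.sin_pos_of_pos_of_lt_pi (by rw [hκ]; linarith) (by rw [hκ]; linarith)
  have hargk : (((0 : ℝ) : ℂ) - k).arg = -((b - a) / 2) := by
    have : ((0 : ℝ) : ℂ) - k = Complex.exp ((-((b - a) / 2) : ℝ) * Complex.I) := by
      rw [hkdef, hκ]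
      push_cast
      rw [show ((Real.pi : ℂ) - (b - a) / 2) * Complex.I
        = Real.pi * Complex.I + (-((b - a) / 2)) * Complex.I by ring, Complex.exp_add,
        Complex.exp_pi_mul_I]
      ring
    rw [this, Complex.arg_exp_mul_I, toIocMod_eq_self]
    constructor <;> linarith
  set M := stripChart (circlePt b) k with hMdef
  have hq : ‖circlePt b‖ = 1 := norm_circlePt b
  set G : ℂ → ℂ := fun s => F (M s) with hG
  have hMc : ContinuousOn M (Complex.im ⁻¹' Icc 0 Real.pi) := fun s hs =>
    (differentiableAt_stripChart hk hs).continuousAt.continuousWithinAt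
  have hGc : ContinuousOn G (Complex.im ⁻¹' Icc 0 Real.pi) :=
    hc.comp hMc fun s hs => stripChart_mem_closedBall hq hk hs
  have hGd : DifferentiableOn ℂ G strip :=
    hd.comp (fun s hs => (differentiableAt_stripChart hk
      (Ioo_subset_Icc_self hs)).differentiableWithinAt) fun s hs => stripChart_mem_ball hq hk hs
  -- the lower side is mapped to the arc from `a` to `b`, the upper side to the other arc
  have hlow : ∀ s : ℂ, s.im = 0 → ∀ h : ℝ, 0 ≤ h → (G s).im ≤ (G (s + h)).im := by
    intro s hs h hh
    have e1 : Complex.exp s = ((Real.exp s.re : ℝ) : ℂ) := by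
      rw [Complex.ofReal_exp]; congr 1; apply Complex.ext <;> simp [hs]
    have e2 : Complex.exp (s + h) = ((Real.exp (s.re + h) : ℝ) : ℂ) := by
      rw [Complex.ofReal_exp]; congr 1; apply Complex.ext <;> simp [hs]
    have hle := Real.exp_le_exp.2 (show s.re ≤ s.re + h by linarith)
    have hmem : ∀ w : ℝ, 0 ≤ w → b + 2 * ((w : ℂ) - k).arg ∈ Icc a b := by
      intro w hw
      have h1 := arg_sub_le_arg_sub hk hw
      rw [hargk] at h1
      have h2 : ((w : ℂ) - k).arg < 0 := Complex.arg_neg_iff.2 (by simpa using hk)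
      constructor <;> linarith
    rw [hG]; simp only
    rw [hMdef, stripChart_boundary hk e1, stripChart_boundary hk e2]
    exact hmono (hmem _ (Real.exp_pos _).le) (hmem _ (Real.exp_pos _).le)
      (by linarith [arg_sub_le_arg_sub hk hle])
  have hup : ∀ s : ℂ, s.im = Real.pi → ∀ h : ℝ, 0 ≤ h → (G s).im ≤ (G (s + h)).im := by
    intro s hs h hh
    have e : ∀ s : ℂ, s.im = Real.pi → Complex.exp s = ((-Real.exp s.re : ℝ) : ℂ) := by
      intro s hs
      have : s = (s.re : ℂ) + Real.pi * Complex.I := by apply Complex.ext <;> simp [hs]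
      conv_lhs => rw [this]
      rw [Complex.exp_add, Complex.exp_pi_mul_I]
      push_cast; ring
    have hle := Real.exp_le_exp.2 (show s.re ≤ s.re + h by linarith)
    have hmem : ∀ w : ℝ, w ≤ 0 → b + 2 * ((w : ℂ) - k).arg + 2 * Real.pi ∈ Icc b (a + 2 * Real.pi) := by
      intro w hw
      have h1 := arg_sub_le_arg_sub hk hw
      rw [hargk] at h1
      have h2 := Complex.neg_pi_lt_arg ((w : ℂ) - k)
      constructor <;> linarith
    rw [hG]; simp only
    rw [hMdef, stripChart_boundary hk (e s hs), stripChart_boundary hk (e (s + h) (by simp [hs])),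
      show (s + h).re = s.re + h by simp]
    have key := hanti (hmem (-Real.exp (s.re + h)) (neg_nonpos.2 (Real.exp_pos _).le))
      (hmem (-Real.exp s.re) (neg_nonpos.2 (Real.exp_pos _).le))
      (by linarith [arg_sub_le_arg_sub hk (neg_le_neg hle)])
    simpa only [circlePt_add_two_pi] using key
  obtain ⟨B, hB⟩ := (isCompact_closedBall (0 : ℂ) 1).exists_bound_of_continuousOn hc
  have hGB : ∀ s ∈ Complex.im ⁻¹' Icc 0 Real.pi, ‖G s‖ ≤ B := fun s hs =>
    hB _ (stripChart_mem_closedBall hq hk hs)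
  -- the inequality between `G` and its translate passes to the interior by Phragmén–Lindelöf
  have hshift : ∀ h : ℝ, 0 ≤ h → ∀ s ∈ strip, (G s).im ≤ (G (s + h)).im := by
    intro h hh s hs
    set f : ℂ → ℂ := fun s => Complex.exp (Complex.I * (G (s + h) - G s)) with hf
    have hnorm : ∀ s, ‖f s‖ = Real.exp ((G s).im - (G (s + h)).im) := by
      intro s; rw [hf]; simp only; rw [Complex.norm_exp]; congr 1; simp
    have hmaps : ∀ S : Set ℝ, MapsTo (fun s : ℂ => s + (h : ℂ)) (Complex.im ⁻¹' S) (Complex.im ⁻¹' S) := by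
      intro S s hs
      simpa using hs
    have hdc : DiffContOnCl ℂ f strip := by
      refine ⟨?_, ?_⟩
      · exact (((hGd.comp (by fun_prop) (hmaps _)).sub hGd).const_mul _).cexp
      · have hcl : closure strip ⊆ Complex.im ⁻¹' Icc 0 Real.pi :=
          closure_minimal (preimage_mono Ioo_subset_Icc_self)
            (isClosed_Icc.preimage Complex.continuous_im)
        refine ContinuousOn.mono ?_ hcl
        exact (continuousOn_const.mul ((hGc.comp (by fun_prop) (hmaps _)).sub hGc)).cexp
    have hb : ‖f s‖ ≤ 1 := by
      refine PhragmenLindelof.horizontal_strip (a := 0) (b := Real.pi) hdc ?_ ?_ ?_ hs.1.le hs.2.le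
      · refine ⟨0, by simp [hpi.ne'], 0, ?_⟩
        refine Asymptotics.IsBigO.of_bound (Real.exp (2 * B)) ?_
        filter_upwards [mem_inf_of_right (mem_principal_self _)] with z hz
        rw [hnorm]
        simp only [zero_mul, Real.exp_zero, norm_one, mul_one]
        have hz' : z ∈ Complex.im ⁻¹' Icc 0 Real.pi := preimage_mono Ioo_subset_Icc_self hz
        have h1 := (Complex.abs_im_le_norm _).trans (hGB z hz')
        have h2 := (Complex.abs_im_le_norm _).trans (hGB _ (hmaps _ hz'))
        exact Real.exp_le_exp.2 (by linarith [le_abs_self (G z).im, neg_abs_le (G (z + h)).im])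
      · intro z hz
        rw [hnorm]; exact Real.exp_le_one_iff.2 (by linarith [hlow z hz h hh])
      · intro z hz
        rw [hnorm]; exact Real.exp_le_one_iff.2 (by linarith [hup z hz h hh])
    rw [hnorm, Real.exp_le_one_iff] at hb
    linarith
  have hder : ∀ s ∈ strip, HasDerivAt G (deriv G s) s := fun s hs =>
    (hGd.differentiableAt (isOpen_strip.mem_nhds hs)).hasDerivAt
  have hline : ∀ s ∈ strip, ∀ e : ℂ, ∀ t : ℝ, s + t * e ∈ strip →
      HasDerivAt (fun t : ℝ => G (s + t * e)) (deriv G (s + t * e) * e) t := by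
    intro s _ e t ht
    have h1 : HasDerivAt (fun t : ℝ => s + t * e) e t := by
      simpa using ((Complex.ofRealCLM.hasDerivAt (x := t)).mul_const e).const_add s
    exact HasDerivAt.comp (h₂ := G) (h := fun t : ℝ => s + t * e) t (hder _ ht) h1
  have hnn : ∀ s ∈ strip, 0 ≤ (deriv G s).im := by
    intro s hs
    have h1 := hline s hs 1 0 (by simpa using hs)
    have h2 : HasDerivAt (fun t : ℝ => (G (s + t * 1)).im) (deriv G s).im 0 := by
      have := Complex.imCLM.hasFDerivAt.comp_hasDerivAt (0 : ℝ) h1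
      simpa [Function.comp_def] using this
    have h3 := (hasDerivAt_iff_tendsto_slope.1 h2).mono_left
      (nhdsWithin_mono _ fun y (hy : y ∈ Ioi (0 : ℝ)) => ne_of_gt hy)
    refine ge_of_tendsto h3 ?_
    filter_upwards [self_mem_nhdsWithin] with t ht
    have ht : (0 : ℝ) < t := ht
    rw [slope_def_field]
    have := hshift t ht.le s hs
    refine div_nonneg ?_ (by linarith)
    simpa using this
  -- equality at one point would make `Im G` constant on horizontal lines, contrary to `hlt`
  have hpos : ∀ s ∈ strip, 0 < (deriv G s).im := by
    by_contra! hcon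
    obtain ⟨c, hcs, hc0⟩ := hcon
    have hc0 : (deriv G c).im = 0 := le_antisymm hc0 (hnn c hcs)
    have hzero : ∀ s ∈ strip, (deriv G s).im = 0 := by
      have := re_eq_of_isMaxOn (f := fun s => Complex.I * deriv G s) convex_strip.isPreconnected
        isOpen_strip ((hGd.deriv isOpen_strip).const_mul _) hcs (by
          intro z hz
          simp only [Complex.mul_re, Complex.I_re, Complex.I_im, zero_mul, one_mul, zero_sub, hc0]
          linarith [hnn z hz])
      intro s hs
      have := this s hs
      simp only [Complex.mul_re, Complex.I_re, Complex.I_im, zero_mul, one_mul, zero_sub, hc0] at this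
      linarith
    set s₀ : ℂ := ((Real.pi / 2 : ℝ) : ℂ) * Complex.I with hs₀
    have hs₀m : ∀ x : ℝ, s₀ + x * 1 ∈ strip := by
      intro x
      change (s₀ + x * 1).im ∈ Ioo 0 Real.pi
      simpa [hs₀] using hpi
    have hconst : ∀ x y : ℝ, (G (s₀ + x * 1)).im = (G (s₀ + y * 1)).im := by
      refine is_const_of_deriv_eq_zero (f := fun x : ℝ => (G (s₀ + x * 1)).im) ?_ ?_
      · intro x
        have := Complex.imCLM.hasFDerivAt.comp_hasDerivAt x
          (hline s₀ (by simpa using hs₀m 0) 1 x (hs₀m x))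
        exact this.differentiableAt
      · intro x
        have := Complex.imCLM.hasFDerivAt.comp_hasDerivAt x
          (hline s₀ (by simpa using hs₀m 0) 1 x (hs₀m x))
        have h2 := this.deriv
        simp only [Function.comp_def, Complex.imCLM_apply] at h2
        rw [h2, mul_one, hzero _ (hs₀m x)]
    have hes : ∀ x : ℝ, Complex.exp (s₀ + x * 1) = Complex.I * ((Real.exp x : ℝ) : ℂ) := by
      intro x
      rw [Complex.exp_add, hs₀]
      push_cast
      rw [Complex.exp_pi_div_two_mul_I, mul_one]
    have hfin : ∀ (l : Filter ℝ) [l.NeBot] (t : ℝ),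
        Tendsto (fun x : ℝ => M (s₀ + x * 1)) l (𝓝 (circlePt t)) →
        (F (circlePt t)).im = (G (s₀ + ((0 : ℝ) : ℂ) * 1)).im := by
      intro l _ t hl
      have h1 : Tendsto (fun x : ℝ => M (s₀ + x * 1)) l (𝓝[closedBall 0 1] (circlePt t)) :=
        tendsto_nhdsWithin_iff.2 ⟨hl, Eventually.of_forall fun x =>
          ball_subset_closedBall (stripChart_mem_ball hq hk (hs₀m x))⟩
      have h2 : Tendsto (fun x : ℝ => (G (s₀ + x * 1)).im) l (𝓝 (F (circlePt t)).im) :=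
        (Complex.continuous_im.tendsto _).comp
          (Tendsto.comp (hc _ (circlePt_mem_closedBall t)) h1)
      exact tendsto_nhds_unique h2 (tendsto_const_nhds.congr fun x => hconst _ _)
    have hbot : Tendsto (fun x : ℝ => M (s₀ + x * 1)) atBot (𝓝 (circlePt a)) := by
      have h1 : Tendsto (fun x : ℝ => Complex.I * ((Real.exp x : ℝ) : ℂ)) atBot (𝓝 0) := by
        have := (Complex.continuous_ofReal.tendsto 0).comp Real.tendsto_exp_atBot
        simpa using this.const_mul Complex.I
      have hk0 : (0 : ℂ) - (starRingEnd ℂ) k ≠ 0 := sub_conj_ne_zero hk (by simp)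
      have h2 := ((h1.sub_const k).div (h1.sub_const ((starRingEnd ℂ) k)) hk0).const_mul (circlePt b)
      have e : circlePt b * ((0 - k) / (0 - (starRingEnd ℂ) k)) = circlePt a := by
        rw [zero_sub, zero_sub, neg_div_neg_eq, hkdef, ← Complex.exp_conj, ← Complex.exp_sub, circlePt,
          circlePt, ← Complex.exp_add, Complex.exp_eq_exp_iff_exists_int]
        refine ⟨1, ?_⟩
        rw [map_mul, Complex.conj_ofReal, Complex.conj_I, hκ]
        push_cast
        ring
      rw [e] at h2
      refine h2.congr fun x => ?_
      rw [hMdef, stripChart, hes, Pi.div_apply]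
    have htop : Tendsto (fun x : ℝ => M (s₀ + x * 1)) atTop (𝓝 (circlePt b)) := by
      have h1 : Tendsto (fun x : ℝ => ((Real.exp (-x) : ℝ) : ℂ)) atTop (𝓝 0) := by
        have := (Complex.continuous_ofReal.tendsto 0).comp
          (Real.tendsto_exp_atBot.comp tendsto_neg_atTop_atBot)
        rwa [Complex.ofReal_zero] at this
      have h2 : ∀ w : ℂ, Tendsto (fun x : ℝ => Complex.I - w * ((Real.exp (-x) : ℝ) : ℂ)) atTop
          (𝓝 Complex.I) := fun w => by
        simpa using (h1.const_mul w).const_sub Complex.I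
      have h3 := ((h2 k).div (h2 ((starRingEnd ℂ) k)) Complex.I_ne_zero).const_mul (circlePt b)
      rw [div_self Complex.I_ne_zero, mul_one] at h3
      refine h3.congr fun x => ?_
      rw [hMdef, stripChart, hes, Pi.div_apply]
      have he : ((Real.exp x : ℝ) : ℂ) ≠ 0 := by exact_mod_cast (Real.exp_pos x).ne'
      congr 1
      rw [Real.exp_neg, Complex.ofReal_inv]
      rw [← mul_div_mul_right _ _ he]
      congr 1 <;> field_simp
    rw [hfin atBot a hbot, hfin atTop b htop] at hlt
    exact lt_irrefl _ hlt
  -- a holomorphic function on a convex set with derivative in a half-plane is injective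
  have hGinj : InjOn G strip := by
    intro z hz w hw he
    by_contra hne
    have hwz : w - z ≠ 0 := sub_ne_zero.2 (Ne.symm hne)
    have hseg : ∀ t ∈ Icc (0 : ℝ) 1, z + t * (w - z) ∈ strip := by
      intro t ht
      have := convex_strip.add_smul_sub_mem hz hw ht
      simpa using this
    have hD : ∀ t ∈ Icc (0 : ℝ) 1, HasDerivAt (fun t : ℝ => (G (z + t * (w - z)) / (w - z)).im)
        (deriv G (z + t * (w - z))).im t := by
      intro t ht
      have h1 := (hline z hz (w - z) t (hseg t ht)).div_const (w - z)
      have := Complex.imCLM.hasFDerivAt.comp_hasDerivAt t h1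
      rw [mul_div_cancel_right₀ _ hwz] at this
      exact this
    obtain ⟨t, ht, h0⟩ := exists_hasDerivAt_eq_zero (a := (0 : ℝ)) (b := 1) one_pos
      (fun t ht => (hD t ht).continuousAt.continuousWithinAt) (by simp [he])
      (fun t ht => hD t (Ioo_subset_Icc_self ht))
    exact (hpos _ (hseg t (Ioo_subset_Icc_self ht))).ne' h0
  intro ζ hζ ξ hξ he
  obtain ⟨s, hs, rfl⟩ := exists_stripChart_eq hq hk hζ
  obtain ⟨t, ht, rfl⟩ := exists_stripChart_eq hq hk hξ
  rw [hGinj hs ht he]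

/-! ### Functions near a regular boundary point -/

/-- Near the boundary point `z` the set `A` contains, for each of its points (boundary points
included), every truncated cone of opening less than `π` around the direction `-n`. This is all
that is used of a regular boundary with exterior normal `n`. -/
structure HasConeAt (A : Set ℂ) (z n : ℂ) : Prop where
  norm_eq : ‖n‖ = 1
  mem_closure : z ∈ closure A
  notMem : z ∉ A
  cone : ∀ ε > 0, ∃ r > 0, ∀ w ∈ ball z r, ∀ w' ∈ ball z r, w ∈ closure A →
    inner ℝ n (w' - w) < -ε * ‖w' - w‖ → w' ∈ A

theorem inner_n_sq_add {n d : ℂ} (hn : ‖n‖ = 1) :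
    inner ℝ n d ^ 2 + inner ℝ (Complex.I * n) d ^ 2 = ‖d‖ ^ 2 := by
  have h : n.re ^ 2 + n.im ^ 2 = 1 := by
    have := Complex.normSq_eq_norm_sq n
    rw [hn, Complex.normSq_apply] at this
    linarith
  rw [← Complex.normSq_eq_norm_sq, Complex.normSq_apply]
  simp only [Complex.inner, Complex.mul_re, Complex.mul_im, Complex.conj_re, Complex.conj_im,
    Complex.I_re, Complex.I_im]
  linear_combination (d.re ^ 2 + d.im ^ 2) * h

theorem IsExteriorNormal.hasConeAt {Ω : Set (OnePoint ℂ)} {z n : ℂ} (h : IsExteriorNormal Ω z n) :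
    HasConeAt (finitePart Ω) z n := by
  obtain ⟨ρ, hρ, h0, hg, hΩ, rfl⟩ := h
  set N := ∇ ρ z with hN
  have hNpos : 0 < ‖N‖ := norm_pos_iff.2 hg
  have hn1 : ‖(‖N‖⁻¹ • N : ℂ)‖ = 1 := by
    rw [norm_smul, norm_inv, norm_norm, inv_mul_cancel₀ hNpos.ne']
  have hstrict : HasStrictFDerivAt ρ (fderiv ℝ ρ z) z := hρ.hasStrictFDerivAt one_ne_zero
  have hfd : ∀ v, fderiv ℝ ρ z v = inner ℝ N v := by
    intro v
    have := hstrict.hasFDerivAt.differentiableAt.hasGradientAt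
    rw [← hN, hasGradientAt_iff_hasFDerivAt] at this
    rw [this.fderiv]; simp
  have hcont : ∀ᶠ w in 𝓝 z, ContinuousAt ρ w := by
    filter_upwards [hρ.eventually (by simp)] with w hw using hw.continuousAt
  -- the strict derivative controls increments of `ρ` uniformly near `z`
  have hinc : ∀ ε > 0, ∃ r > 0, ∀ w ∈ ball z r, ∀ w' ∈ ball z r,
      |ρ w' - ρ w - inner ℝ N (w' - w)| ≤ ε * ‖w' - w‖ := by
    intro ε hε
    have h1 := hstrict.isLittleO.def hε
    rw [nhds_prod_eq] at h1
    obtain ⟨U, hU, hU'⟩ := eventually_prod_self_iff'.1 h1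
    obtain ⟨r, hr, hrU⟩ := Metric.mem_nhds_iff.1 hU
    refine ⟨r, hr, fun w hw w' hw' => ?_⟩
    have := hU' w' (hrU hw') w (hrU hw)
    simpa [hfd] using this
  have hcone : ∀ ε > 0, ∃ r > 0, ∀ w ∈ ball z r, ∀ w' ∈ ball z r, ρ w ≤ 0 →
      inner ℝ (‖N‖⁻¹ • N) (w' - w) < -ε * ‖w' - w‖ → w' ∈ finitePart Ω := by
    intro ε hε
    obtain ⟨r₁, hr₁, H₁⟩ := hinc (‖N‖ * ε) (by positivity)
    obtain ⟨r₂, hr₂, H₂⟩ := Metric.eventually_nhds_iff_ball.1 hΩ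
    refine ⟨min r₁ r₂, lt_min hr₁ hr₂, fun w hw w' hw' hle hin => ?_⟩
    refine (H₂ w' (ball_subset_ball (min_le_right _ _) hw')).2 ?_
    have := le_of_abs_le (H₁ w (ball_subset_ball (min_le_left _ _) hw) w'
      (ball_subset_ball (min_le_left _ _) hw'))
    rw [real_inner_smul_left] at hin
    have h2 : inner ℝ N (w' - w) < ‖N‖ * (-ε * ‖w' - w‖) := by
      rw [inv_mul_lt_iff₀ hNpos] at hin; exact hin
    nlinarith
  refine ⟨hn1, ?_, ?_, ?_⟩
  · obtain ⟨r, hr, H⟩ := hcone (1 / 2) (by norm_num)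
    set n : ℂ := ‖N‖⁻¹ • N with hn
    have ht : Tendsto (fun s : ℝ => z - s • n) (𝓝[>] 0) (𝓝 z) := by
      have : Continuous fun s : ℝ => z - s • n := by fun_prop
      simpa using (this.tendsto 0).mono_left nhdsWithin_le_nhds
    refine mem_closure_of_tendsto ht ?_
    filter_upwards [self_mem_nhdsWithin, ht.eventually (ball_mem_nhds z hr)] with s hs hs'
    have hs : (0 : ℝ) < s := hs
    refine H z (mem_ball_self hr) _ hs' h0.le ?_
    rw [show z - s • n - z = -(s • n) by ring, inner_neg_right, real_inner_smul_right,
      real_inner_self_eq_norm_sq, hn1, norm_neg, norm_smul s, hn1, Real.norm_of_nonneg hs.le]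
    linarith
  · intro hz
    have := hΩ.self_of_nhds.1 hz
    linarith
  · intro ε hε
    obtain ⟨r₁, hr₁, H₁⟩ := hcone ε hε
    obtain ⟨r₂, hr₂, H₂⟩ := Metric.eventually_nhds_iff_ball.1 (hΩ.and hcont)
    refine ⟨min r₁ r₂, lt_min hr₁ hr₂, fun w hw w' hw' hcl hin => ?_⟩
    refine H₁ w (ball_subset_ball (min_le_left _ _) hw) w'
      (ball_subset_ball (min_le_left _ _) hw') ?_ hin
    have hw2 := ball_subset_ball (min_le_right _ _) hw
    have := mem_closure_iff_nhdsWithin_neBot.1 hcl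
    refine le_of_tendsto ((H₂ w hw2).2.tendsto.mono_left (nhdsWithin_le_nhds (s := finitePart Ω))) ?_
    filter_upwards [self_mem_nhdsWithin, mem_nhdsWithin_of_mem_nhds (isOpen_ball.mem_nhds hw2)]
      with x hx hx'
    exact ((H₂ x hx').1.1 hx).le

/-- `k` has the boundary value `κ` and the gradient `g` at `z`, seen from `A`. -/
def HasExpansionAt (A : Set ℂ) (k : ℂ → ℝ) (z : ℂ) (κ : ℝ) (g : ℂ) : Prop :=
  ∀ ε > 0, ∀ᶠ w in 𝓝[A] z, |k w - κ - inner ℝ g (w - z)| ≤ ε * ‖w - z‖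

theorem HasExpansionAt.tendsto {A : Set ℂ} {k : ℂ → ℝ} {z g : ℂ} {κ : ℝ}
    (h : HasExpansionAt A k z κ g) : Tendsto k (𝓝[A] z) (𝓝 κ) := by
  have h1 : Tendsto (fun w : ℂ => 1 * ‖w - z‖) (𝓝[A] z) (𝓝 0) := by
    have : Continuous fun w : ℂ => 1 * ‖w - z‖ := by fun_prop
    simpa using (this.tendsto z).mono_left nhdsWithin_le_nhds
  have h2 := squeeze_zero_norm' (f := fun w => k w - κ - inner ℝ g (w - z)) (h 1 one_pos) h1
  have h3 : Tendsto (fun w : ℂ => inner ℝ g (w - z)) (𝓝[A] z) (𝓝 0) := by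
    have : Continuous fun w : ℂ => inner ℝ g (w - z) := by fun_prop
    simpa using (this.tendsto z).mono_left nhdsWithin_le_nhds
  have h4 := (h2.add h3).add_const κ
  simpa using h4

/-- If the gradient has a limit at a regular boundary point, then the function has a first order
expansion there: any two points are joined by a path of comparable length through a point below
the boundary point. -/
theorem HasConeAt.exists_hasExpansionAt {A : Set ℂ} {z n g : ℂ} (hA : HasConeAt A z n) {k : ℂ → ℝ}
    (hd : ∀ᶠ w in 𝓝[A] z, DifferentiableAt ℝ k w) (hg : Tendsto (∇ k) (𝓝[A] z) (𝓝 g)) :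
    ∃ κ, HasExpansionAt A k z κ g := by
  have hbot : (𝓝[A] z).NeBot := mem_closure_iff_nhdsWithin_neBot.1 hA.mem_closure
  set k₁ : ℂ → ℝ := fun w => k w - inner ℝ g (w - z) with hk₁
  have key : ∀ ε > 0, ∃ r > 0, ∀ δ, 0 < δ → 9 * δ < r → ∀ z₁ ∈ A, ∀ z₂ ∈ A, ‖z₁ - z‖ ≤ δ →
      ‖z₂ - z‖ ≤ δ → |k₁ z₁ - k₁ z₂| ≤ 18 * ε * δ := by
    intro ε hε
    obtain ⟨r₁, hr₁, H₁⟩ := hA.cone (1 / 2) (by norm_num)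
    have hev : ∀ᶠ w in 𝓝[A] z, DifferentiableAt ℝ k w ∧ ‖∇ k w - g‖ ≤ ε := by
      filter_upwards [hd, hg.eventually (ball_mem_nhds g hε)] with w hw hw'
      exact ⟨hw, by rw [← dist_eq_norm]; exact le_of_lt hw'⟩
    rw [eventually_nhdsWithin_iff, Metric.eventually_nhds_iff_ball] at hev
    obtain ⟨r₂, hr₂, H₂⟩ := hev
    refine ⟨min r₁ r₂, lt_min hr₁ hr₂, fun δ hδ hδr => ?_⟩
    -- from so far below, all of the `δ`-neighbourhood is seen within a narrow cone
    set P := z - (8 * δ) • n with hP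
    have hPz : ‖P - z‖ = 8 * δ := by
      rw [hP, sub_sub_cancel_left, norm_neg, norm_smul, hA.norm_eq, Real.norm_of_nonneg (by positivity),
        mul_one]
    have leg : ∀ w ∈ A, ‖w - z‖ ≤ δ → |k₁ P - k₁ w| ≤ 9 * ε * δ := by
      intro w hw hwδ
      have hwb : w ∈ ball z (min r₁ r₂) := by rw [mem_ball, dist_eq_norm]; linarith
      have hPb : P ∈ ball z (min r₁ r₂) := by rw [mem_ball, dist_eq_norm, hPz]; linarith
      have hPw : ‖P - w‖ ≤ 9 * δ := by
        calc ‖P - w‖ = ‖(P - z) - (w - z)‖ := by rw [sub_sub_sub_cancel_right]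
          _ ≤ ‖P - z‖ + ‖w - z‖ := norm_sub_le _ _
          _ ≤ 9 * δ := by rw [hPz]; linarith
      have hin : inner ℝ n (P - w) ≤ -7 * δ := by
        have e : P - w = -((8 * δ) • n) + -(w - z) := by rw [hP]; ring
        rw [e, inner_add_right, inner_neg_right, real_inner_smul_right, real_inner_self_eq_norm_sq,
          hA.norm_eq, inner_neg_right]
        have := abs_real_inner_le_norm n (w - z)
        rw [hA.norm_eq, one_mul] at this
        linarith [neg_abs_le (inner ℝ n (w - z))]
      have hseg : ∀ x ∈ segment ℝ w P, x ∈ A ∩ ball z r₂ := by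
        intro x hx
        have hxb : x ∈ ball z (min r₁ r₂) := (convex_ball z _).segment_subset hwb hPb hx
        refine ⟨?_, ball_subset_ball (min_le_right _ _) hxb⟩
        rw [segment_eq_image'] at hx
        obtain ⟨s, hs, rfl⟩ := hx
        rcases hs.1.eq_or_lt with h | h
        · simpa [← h] using hw
        · refine H₁ w (ball_subset_ball (min_le_left _ _) hwb) _
            (ball_subset_ball (min_le_left _ _) hxb) (subset_closure hw) ?_
          simp only [add_sub_cancel_left]
          rw [real_inner_smul_right, norm_smul, Real.norm_of_nonneg h.le]
          have := mul_le_mul_of_nonneg_left hin h.le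
          have := mul_le_mul_of_nonneg_left hPw h.le
          nlinarith [mul_pos h hδ]
      have hk₁d : ∀ x ∈ segment ℝ w P, HasFDerivWithinAt k₁ (fderiv ℝ k x - innerSL ℝ g)
          (segment ℝ w P) x := by
        intro x hx
        have h1 := (H₂ x (hseg x hx).2 (hseg x hx).1).1.hasFDerivAt
        have h2 : HasFDerivAt (fun w : ℂ => inner ℝ g (w - z)) (innerSL ℝ g) x :=
          (innerSL ℝ g).hasFDerivAt.comp x ((hasFDerivAt_id x).sub_const z)
        exact (h1.sub h2).hasFDerivWithinAt
      have hbound : ∀ x ∈ segment ℝ w P, ‖fderiv ℝ k x - innerSL ℝ g‖ ≤ ε := by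
        intro x hx
        have h1 := (H₂ x (hseg x hx).2 (hseg x hx).1)
        refine le_trans (ContinuousLinearMap.opNorm_le_bound _ (norm_nonneg (∇ k x - g)) fun v => ?_) h1.2
        have h2 := h1.1.hasGradientAt
        rw [hasGradientAt_iff_hasFDerivAt] at h2
        have h3 : (fderiv ℝ k x - innerSL ℝ g) v = inner ℝ (∇ k x - g) v := by
          rw [h2.fderiv, inner_sub_left]; simp
        rw [h3]
        exact norm_inner_le_norm _ _
      have := (convex_segment w P).norm_image_sub_le_of_norm_hasFDerivWithin_le hk₁d hbound
        (left_mem_segment ℝ w P) (right_mem_segment ℝ w P)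
      rw [Real.norm_eq_abs] at this
      calc |k₁ P - k₁ w| ≤ ε * ‖P - w‖ := this
        _ ≤ ε * (9 * δ) := mul_le_mul_of_nonneg_left hPw hε.le
        _ = 9 * ε * δ := by ring
    intro z₁ h₁ z₂ h₂ hz₁ hz₂
    have := abs_sub_le (k₁ z₁) (k₁ P) (k₁ z₂)
    rw [abs_sub_comm (k₁ z₁) (k₁ P)] at this
    linarith [leg z₁ h₁ hz₁, leg z₂ h₂ hz₂]
  have hnear : ∀ δ > 0, ∀ᶠ w in 𝓝[A] z, w ∈ A ∧ ‖w - z‖ ≤ δ := by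
    intro δ hδ
    filter_upwards [self_mem_nhdsWithin, mem_nhdsWithin_of_mem_nhds (ball_mem_nhds z hδ)] with w hw hw'
    exact ⟨hw, by rw [mem_ball, dist_eq_norm] at hw'; exact hw'.le⟩
  have hcau : Cauchy (map k₁ (𝓝[A] z)) := by
    rw [Metric.cauchy_iff]
    refine ⟨inferInstance, fun ε hε => ?_⟩
    obtain ⟨r, hr, H⟩ := key 1 one_pos
    set δ := min (r / 10) (ε / 36) with hδ
    have hδpos : 0 < δ := lt_min (by positivity) (by positivity)
    refine ⟨k₁ '' {w | w ∈ A ∧ ‖w - z‖ ≤ δ}, image_mem_map (hnear δ hδpos), ?_⟩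
    rintro _ ⟨z₁, h₁, rfl⟩ _ ⟨z₂, h₂, rfl⟩
    rw [Real.dist_eq]
    have h3 := H δ hδpos (by have := min_le_left (r / 10) (ε / 36); linarith) z₁ h₁.1 z₂ h₂.1 h₁.2 h₂.2
    have h4 := min_le_right (r / 10) (ε / 36)
    linarith
  obtain ⟨κ, hκ⟩ := CompleteSpace.complete hcau
  have hκ : Tendsto k₁ (𝓝[A] z) (𝓝 κ) := hκ
  refine ⟨κ, fun ε hε => ?_⟩
  obtain ⟨r, hr, H⟩ := key (ε / 18) (by positivity)
  filter_upwards [hnear (r / 10) (by positivity)] with w hw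
  have hδ : 0 < ‖w - z‖ := norm_pos_iff.2 (sub_ne_zero.2 fun h => hA.notMem (h ▸ hw.1))
  have h1 : Tendsto (fun z₂ => |k₁ w - k₁ z₂|) (𝓝[A] z) (𝓝 |k₁ w - κ|) := (hκ.const_sub _).abs
  have h2 : |k₁ w - κ| ≤ 18 * (ε / 18) * ‖w - z‖ := by
    refine le_of_tendsto h1 ?_
    filter_upwards [hnear _ hδ] with z₂ hz₂
    exact H _ hδ (by linarith [hw.2]) w hw.1 z₂ hz₂.1 le_rfl hz₂.2
  rw [show k w - κ - inner ℝ g (w - z) = k₁ w - κ by rw [hk₁]; ring]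
  linarith

/-- At a regular boundary point where a function attains its minimum, its gradient is normal to
the boundary. -/
theorem HasConeAt.inner_eq_zero_of_le {A : Set ℂ} {z n g : ℂ} (hA : HasConeAt A z n) {k : ℂ → ℝ}
    {κ : ℝ} (hk : HasExpansionAt A k z κ g) (hle : ∀ᶠ w in 𝓝[A] z, κ ≤ k w) :
    inner ℝ g (Complex.I * n) = 0 := by
  have hperp : inner ℝ n (Complex.I * n) = 0 := by
    simp only [Complex.inner, Complex.mul_re, Complex.mul_im, Complex.conj_re, Complex.conj_im,
      Complex.I_re, Complex.I_im]
    ring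
  have main : ∀ e : ℂ, ‖e‖ = 1 → inner ℝ n e = 0 → 0 ≤ inner ℝ g e := by
    intro e he hne
    have step : ∀ ε : ℝ, 0 < ε → 0 ≤ inner ℝ g e - ε * inner ℝ g n + ε * (1 + ε) := by
      intro ε hε
      obtain ⟨r, hr, H⟩ := hA.cone (ε / (2 * (1 + ε))) (by positivity)
      set q := e - ε • n with hq
      have hqn : ‖q‖ ≤ 1 + ε := by
        calc ‖q‖ ≤ ‖e‖ + ‖ε • n‖ := norm_sub_le _ _
          _ = 1 + ε := by rw [he, norm_smul, hA.norm_eq, Real.norm_of_nonneg hε.le, mul_one]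
      have hqi : inner ℝ n q = -ε := by
        rw [hq, inner_sub_right, real_inner_smul_right, real_inner_self_eq_norm_sq, hne, hA.norm_eq]
        ring
      have ht : Tendsto (fun s : ℝ => z + s • q) (𝓝[>] 0) (𝓝 z) := by
        have : Continuous fun s : ℝ => z + s • q := by fun_prop
        simpa using (this.tendsto 0).mono_left nhdsWithin_le_nhds
      have htA : Tendsto (fun s : ℝ => z + s • q) (𝓝[>] 0) (𝓝[A] z) := by
        refine tendsto_nhdsWithin_iff.2 ⟨ht, ?_⟩
        filter_upwards [self_mem_nhdsWithin, ht.eventually (ball_mem_nhds z hr)] with s hs hs'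
        have hs : (0 : ℝ) < s := hs
        refine H z (mem_ball_self hr) _ hs' hA.mem_closure ?_
        rw [add_sub_cancel_left, real_inner_smul_right, hqi, norm_smul, Real.norm_of_nonneg hs.le]
        have h1 : ε / (2 * (1 + ε)) * (s * ‖q‖) ≤ ε / (2 * (1 + ε)) * (s * (1 + ε)) := by gcongr
        have h2 : ε / (2 * (1 + ε)) * (s * (1 + ε)) = s * ε / 2 := by field_simp
        have := mul_pos hs hε
        linarith
      obtain ⟨s, ⟨h1, h2⟩, hs⟩ := (((htA.eventually (hk ε hε)).and (htA.eventually hle)).and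
        self_mem_nhdsWithin).exists
      have hs : (0 : ℝ) < s := hs
      rw [add_sub_cancel_left, real_inner_smul_right, norm_smul, Real.norm_of_nonneg hs.le] at h1
      have h3 := le_of_abs_le h1
      have h4 : 0 ≤ s * (inner ℝ g q + ε * (1 + ε)) := by
        have : ε * (s * ‖q‖) ≤ ε * (s * (1 + ε)) := by gcongr
        nlinarith
      have h5 := nonneg_of_mul_nonneg_right h4 hs
      rw [hq, inner_sub_right, real_inner_smul_right] at h5
      linarith
    have hl : Tendsto (fun ε : ℝ => inner ℝ g e - ε * inner ℝ g n + ε * (1 + ε)) (𝓝[>] 0)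
        (𝓝 (inner ℝ g e)) := by
      have : Continuous fun ε : ℝ => inner ℝ g e - ε * inner ℝ g n + ε * (1 + ε) := by fun_prop
      simpa using (this.tendsto 0).mono_left nhdsWithin_le_nhds
    exact ge_of_tendsto hl (by filter_upwards [self_mem_nhdsWithin] with ε hε using step ε hε)
  have hI : ‖Complex.I * n‖ = 1 := by rw [norm_mul, Complex.norm_I, hA.norm_eq, one_mul]
  refine le_antisymm ?_ (main _ hI hperp)
  have := main (-(Complex.I * n)) (by rw [norm_neg, hI]) (by rw [inner_neg_right, hperp, neg_zero])
  rw [inner_neg_right] at this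
  linarith

theorem inner_I_mul_left (g n : ℂ) : inner ℝ (Complex.I * g) n = -inner ℝ g (Complex.I * n) := by
  simp only [Complex.inner, Complex.mul_re, Complex.mul_im, Complex.conj_re, Complex.conj_im,
      Complex.I_re, Complex.I_im]
  ring

/-- A function whose gradient has normal limits along a regular boundary arc has locally constant
boundary values on that arc. The arc `β` is only assumed continuous; its projection to the tangent
line serves as a regular parameter. -/
theorem exists_tendsto_const_of_normal_gradient {A : Set ℂ} {k : ℂ → ℝ} {β : ℝ → ℂ} {I : Set ℝ}
    (hI : IsOpen I) (hβ : ContinuousOn β I)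
    (hcone : ∀ t ∈ I, ∃ n g : ℂ, ∃ κ : ℝ, HasConeAt A (β t) n ∧ HasExpansionAt A k (β t) κ g ∧
      inner ℝ g (Complex.I * n) = 0) {t₀ : ℝ} (ht₀ : t₀ ∈ I) :
    ∃ c, ∃ r > 0, ∀ t, |t - t₀| < r → Tendsto k (𝓝[A] (β t)) (𝓝 c) := by
  choose! n g κ hA hk hgn using hcone
  obtain ⟨R, hR, HR⟩ := (hA t₀ ht₀).cone (1 / 2) (by norm_num)
  obtain ⟨r, hr, Hr⟩ : ∃ r > 0, ball t₀ r ⊆ I ∩ β ⁻¹' ball (β t₀) R :=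
    Metric.mem_nhds_iff.1 ((inter_mem (hI.mem_nhds ht₀)
      ((hβ.continuousAt (hI.mem_nhds ht₀)).preimage_mem_nhds (ball_mem_nhds _ hR))))
  set J := ball t₀ r with hJ
  have hJI : ∀ t ∈ J, t ∈ I := fun t ht => (Hr ht).1
  have hclo : ∀ t ∈ I, β t ∈ closure A := fun t ht => (hA t ht).mem_closure
  have hnot : ∀ t ∈ I, β t ∉ A := fun t ht => (hA t ht).notMem
  have hbot : ∀ t ∈ I, (𝓝[A] (β t)).NeBot := fun t ht => mem_closure_iff_nhdsWithin_neBot.1 (hclo t ht)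
  -- two boundary points never lie in each other's cones
  have hflat : ∀ t ∈ I, ∀ ε > 0, ∃ δ > 0, ∀ s ∈ I, β s ∈ ball (β t) δ → ∀ s' ∈ I,
      β s' ∈ ball (β t) δ → |inner ℝ (n t) (β s' - β s)| ≤ ε * ‖β s' - β s‖ := by
    intro t ht ε hε
    obtain ⟨δ, hδ, H⟩ := (hA t ht).cone ε hε
    refine ⟨δ, hδ, fun s hs hsb s' hs' hsb' => ?_⟩
    rw [abs_le]
    constructor
    · by_contra! hlt
      exact hnot s' hs' (H _ hsb _ hsb' (hclo s hs) (by linarith))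
    · by_contra! hlt
      refine hnot s hs (H _ hsb' _ hsb (hclo s' hs') ?_)
      rw [← neg_sub, inner_neg_right, norm_neg]
      linarith
  set x : ℝ → ℝ := fun t => inner ℝ (Complex.I * n t₀) (β t) with hx
  have hlip : ∀ s ∈ J, ∀ t ∈ J, ‖β s - β t‖ ≤ 2 * |x s - x t| := by
    intro s hs t ht
    have h1 : |inner ℝ (n t₀) (β s - β t)| ≤ 1 / 2 * ‖β s - β t‖ := by
      rw [abs_le]
      constructor
      · by_contra! hlt
        exact hnot s (hJI s hs) (HR _ (Hr ht).2 _ (Hr hs).2 (hclo t (hJI t ht)) (by linarith))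
      · by_contra! hlt
        refine hnot t (hJI t ht) (HR _ (Hr hs).2 _ (Hr ht).2 (hclo s (hJI s hs)) ?_)
        rw [← neg_sub, inner_neg_right, norm_neg]
        linarith
    have h2 := inner_n_sq_add (d := β s - β t) (hA t₀ ht₀).norm_eq
    have h3 : inner ℝ (Complex.I * n t₀) (β s - β t) = x s - x t := by rw [inner_sub_right]
    rw [h3] at h2
    have h4 : inner ℝ (n t₀) (β s - β t) ^ 2 ≤ (1 / 2 * ‖β s - β t‖) ^ 2 :=
      sq_le_sq' (neg_le_of_abs_le h1) (le_of_abs_le h1)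
    refine le_of_sq_le_sq ?_ (by positivity)
    rw [mul_pow, sq_abs]
    nlinarith [sq_nonneg (x s - x t)]
  -- boundary values differ by `o(|β s - β t|)`
  have hsmall : ∀ t ∈ I, ∀ ε > 0, ∃ δ > 0, ∀ s ∈ I, ‖β s - β t‖ < δ →
      |κ s - κ t| ≤ ε * ‖β s - β t‖ := by
    intro t ht ε hε
    set a := inner ℝ (g t) (n t) with ha
    have hgdec : ∀ d : ℂ, inner ℝ (g t) d = a * inner ℝ (n t) d := by
      intro d
      have hn2 : (n t).re ^ 2 + (n t).im ^ 2 = 1 := by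
        have := Complex.normSq_eq_norm_sq (n t)
        rw [(hA t ht).norm_eq, Complex.normSq_apply] at this
        linarith
      have h0 := hgn t ht
      rw [ha]
      simp only [Complex.inner, Complex.mul_re, Complex.mul_im, Complex.conj_re, Complex.conj_im,
        Complex.I_re, Complex.I_im] at h0 ⊢
      linear_combination (-((g t).re * d.re + (g t).im * d.im)) * hn2
        + (d.im * (n t).re - d.re * (n t).im) * h0
    obtain ⟨δ₁, hδ₁, H₁⟩ := hflat t ht (ε / (2 * (1 + |a|))) (by positivity)
    have h2 := hk t ht (ε / 2) (by positivity)
    rw [eventually_nhdsWithin_iff, Metric.eventually_nhds_iff_ball] at h2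
    obtain ⟨δ₂, hδ₂, H₂⟩ := h2
    refine ⟨min δ₁ δ₂, lt_min hδ₁ hδ₂, fun s hs hsd => ?_⟩
    have hsb : β s ∈ ball (β t) δ₁ := by
      rw [mem_ball, dist_eq_norm]; exact hsd.trans_le (min_le_left _ _)
    have hsb2 : β s ∈ ball (β t) δ₂ := by
      rw [mem_ball, dist_eq_norm]; exact hsd.trans_le (min_le_right _ _)
    have h3 : |κ s - κ t - inner ℝ (g t) (β s - β t)| ≤ ε / 2 * ‖β s - β t‖ := by
      have := hbot s hs
      have hid : Tendsto (fun w : ℂ => w) (𝓝[A] (β s)) (𝓝 (β s)) := tendsto_id.mono_left nhdsWithin_le_nhds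
      have c1 : Tendsto (fun w => |k w - κ t - inner ℝ (g t) (w - β t)|) (𝓝[A] (β s))
          (𝓝 |κ s - κ t - inner ℝ (g t) (β s - β t)|) :=
        (((hk s hs).tendsto.sub_const _).sub (tendsto_const_nhds.inner (hid.sub_const _))).abs
      have c2 : Tendsto (fun w => ε / 2 * ‖w - β t‖) (𝓝[A] (β s)) (𝓝 (ε / 2 * ‖β s - β t‖)) :=
        (hid.sub_const _).norm.const_mul _
      refine le_of_tendsto_of_tendsto c1 c2 ?_
      filter_upwards [self_mem_nhdsWithin, mem_nhdsWithin_of_mem_nhds (isOpen_ball.mem_nhds hsb2)]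
        with w hw hw'
      exact H₂ w hw' hw
    have h4 := H₁ t ht (mem_ball_self hδ₁) s hs hsb
    have h5 : |inner ℝ (g t) (β s - β t)| ≤ ε / 2 * ‖β s - β t‖ := by
      rw [hgdec, abs_mul]
      calc |a| * |inner ℝ (n t) (β s - β t)|
          ≤ (1 + |a|) * (ε / (2 * (1 + |a|)) * ‖β s - β t‖) :=
            mul_le_mul (by linarith) h4 (abs_nonneg _) (by positivity)
        _ = ε / 2 * ‖β s - β t‖ := by
            have : (1 + |a|) ≠ 0 := by positivity
            field_simp
    have h6 := abs_sub_abs_le_abs_sub (κ s - κ t) (inner ℝ (g t) (β s - β t))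
    linarith
  have hxc : ContinuousOn x J := continuousOn_const.inner (hβ.mono hJI)
  have hconv : Convex ℝ (x '' J) := by
    have h1 : IsPreconnected (x '' J) :=
      (convex_ball t₀ r).isPreconnected.image _ hxc
    exact h1.ordConnected.convex
  have hκeq : ∀ s ∈ J, ∀ t ∈ J, x s = x t → κ s = κ t := by
    intro s hs t ht h
    have h1 := hlip s hs t ht
    rw [h, sub_self, abs_zero, mul_zero] at h1
    have h2 : β s = β t := sub_eq_zero.1 (norm_le_zero_iff.1 h1)
    have := hbot t (hJI t ht)
    exact tendsto_nhds_unique (h2 ▸ (hk s (hJI s hs)).tendsto) (hk t (hJI t ht)).tendsto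
  set T : ℝ → ℝ := Function.invFunOn x J with hT
  have hTx : ∀ y ∈ x '' J, T y ∈ J ∧ x (T y) = y := fun y hy =>
    ⟨Function.invFunOn_mem hy, Function.invFunOn_eq hy⟩
  have hder : ∀ y ∈ x '' J, HasDerivWithinAt (fun y => κ (T y)) 0 (x '' J) y := by
    intro y hy
    rw [hasDerivWithinAt_iff_isLittleO, Asymptotics.isLittleO_iff]
    intro ε hε
    obtain ⟨δ, hδ, H⟩ := hsmall (T y) (hJI _ (hTx y hy).1) (ε / 2) (by positivity)
    filter_upwards [self_mem_nhdsWithin, mem_nhdsWithin_of_mem_nhds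
      (ball_mem_nhds y (show 0 < δ / 2 by positivity))] with y' hy' hyb
    have h1 := hlip _ (hTx y' hy').1 _ (hTx y hy).1
    rw [(hTx y' hy').2, (hTx y hy).2] at h1
    rw [mem_ball, Real.dist_eq] at hyb
    have h2 := H _ (hJI _ (hTx y' hy').1) (by linarith)
    simp only [smul_zero, sub_zero, Real.norm_eq_abs]
    nlinarith
  have hconst : ∀ t ∈ J, κ t = κ t₀ := by
    intro t ht
    have ht₀J : t₀ ∈ J := mem_ball_self hr
    have h1 := hconv.norm_image_sub_le_of_norm_hasDerivWithin_le (C := 0) hder (fun y _ => by simp)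
      (mem_image_of_mem x ht₀J) (mem_image_of_mem x ht)
    rw [zero_mul] at h1
    have h2 := sub_eq_zero.1 (norm_le_zero_iff.1 h1)
    have e : ∀ s ∈ J, κ (T (x s)) = κ s := fun s hs =>
      hκeq _ (hTx _ (mem_image_of_mem x hs)).1 _ hs (hTx _ (mem_image_of_mem x hs)).2
    rwa [e t ht, e t₀ ht₀J] at h2
  refine ⟨κ t₀, r, hr, fun t ht => ?_⟩
  have htJ : t ∈ J := by rw [hJ, mem_ball, Real.dist_eq]; exact ht
  rw [← hconst t htJ]
  exact (hk t (hJI t htJ)).tendsto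

/-! ### Harmonic and holomorphic functions on the extended plane -/

/-- The chart `z ↦ 1 / z` around `∞`. -/
def invChart (z : ℂ) : OnePoint ℂ := if z = 0 then ∞ else ((z⁻¹ : ℂ) : OnePoint ℂ)

theorem atInfty_eq {α : Type*} (f : OnePoint ℂ → α) : atInfty f = fun z => f (invChart z) := by
  funext z
  by_cases h : z = 0 <;> simp [atInfty, invChart, h]

theorem invChart_zero : invChart 0 = ∞ := by simp [invChart]

theorem map_invChart_nhds : map invChart (𝓝 0) = 𝓝 ∞ := by
  have h1 : map invChart (𝓝[≠] 0) = map ((↑) : ℂ → OnePoint ℂ) (coclosedCompact ℂ) := by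
    have : map invChart (𝓝[≠] 0) = map (fun z : ℂ => ((z⁻¹ : ℂ) : OnePoint ℂ)) (𝓝[≠] 0) := by
      refine Filter.map_congr ?_
      filter_upwards [self_mem_nhdsWithin] with z hz
      exact if_neg hz
    rw [this, coclosedCompact_eq_cocompact, ← Metric.cobounded_eq_cocompact,
      ← Filter.inv_nhdsNE_zero, ← Filter.map_inv, map_map]
    rfl
  rw [OnePoint.nhds_infty_eq, ← h1, ← nhdsNE_sup_pure, Filter.map_sup, Filter.map_pure, invChart_zero]

/-- Every point of the extended plane is the image of `c₀` under one of the two charts. -/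
theorem exists_chart (p : OnePoint ℂ) : ∃ (c : ℂ → OnePoint ℂ) (c₀ : ℂ), c c₀ = p ∧
    map c (𝓝 c₀) = 𝓝 p ∧
    (∀ f S, HolomorphicOn f S → p ∈ S → DifferentiableAt ℂ (fun w => f (c w)) c₀) ∧
    (∀ f S, HarmonicOn f S → p ∈ S → InnerProductSpace.HarmonicAt (fun w => f (c w)) c₀) := by
  induction p using OnePoint.rec with
  | infty =>
    refine ⟨invChart, 0, invChart_zero, map_invChart_nhds, fun f S hf hp => ?_, fun f S hf hp => ?_⟩
    · rw [← atInfty_eq]; exact hf.2 hp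
    · rw [← atInfty_eq]; exact hf.2 hp
  | coe z =>
    exact ⟨(↑), z, rfl, (OnePoint.nhds_coe_eq z).symm, fun f S hf hp => hf.1 z hp,
      fun f S hf hp => hf.1 z hp⟩

theorem HolomorphicOn.continuousAt {f : OnePoint ℂ → ℂ} {S : Set (OnePoint ℂ)}
    (hf : HolomorphicOn f S) {p : OnePoint ℂ} (hp : p ∈ S) : ContinuousAt f p := by
  obtain ⟨c, c₀, rfl, hmap, hhol, -⟩ := exists_chart p
  rw [ContinuousAt, ← hmap, tendsto_map'_iff]
  exact (hhol f S hf hp).continuousAt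

/-- The complex coordinate `1 / z` near `∞`; its value at the finite point `0` is irrelevant. -/
def invCoord (p : OnePoint ℂ) : ℂ := p.elim 0 (fun z => z⁻¹)

theorem invCoord_invChart (z : ℂ) : invCoord (invChart z) = z := by
  by_cases h : z = 0
  · simp [invChart, invCoord, h]
  · simp [invChart, invCoord, h]

/-- A harmonic function is locally the real part of a holomorphic function. -/
theorem HarmonicOn.exists_local_holomorphic {u : OnePoint ℂ → ℝ} {S : Set (OnePoint ℂ)}
    (hS : IsOpen S) (hu : HarmonicOn u S) {p : OnePoint ℂ} (hp : p ∈ S) :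
    ∃ (N : Set (OnePoint ℂ)) (Φ : OnePoint ℂ → ℂ), IsOpen N ∧ p ∈ N ∧ N ⊆ S ∧
      HolomorphicOn Φ N ∧ ∀ q ∈ N, (Φ q).re = u q := by
  induction p using OnePoint.rec with
  | infty =>
    have h := hu.2 hp
    obtain ⟨r, hr, hb⟩ := Metric.eventually_nhds_iff_ball.1 h.eventually
    obtain ⟨f, hf, hfu⟩ := InnerProductSpace.HarmonicOnNhd.exists_analyticOnNhd_ball_re_eq
      (f := atInfty u) (z := 0) (R := r) hb
    have hmem : invChart '' ball 0 r ∈ 𝓝 (∞ : OnePoint ℂ) := by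
      rw [← map_invChart_nhds]; exact image_mem_map (ball_mem_nhds _ hr)
    refine ⟨interior (invChart '' ball 0 r) ∩ S, fun q => f (invCoord q),
      isOpen_interior.inter hS, ⟨mem_interior_iff_mem_nhds.2 hmem, hp⟩, inter_subset_right, ⟨?_, ?_⟩, ?_⟩
    · intro z hz
      obtain ⟨w, hw, hwz⟩ := interior_subset hz.1
      have hw0 : w ≠ 0 := by
        rintro rfl
        rw [invChart_zero] at hwz
        exact OnePoint.infty_ne_coe z hwz
      have hz' : w⁻¹ = z := by simpa [invChart, hw0] using hwz
      have hz0 : z ≠ 0 := hz' ▸ inv_ne_zero hw0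
      have e : (fun w : ℂ => f (invCoord (w : OnePoint ℂ))) = fun w => f w⁻¹ := by
        funext w; simp [invCoord]
      rw [e]
      have h1 : DifferentiableAt ℂ f z⁻¹ := by
        rw [← hz', inv_inv]; exact (hf w hw).differentiableAt
      exact h1.comp z (differentiableAt_inv hz0)
    · intro _
      rw [atInfty_eq]
      simp only [invCoord_invChart]
      exact (hf 0 (mem_ball_self hr)).differentiableAt
    · rintro q ⟨hq, -⟩
      obtain ⟨w, hw, rfl⟩ := interior_subset hq
      simp only [invCoord_invChart]
      have := hfu hw
      simp only [atInfty_eq] at this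
      exact this
  | coe z =>
    have h := hu.1 z hp
    obtain ⟨r, hr, hb⟩ := Metric.eventually_nhds_iff_ball.1 h.eventually
    obtain ⟨f, hf, hfu⟩ := InnerProductSpace.HarmonicOnNhd.exists_analyticOnNhd_ball_re_eq
      (f := fun w : ℂ => u (w : OnePoint ℂ)) (z := z) (R := r) hb
    refine ⟨(↑) '' ball z r ∩ S, fun q => f (q.elim 0 id),
      (OnePoint.isOpen_image_coe.2 isOpen_ball).inter hS,
      ⟨mem_image_of_mem _ (mem_ball_self hr), hp⟩, inter_subset_right, ⟨?_, ?_⟩, ?_⟩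
    · rintro w ⟨⟨w', hw', e⟩, -⟩
      rw [OnePoint.coe_eq_coe] at e
      subst e
      simpa using (hf w' hw').differentiableAt
    · rintro ⟨h, -⟩
      exact absurd h OnePoint.infty_notMem_image_coe
    · rintro q ⟨⟨w, hw, rfl⟩, -⟩
      simpa using hfu hw

/-- A harmonic function is constant near a local maximum. -/
theorem HarmonicOn.eventually_eq_of_isLocalMax {u : OnePoint ℂ → ℝ} {S : Set (OnePoint ℂ)}
    (hu : HarmonicOn u S) {p : OnePoint ℂ} (hp : p ∈ S) (hm : IsLocalMax u p) :
    ∀ᶠ q in 𝓝 p, u q = u p := by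
  obtain ⟨c, c₀, rfl, hmap, -, hhar⟩ := exists_chart p
  rw [IsLocalMax, IsMaxFilter, ← hmap, eventually_map] at hm
  rw [← hmap, eventually_map]
  obtain ⟨r, hr, hb⟩ := Metric.eventually_nhds_iff_ball.1 ((hhar u S hu hp).eventually.and hm)
  obtain ⟨f, hf, hfu⟩ := InnerProductSpace.HarmonicOnNhd.exists_analyticOnNhd_ball_re_eq
      (f := fun w : ℂ => u (c w)) (z := c₀) (R := r) fun w hw => (hb w hw).1
  have := re_eq_of_isMaxOn (convex_ball c₀ r).isPreconnected isOpen_ball hf.differentiableOn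
    (mem_ball_self hr) fun w hw => by
      have e1 : (f w).re = u (c w) := hfu hw
      have e2 : (f c₀).re = u (c c₀) := hfu (mem_ball_self hr)
      rw [e1, e2]; exact (hb w hw).2
  filter_upwards [ball_mem_nhds c₀ hr] with w hw
  have e1 : (f w).re = u (c w) := hfu hw
  have e2 : (f c₀).re = u (c c₀) := hfu (mem_ball_self hr)
  rw [← e1, ← e2]; exact this w hw

theorem HarmonicOn.neg {u : OnePoint ℂ → ℝ} {S : Set (OnePoint ℂ)} (hu : HarmonicOn u S) :
    HarmonicOn (fun p => -u p) S := by
  refine ⟨fun z hz => (hu.1 z hz).neg, fun h => ?_⟩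
  have := (hu.2 h).neg
  convert this using 1
  simp only [atInfty_eq]; rfl

theorem HarmonicOn.continuousAt {u : OnePoint ℂ → ℝ} {S : Set (OnePoint ℂ)}
    (hu : HarmonicOn u S) {p : OnePoint ℂ} (hp : p ∈ S) : ContinuousAt u p := by
  obtain ⟨c, c₀, rfl, hmap, -, hhar⟩ := exists_chart p
  rw [ContinuousAt, ← hmap, tendsto_map'_iff]
  exact (hhar u S hu hp).1.continuousAt

/-- **Maximum principle** on a connected open subset of the extended plane. -/
theorem HarmonicOn.le_of_frontier_le {u : OnePoint ℂ → ℝ} {S : Set (OnePoint ℂ)} (hS : IsOpen S)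
    (hSc : IsPreconnected S) (hu : HarmonicOn u S) (hc : ContinuousOn u (closure S)) {M : ℝ}
    (hne : (frontier S).Nonempty) (hM : ∀ p ∈ frontier S, u p ≤ M) :
    ∀ p ∈ closure S, u p ≤ M := by
  obtain ⟨b, hb⟩ := hne
  have hbcl : b ∈ closure S := frontier_subset_closure hb
  obtain ⟨p, hp, hmax⟩ := isClosed_closure.isCompact.exists_isMaxOn ⟨b, hbcl⟩ hc
  suffices h : u p ≤ M from fun q hq => (hmax hq).trans h
  by_cases hpS : p ∈ S
  · -- the maximum is attained on a relatively open and closed subset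
    set T : Set (OnePoint ℂ) := {q | q ∈ S ∧ u q = u p} with hT
    have hTo : IsOpen T := by
      rw [isOpen_iff_mem_nhds]
      rintro q ⟨hq, hqe⟩
      have hlm : IsLocalMax u q := by
        filter_upwards [hS.mem_nhds hq] with x hx
        rw [hqe]; exact hmax (subset_closure hx)
      filter_upwards [hS.mem_nhds hq, hu.eventually_eq_of_isLocalMax hq hlm] with x hx hx'
      exact ⟨hx, hx'.trans hqe⟩
    have hT'o : IsOpen {q | q ∈ S ∧ u q ≠ u p} := by
      rw [isOpen_iff_mem_nhds]
      rintro q ⟨hq, hqe⟩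
      filter_upwards [hS.mem_nhds hq, (hu.continuousAt hq).eventually_ne hqe] with x hx hx'
      exact ⟨hx, hx'⟩
    have hall : ∀ q ∈ S, u q = u p := by
      intro q hq
      by_contra hqe
      obtain ⟨x, hx, h1, h2⟩ := hSc T {q | q ∈ S ∧ u q ≠ u p} hTo hT'o
        (fun x hx => by
          by_cases h : u x = u p
          · exact Or.inl ⟨hx, h⟩
          · exact Or.inr ⟨hx, h⟩) ⟨p, hpS, hpS, rfl⟩ ⟨q, hq, hq, hqe⟩
      exact h2.2 h1.2
    have hbe : u b = u p := by
      have hbot : (𝓝[S] b).NeBot := mem_closure_iff_nhdsWithin_neBot.1 hbcl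
      have h1 : Tendsto u (𝓝[S] b) (𝓝 (u b)) := (hc b hbcl).mono_left (nhdsWithin_mono _ subset_closure)
      refine tendsto_nhds_unique h1 (tendsto_const_nhds.congr' ?_)
      filter_upwards [self_mem_nhdsWithin] with x hx using (hall x hx).symm
    rw [← hbe]; exact hM b hb
  · exact hM p ⟨hp, by rwa [hS.interior_eq]⟩

/-! ### Gradients and conjugate functions -/

theorem hasGradientAt_re {f : ℂ → ℂ} {z : ℂ} {u : ℂ → ℝ} (hf : DifferentiableAt ℂ f z)
    (hu : ∀ᶠ w in 𝓝 z, (f w).re = u w) : HasGradientAt u ((starRingEnd ℂ) (deriv f z)) z := by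
  rw [hasGradientAt_iff_hasFDerivAt]
  have h1 : HasFDerivAt f ((ContinuousLinearMap.toSpanSingleton ℂ (deriv f z)).restrictScalars ℝ) z :=
    hf.hasDerivAt.hasFDerivAt.restrictScalars ℝ
  have h2 := Complex.reCLM.hasFDerivAt.comp z h1
  refine (h2.congr_of_eventuallyEq (f₁ := u) ?_).congr_fderiv ?_
  · filter_upwards [hu] with w hw using hw.symm
  · ext; simp [Complex.inner]

theorem hasGradientAt_im {f : ℂ → ℂ} {z : ℂ} {v : ℂ → ℝ} (hf : DifferentiableAt ℂ f z)
    (hv : ∀ᶠ w in 𝓝 z, (f w).im = v w) :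
    HasGradientAt v (Complex.I * (starRingEnd ℂ) (deriv f z)) z := by
  have h := hasGradientAt_re (f := fun w => -Complex.I * f w) (u := v) (hf.const_mul _)
    (by filter_upwards [hv] with w hw; simpa using hw)
  rw [deriv_const_mul _ hf] at h
  simpa using h

/-- The Cauchy–Riemann equations. -/
theorem grad_of_holomorphic {f : ℂ → ℂ} {z : ℂ} {u v : OnePoint ℂ → ℝ}
    (hf : DifferentiableAt ℂ f z) (hu : ∀ᶠ w : ℂ in 𝓝 z, (f w).re = u w)
    (hv : ∀ᶠ w : ℂ in 𝓝 z, (f w).im = v w) :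
    grad u z = (starRingEnd ℂ) (deriv f z) ∧ grad v z = Complex.I * grad u z ∧
      DifferentiableAt ℝ (fun w : ℂ => v (w : OnePoint ℂ)) z := by
  have h1 := hasGradientAt_re (u := fun w : ℂ => u (w : OnePoint ℂ)) hf hu
  have h2 := hasGradientAt_im (v := fun w : ℂ => v (w : OnePoint ℂ)) hf hv
  refine ⟨h1.gradient, ?_, h2.differentiableAt⟩
  rw [grad, grad, h1.gradient, h2.gradient]

theorem harmonicOn_im {f : OnePoint ℂ → ℂ} {S : Set (OnePoint ℂ)} (hS : IsOpen S)
    (hf : HolomorphicOn f S) : HarmonicOn (fun p => (f p).im) S := by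
  have hcoe : IsOpen (((↑) : ℂ → OnePoint ℂ) ⁻¹' S) := hS.preimage OnePoint.continuous_coe
  have hfin : DifferentiableOn ℂ (fun w : ℂ => f (w : OnePoint ℂ)) (((↑) : ℂ → OnePoint ℂ) ⁻¹' S) :=
    fun w hw => (hf.1 w hw).differentiableWithinAt
  refine ⟨fun z hz => (hfin.analyticAt (hcoe.mem_nhds hz)).harmonicAt_im, fun hS' => ?_⟩
  have hev : ∀ᶠ z in 𝓝 (0 : ℂ), DifferentiableAt ℂ (atInfty f) z := by
    have h1 : ∀ᶠ z in 𝓝 (0 : ℂ), invChart z ∈ S := by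
      have : ∀ᶠ p in map invChart (𝓝 0), p ∈ S := by
        rw [map_invChart_nhds]; exact hS.mem_nhds hS'
      exact this
    filter_upwards [h1] with z hz
    by_cases h0 : z = 0
    · rw [h0]; exact hf.2 hS'
    · have hz' : invChart z = ((z⁻¹ : ℂ) : OnePoint ℂ) := by simp [invChart, h0]
      rw [hz'] at hz
      have h2 : DifferentiableAt ℂ (fun w : ℂ => f ((w⁻¹ : ℂ) : OnePoint ℂ)) z :=
        DifferentiableAt.comp (g := fun w : ℂ => f (w : OnePoint ℂ)) z (hf.1 _ hz)
          (differentiableAt_inv h0)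
      refine h2.congr_of_eventuallyEq ?_
      filter_upwards [isOpen_ne.mem_nhds h0] with w hw
      have hw : w ≠ 0 := hw
      simp [atInfty, hw]
  have han : AnalyticAt ℂ (atInfty f) 0 := Complex.analyticAt_iff_eventually_differentiableAt.2 hev
  have h3 := han.harmonicAt_im
  rw [atInfty_eq] at h3 ⊢
  exact h3

/-- Along a curve of steepest ascent the conjugate function has derivative zero, so that the set
of its values is null. -/
theorem IsAscentCurve.volume_image_im_eq_zero {u : OnePoint ℂ → ℝ} {Ω : Set (OnePoint ℂ)}
    {c : ℝ → OnePoint ℂ} (hc : IsAscentCurve u Ω c) {N : Set (OnePoint ℂ)} {Φ : OnePoint ℂ → ℂ}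
    (hN : IsOpen N) (hΦ : HolomorphicOn Φ N) (hre : ∀ q ∈ N, (Φ q).re = u q) :
    volume ((fun q => (Φ q).im) '' (c '' Icc 0 1 ∩ N)) = 0 := by
  obtain ⟨T, f, hT, hf⟩ := hc.ascent
  set O : Set ℝ := {t | t ∈ Ioo (0 : ℝ) 1 \ T ∧ c t ∈ N} with hO
  set h : ℝ → ℝ := fun t => (Φ (c t)).im with hh
  have hopen : IsOpen (Ioo (0 : ℝ) 1 \ T) := isOpen_Ioo.sdiff hT.isClosed
  have hder : ∀ t ∈ O, HasFDerivWithinAt h (0 : ℝ →L[ℝ] ℝ) O t := by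
    rintro t ⟨ht, htN⟩
    obtain ⟨hct, hg0, r, hr, hfd⟩ := hf t ht
    rw [hct] at htN
    have hd := hΦ.1 (f t) htN
    have hev : ∀ᶠ w : ℂ in 𝓝 (f t), (Φ w).re = u w := by
      filter_upwards [(hN.preimage OnePoint.continuous_coe).mem_nhds htN] with w hw using hre _ hw
    have hgr := (hasGradientAt_re (u := fun w : ℂ => u (w : OnePoint ℂ)) hd hev).gradient
    set D := deriv (fun w : ℂ => Φ (w : OnePoint ℂ)) (f t) with hD
    have h1 : HasDerivAt (fun t => Φ (f t : OnePoint ℂ)) (D * (r • grad u (f t))) t :=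
      hd.hasDerivAt.comp t hfd
    have h2 : HasDerivAt (fun t => (Φ (f t : OnePoint ℂ)).im) (D * (r • grad u (f t))).im t :=
      Complex.imCLM.hasFDerivAt.comp_hasDerivAt t h1
    have h3 : (D * (r • grad u (f t))).im = 0 := by
      rw [grad, hgr, mul_smul_comm, Complex.mul_conj]; simp
    rw [h3] at h2
    have h4 : HasDerivAt h 0 t := by
      refine h2.congr_of_eventuallyEq ?_
      filter_upwards [hopen.mem_nhds ht] with s hs
      rw [hh]; simp only
      rw [(hf s hs).1]
    have h5 := h4.hasFDerivAt
    rw [show ContinuousLinearMap.toSpanSingleton ℝ (0 : ℝ) = 0 by ext; simp] at h5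
    exact h5.hasFDerivWithinAt
  have hnull : volume (h '' O) = 0 :=
    addHaar_image_eq_zero_of_det_fderivWithin_eq_zero volume hder fun t _ => by
      simp [ContinuousLinearMap.det]
  have hfin : volume (h '' ({0, 1} ∪ T)) = 0 :=
    (((Set.toFinite {(0 : ℝ), 1}).union hT).image h).measure_zero volume
  refine measure_mono_null ?_ (measure_union_null hnull hfin)
  rintro _ ⟨_, ⟨⟨t, ht, rfl⟩, htN⟩, rfl⟩
  by_cases htT : t ∈ ({0, 1} ∪ T : Set ℝ)
  · exact Or.inr ⟨t, htT, rfl⟩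
  · refine Or.inl ⟨t, ⟨⟨?_, fun h => htT (Or.inr h)⟩, htN⟩, rfl⟩
    have h0 : t ≠ 0 := fun h => htT (Or.inl (by simp [h]))
    have h1 : t ≠ 1 := fun h => htT (Or.inl (by simp [h]))
    exact ⟨lt_of_le_of_ne ht.1 (Ne.symm h0), lt_of_le_of_ne ht.2 h1⟩

/-! ### The cut domain and its conformal parametrization -/

section Setting

variable {m : ℕ} {E : Fin (m + 1) → Set (OnePoint ℂ)} {u : OnePoint ℂ → ℝ}

theorem IsMultiplyConnected.isOpen_domain (hE : IsMultiplyConnected E) : IsOpen (domain E) :=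
  (isClosed_iUnion_of_finite hE.isClosed).isOpen_compl

theorem IsAscentCurve.isCompact_image {Ω : Set (OnePoint ℂ)} {c : ℝ → OnePoint ℂ}
    (hc : IsAscentCurve u Ω c) : IsCompact (c '' Icc 0 1) :=
  isCompact_Icc.image_of_continuousOn hc.continuousOn

theorem Cuts.isClosed_carrier (C : Cuts E u) : IsClosed C.carrier :=
  C.γ₀_ascent.isCompact_image.isClosed.union (isClosed_iUnion_of_finite fun k =>
    (C.α_ascent k).isCompact_image.isClosed.union (C.β_ascent k).isCompact_image.isClosed)

theorem Cuts.isOpen_cutDomain (hE : IsMultiplyConnected E) (C : Cuts E u) : IsOpen C.cutDomain :=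
  hE.isOpen_domain.sdiff C.isClosed_carrier

theorem Cuts.cutDomain_subset (C : Cuts E u) : C.cutDomain ⊆ domain E := sdiff_subset

/-- The end points of the cuts. -/
def Cuts.endPts (C : Cuts E u) : Set (OnePoint ℂ) :=
  {C.γ₀ 0, C.γ₀ 1} ∪ ⋃ k, ({C.α k 0, C.α k 1} ∪ {C.β k 0, C.β k 1})

theorem Cuts.finite_endPts (C : Cuts E u) : C.endPts.Finite :=
  (toFinite _).union (finite_iUnion fun _ => (toFinite _).union (toFinite _))

theorem IsAscentCurve.image_diff_subset {Ω : Set (OnePoint ℂ)} {c : ℝ → OnePoint ℂ}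
    (hc : IsAscentCurve u Ω c) : c '' Icc 0 1 \ Ω ⊆ {c 0, c 1} := by
  rintro _ ⟨⟨t, ht, rfl⟩, hΩ⟩
  by_cases h0 : t = 0
  · simp [h0]
  by_cases h1 : t = 1
  · simp [h1]
  exact absurd (hc.mem t ⟨lt_of_le_of_ne ht.1 (Ne.symm h0), lt_of_le_of_ne ht.2 h1⟩) hΩ

theorem Cuts.carrier_diff_subset (C : Cuts E u) : C.carrier \ domain E ⊆ C.endPts := by
  rintro p ⟨hp | hp, hΩ⟩
  · exact Or.inl (C.γ₀_ascent.image_diff_subset ⟨hp, hΩ⟩)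
  · obtain ⟨k, hk⟩ := mem_iUnion.1 hp
    refine Or.inr (mem_iUnion.2 ⟨k, ?_⟩)
    rcases hk with hk | hk
    · exact Or.inl ((C.α_ascent k).image_diff_subset ⟨hk, hΩ⟩)
    · exact Or.inr ((C.β_ascent k).image_diff_subset ⟨hk, hΩ⟩)

theorem notMem_of_mem_frontier (hE : IsMultiplyConnected E) {p : OnePoint ℂ}
    (hp : p ∈ frontier (domain E)) : p ∉ domain E := fun h =>
  hp.2 (by rwa [hE.isOpen_domain.interior_eq])

/-- The boundary values of the potential are `0` or `1`. -/
theorem IsPotential.eq_zero_or_one (hu : IsPotential E u) {p : OnePoint ℂ} (hp : p ∉ domain E) :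
    u p = 0 ∨ u p = 1 := by
  rw [domain, notMem_compl_iff, mem_iUnion] at hp
  obtain ⟨j, hj⟩ := hp
  by_cases h : j = 0
  · subst h; exact Or.inl (hu.eq_zero p hj)
  · exact Or.inr (hu.eq_one j h p hj)

theorem OrientedBoundary.mem_closure {C : Cuts E u} (B : OrientedBoundary C) {ζ : ℂ}
    (hζ : ζ ∈ closedBall (0 : ℂ) 1) : B.ψ ζ ∈ closure C.cutDomain := by
  have hcl : closure (ball (0 : ℂ) 1) = closedBall 0 1 := closure_ball 0 one_ne_zero
  have h1 : MapsTo B.ψ (ball 0 1) C.cutDomain := B.bijOn.mapsTo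
  have h2 : MapsTo B.ψ (closure (ball 0 1)) (closure C.cutDomain) :=
    h1.closure_of_continuousOn (hcl.symm ▸ B.continuousOn)
  exact h2 (hcl.symm ▸ hζ)

theorem OrientedBoundary.mem_closure_domain {C : Cuts E u} (B : OrientedBoundary C) {ζ : ℂ}
    (hζ : ζ ∈ closedBall (0 : ℂ) 1) : B.ψ ζ ∈ closure (domain E) :=
  closure_mono C.cutDomain_subset (B.mem_closure hζ)

/-- Points of the boundary segments are boundary points of the domain. -/
theorem OrientedBoundary.segment_mem_frontier (hE : IsMultiplyConnected E) {C : Cuts E u}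
    (B : OrientedBoundary C) {p : ℕ} (hp : p ≤ B.J) {t : ℝ}
    (ht : t ∈ Icc (B.θ (2 * p + 1)) (B.θ (2 * p + 2))) :
    B.ψ (circlePt t) ∈ frontier (domain E) := by
  refine ⟨B.mem_closure_domain (circlePt_mem_closedBall t), ?_⟩
  rw [hE.isOpen_domain.interior_eq, domain, notMem_compl_iff]
  exact mem_iUnion.2 ⟨_, B.segment p hp t ht⟩

theorem OrientedBoundary.frontier_nonempty (hE : IsMultiplyConnected E) {C : Cuts E u}
    (B : OrientedBoundary C) : (frontier (domain E)).Nonempty :=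
  ⟨_, B.segment_mem_frontier hE (Nat.zero_le _)
    (left_mem_Icc.2 (B.θ_lt 1 (by have := B.J_pos; omega)).le)⟩

theorem IsPotential.mem_Icc (hE : IsMultiplyConnected E) (hu : IsPotential E u)
    (hne : (frontier (domain E)).Nonempty) {p : OnePoint ℂ} (hp : p ∈ closure (domain E)) :
    u p ∈ Icc 0 1 := by
  have hb : ∀ q ∈ frontier (domain E), u q = 0 ∨ u q = 1 := fun q hq =>
    hu.eq_zero_or_one (notMem_of_mem_frontier hE hq)
  constructor
  · have := hu.harmonic.neg.le_of_frontier_le hE.isOpen_domain hE.domain_connected.isPreconnected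
      hu.continuousOn.neg hne (M := 0) (fun q hq => by rcases hb q hq with h | h <;> simp [h]) p hp
    linarith
  · exact hu.harmonic.le_of_frontier_le hE.isOpen_domain hE.domain_connected.isPreconnected
      hu.continuousOn hne (fun q hq => by rcases hb q hq with h | h <;> simp [h]) p hp

theorem Cuts.volume_image_im_carrier (C : Cuts E u) {N : Set (OnePoint ℂ)} {Φ : OnePoint ℂ → ℂ}
    (hN : IsOpen N) (hΦ : HolomorphicOn Φ N) (hre : ∀ q ∈ N, (Φ q).re = u q) :
    volume ((fun q => (Φ q).im) '' (C.carrier ∩ N)) = 0 := by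
  have h0 := C.γ₀_ascent.volume_image_im_eq_zero hN hΦ hre
  have hα := fun k => (C.α_ascent k).volume_image_im_eq_zero hN hΦ hre
  have hβ := fun k => (C.β_ascent k).volume_image_im_eq_zero hN hΦ hre
  rw [Cuts.carrier, union_inter_distrib_right, iUnion_inter, image_union, image_iUnion]
  refine measure_union_null h0 (measure_iUnion_null fun k => ?_)
  rw [union_inter_distrib_right, image_union]
  exact measure_union_null (hα k) (hβ k)

/-- The potential has no critical points in the cut domain. -/
theorem Cuts.grad_ne_zero (C : Cuts E u) {z : ℂ} (hz : (z : OnePoint ℂ) ∈ C.cutDomain) :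
    grad u z ≠ 0 := by
  intro h
  obtain ⟨k, hk⟩ := C.saddle_all z hz.1 (Or.inl ⟨z, rfl, h⟩)
  refine hz.2 (Or.inr (mem_iUnion.2 ⟨k, Or.inl ⟨0, by simp, ?_⟩⟩))
  rw [C.α_zero, hk]

/-- Pull-back of a holomorphic function to the disk. -/
theorem OrientedBoundary.differentiableAt_comp {C : Cuts E u} (B : OrientedBoundary C)
    {f : OnePoint ℂ → ℂ} {N : Set (OnePoint ℂ)} (hN : IsOpen N) (hf : HolomorphicOn f N) {ζ : ℂ}
    (hζ : ζ ∈ ball (0 : ℂ) 1) (hζN : B.ψ ζ ∈ N) : DifferentiableAt ℂ (fun w => f (B.ψ w)) ζ := by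
  have hψc : ∀ w ∈ ball (0 : ℂ) 1, ContinuousAt B.ψ w := fun w hw =>
    B.continuousOn.continuousAt (mem_of_superset (isOpen_ball.mem_nhds hw) ball_subset_closedBall)
  have hfin : ∀ w ∈ ball (0 : ℂ) 1, B.ψ w ∈ N → B.ψ w ≠ ∞ →
      DifferentiableAt ℂ (fun w => f (B.ψ w)) w := by
    intro w hw hwN hinf
    obtain ⟨g, hg, he⟩ := B.conformal w hw hinf
    have hw' : B.ψ w = g w := he.self_of_nhds
    have h1 : DifferentiableAt ℂ (fun x => f (g x : OnePoint ℂ)) w :=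
      DifferentiableAt.comp (g := fun x : ℂ => f (x : OnePoint ℂ)) w (hf.1 _ (hw' ▸ hwN)) hg
    refine h1.congr_of_eventuallyEq ?_
    filter_upwards [he] with x hx
    rw [hx]
  by_cases hinf : B.ψ ζ = ∞
  · refine (Complex.analyticAt_of_differentiable_on_punctured_nhds_of_continuousAt ?_ ?_).differentiableAt
    · filter_upwards [self_mem_nhdsWithin, mem_nhdsWithin_of_mem_nhds (isOpen_ball.mem_nhds hζ),
        mem_nhdsWithin_of_mem_nhds ((hψc ζ hζ).preimage_mem_nhds (hN.mem_nhds hζN))] with w h1 h2 h3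
      exact hfin w h2 h3 fun h => h1 (B.bijOn.injOn h2 hζ (h.trans hinf.symm))
    · exact ContinuousAt.comp (g := f) (hf.continuousAt hζN) (hψc ζ hζ)
  · exact hfin ζ hζ hζN hinf

theorem OrientedBoundary.differentiableOn_comp {C : Cuts E u} (B : OrientedBoundary C)
    (hE : IsMultiplyConnected E) {f : OnePoint ℂ → ℂ} (hf : HolomorphicOn f C.cutDomain) :
    DifferentiableOn ℂ (fun w => f (B.ψ w)) (ball 0 1) := fun _ hζ =>
  (B.differentiableAt_comp (C.isOpen_cutDomain hE) hf hζ (B.bijOn.mapsTo hζ)).differentiableWithinAt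

/-- A harmonic function on the cut domain is, read in the disk, the real part of a holomorphic
function. -/
theorem OrientedBoundary.exists_re_eq_comp {C : Cuts E u} (B : OrientedBoundary C)
    (hE : IsMultiplyConnected E) {w : OnePoint ℂ → ℝ} (hw : HarmonicOn w C.cutDomain) :
    ∃ G : ℂ → ℂ, DifferentiableOn ℂ G (ball 0 1) ∧ ∀ ζ ∈ ball (0 : ℂ) 1, (G ζ).re = w (B.ψ ζ) := by
  have h : InnerProductSpace.HarmonicOnNhd (fun ζ => w (B.ψ ζ)) (ball 0 1) := by
    intro ζ hζ
    obtain ⟨N, Φ, hN, hpN, hNS, hΦ, hre⟩ :=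
      hw.exists_local_holomorphic (C.isOpen_cutDomain hE) (B.bijOn.mapsTo hζ)
    have hev : ∀ᶠ ξ in 𝓝 ζ, ξ ∈ ball (0 : ℂ) 1 ∧ B.ψ ξ ∈ N := by
      have hψc : ContinuousAt B.ψ ζ := B.continuousOn.continuousAt
        (mem_of_superset (isOpen_ball.mem_nhds hζ) ball_subset_closedBall)
      filter_upwards [isOpen_ball.mem_nhds hζ, hψc.preimage_mem_nhds (hN.mem_nhds hpN)]
        with ξ h1 h2 using ⟨h1, h2⟩
    have han : AnalyticAt ℂ (fun ξ => Φ (B.ψ ξ)) ζ := by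
      rw [Complex.analyticAt_iff_eventually_differentiableAt]
      filter_upwards [hev] with ξ hξ using B.differentiableAt_comp hN hΦ hξ.1 hξ.2
    refine (InnerProductSpace.harmonicAt_congr_nhds ?_).1 han.harmonicAt_re
    filter_upwards [hev] with ξ hξ using hre _ hξ.2
  obtain ⟨G, hG, he⟩ := h.exists_analyticOnNhd_ball_re_eq
  exact ⟨G, hG.differentiableOn, fun ζ hζ => he hζ⟩

/-- The conformal map is open at finite points. -/
theorem OrientedBoundary.eventually_exists_preimage {C : Cuts E u} (B : OrientedBoundary C)
    {ζ z : ℂ} (hζ : ζ ∈ ball (0 : ℂ) 1) (hz : B.ψ ζ = z) {V : Set ℂ} (hV : V ∈ 𝓝 ζ) :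
    ∀ᶠ w : ℂ in 𝓝 z, ∃ ξ ∈ V, B.ψ ξ = w := by
  obtain ⟨g, hg, he⟩ := B.conformal ζ hζ (by rw [hz]; exact OnePoint.coe_ne_infty z)
  have hgz : g ζ = z := by
    have := he.self_of_nhds
    rw [hz, OnePoint.coe_eq_coe] at this
    exact this.symm
  have han : AnalyticAt ℂ g ζ := by
    rw [Complex.analyticAt_iff_eventually_differentiableAt]
    filter_upwards [he.eventually_nhds, isOpen_ball.mem_nhds hζ] with ξ h1 h2
    have h3 : B.ψ ξ = g ξ := h1.self_of_nhds
    obtain ⟨g', hg', he'⟩ := B.conformal ξ h2 (by rw [h3]; exact OnePoint.coe_ne_infty _)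
    refine hg'.congr_of_eventuallyEq ?_
    filter_upwards [h1, he'] with x hx hx'
    rw [hx, OnePoint.coe_eq_coe] at hx'
    exact hx'
  rcases han.eventually_constant_or_nhds_le_map_nhds with hc | hmap
  · exfalso
    have h1 : ∀ᶠ ξ in 𝓝[≠] ζ, False := by
      filter_upwards [self_mem_nhdsWithin, (hc.and he).filter_mono nhdsWithin_le_nhds,
        mem_nhdsWithin_of_mem_nhds (isOpen_ball.mem_nhds hζ)] with ξ h1 h2 h3
      exact h1 (B.bijOn.injOn h3 hζ (by rw [h2.2, h2.1, hgz, hz]))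
    exact h1.exists.elim fun _ h => h
  · rw [hgz] at hmap
    have : g '' (V ∩ {ξ | B.ψ ξ = g ξ}) ∈ 𝓝 z := hmap (image_mem_map (inter_mem hV he))
    filter_upwards [this] with w hw
    obtain ⟨ξ, hξ, rfl⟩ := hw
    exact ⟨ξ, hξ.1, hξ.2⟩

/-- The holomorphic function of `exists_re_eq_comp`, transported back to the cut domain. -/
theorem OrientedBoundary.exists_differentiableAt_invFunOn {C : Cuts E u} (B : OrientedBoundary C)
    (hE : IsMultiplyConnected E) {w : OnePoint ℂ → ℝ} (hw : HarmonicOn w C.cutDomain) {G : ℂ → ℂ}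
    (hG : DifferentiableOn ℂ G (ball 0 1)) (hre : ∀ ζ ∈ ball (0 : ℂ) 1, (G ζ).re = w (B.ψ ζ))
    {z : ℂ} (hz : (z : OnePoint ℂ) ∈ C.cutDomain) :
    DifferentiableAt ℂ (fun x : ℂ => G (Function.invFunOn B.ψ (ball 0 1) (x : OnePoint ℂ))) z := by
  obtain ⟨ζ, hζ, hζz⟩ := B.bijOn.surjOn hz
  obtain ⟨N, Φ, hN, hpN, hNS, hΦ, hΦre⟩ :=
    hw.exists_local_holomorphic (C.isOpen_cutDomain hE) hz
  have hψc : ContinuousAt B.ψ ζ := B.continuousOn.continuousAt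
    (mem_of_superset (isOpen_ball.mem_nhds hζ) ball_subset_closedBall)
  obtain ⟨δ, hδ, hball⟩ : ∃ δ > 0, ball ζ δ ⊆ ball (0 : ℂ) 1 ∩ B.ψ ⁻¹' N :=
    Metric.mem_nhds_iff.1 (inter_mem (isOpen_ball.mem_nhds hζ)
      (hψc.preimage_mem_nhds (hN.mem_nhds (hζz ▸ hpN))))
  have hd : DifferentiableOn ℂ (fun ξ => Φ (B.ψ ξ) - G ξ) (ball ζ δ) := fun ξ hξ =>
    ((B.differentiableAt_comp hN hΦ (hball hξ).1 (hball hξ).2).sub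
      (hG.differentiableAt (isOpen_ball.mem_nhds (hball hξ).1))).differentiableWithinAt
  obtain ⟨c, hc⟩ := (hd.analyticOnNhd isOpen_ball).eq_const_of_re_eq_const (c₀ := 0)
    (fun ξ hξ => by
      rw [Complex.sub_re, hΦre _ (hball hξ).2, hre _ (hball hξ).1, sub_self])
    isOpen_ball ((convex_ball ζ δ).isConnected (nonempty_ball.2 hδ))
  have h1 := (hΦ.1 z hpN).sub_const c
  refine h1.congr_of_eventuallyEq ?_
  filter_upwards [B.eventually_exists_preimage hζ hζz (ball_mem_nhds ζ hδ)] with x hx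
  obtain ⟨ξ, hξ, hξx⟩ := hx
  have e : Function.invFunOn B.ψ (ball 0 1) (x : OnePoint ℂ) = ξ := by
    rw [← hξx]; exact B.bijOn.injOn.leftInvOn_invFunOn (hball hξ).1
  rw [e, ← hξx, ← hc ξ hξ]
  ring

/-! ### Regular boundary points -/

theorem HasConeAt.congr {A A' : Set ℂ} {z n : ℂ} (h : HasConeAt A z n)
    (hAA' : ∀ᶠ w in 𝓝 z, w ∈ A ↔ w ∈ A') : HasConeAt A' z n := by
  obtain ⟨R, hR, H⟩ := Metric.eventually_nhds_iff_ball.1 hAA'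
  have hcl : ∀ w ∈ ball z R, w ∈ closure A' → w ∈ closure A := by
    intro w hw hcl
    rw [mem_closure_iff_frequently] at hcl ⊢
    refine (hcl.and_eventually (isOpen_ball.mem_nhds hw)).mono fun x hx => (H x hx.2).2 hx.1
  refine ⟨h.norm_eq, ?_, fun hz => h.notMem ((H z (mem_ball_self hR)).2 hz), fun ε hε => ?_⟩
  · have := h.mem_closure
    rw [mem_closure_iff_frequently] at this ⊢
    exact (this.and_eventually hAA').mono fun x hx => hx.2.1 hx.1
  · obtain ⟨r, hr, Hr⟩ := h.cone ε hε
    refine ⟨min r R, lt_min hr hR, fun w hw w' hw' hwc hin => ?_⟩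
    have hwR := ball_subset_ball (min_le_right r R) hw
    have hw'R := ball_subset_ball (min_le_right r R) hw'
    exact (H w' hw'R).1 (Hr w (ball_subset_ball (min_le_left _ _) hw) w'
      (ball_subset_ball (min_le_left _ _) hw') (hcl w hwR hwc) hin)

/-- At all boundary points with finitely many exceptions there is an exterior normal, no cut ends,
and the gradient of the potential has a limit, which is normal to the boundary. -/
theorem Cuts.exists_finite_regular (hE : IsMultiplyConnected E) (hu : IsPotential E u)
    (C : Cuts E u) (hne : (frontier (domain E)).Nonempty) :
    ∃ S : Set (OnePoint ℂ), S.Finite ∧ ∀ p ∈ frontier (domain E) \ S, ∃ z n g : ℂ,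
      p = (z : OnePoint ℂ) ∧ IsExteriorNormal (domain E) z n ∧
      (∀ n', IsExteriorNormal (domain E) z n' → HasConeAt (finitePart C.cutDomain) z n') ∧
      Tendsto (grad u) (𝓝[finitePart C.cutDomain] z) (𝓝 g) ∧ inner ℝ g (Complex.I * n) = 0 := by
  obtain ⟨S₁, hS₁, H₁⟩ := hE.regular
  obtain ⟨S₂, hS₂, H₂⟩ := hu.differentiable
  refine ⟨S₁ ∪ S₂ ∪ C.endPts, (hS₁.union hS₂).union C.finite_endPts, fun p hp => ?_⟩
  obtain ⟨z, n, rfl, hn⟩ := H₁ p ⟨hp.1, fun h => hp.2 (Or.inl (Or.inl h))⟩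
  obtain ⟨z', g, hz', hg⟩ := H₂ z ⟨hp.1, fun h => hp.2 (Or.inl (Or.inr h))⟩
  rw [OnePoint.coe_eq_coe] at hz'
  subst hz'
  have hpΩ := notMem_of_mem_frontier hE hp.1
  have hev : ∀ᶠ w : ℂ in 𝓝 z, w ∈ finitePart (domain E) ↔ w ∈ finitePart C.cutDomain := by
    have h1 : (z : OnePoint ℂ) ∉ C.carrier := fun h => hp.2 (Or.inr (C.carrier_diff_subset ⟨h, hpΩ⟩))
    have h2 : ∀ᶠ w : ℂ in 𝓝 z, (w : OnePoint ℂ) ∉ C.carrier :=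
      (OnePoint.continuous_coe.tendsto z).eventually (C.isClosed_carrier.isOpen_compl.mem_nhds h1)
    filter_upwards [h2] with w hw
    exact ⟨fun h => ⟨h, hw⟩, fun h => h.1⟩
  have hfilter : 𝓝[finitePart C.cutDomain] z ≤ 𝓝[finitePart (domain E)] z :=
    nhdsWithin_mono _ fun w hw => hw.1
  have hcone := hn.hasConeAt.congr hev
  have hg' := hg.mono_left hfilter
  refine ⟨z, n, g, rfl, hn, fun n' hn' => hn'.hasConeAt.congr hev, hg', ?_⟩
  -- `u` is differentiable in the domain and has an extremum at the boundary point
  have hd : ∀ᶠ w in 𝓝[finitePart C.cutDomain] z,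
      DifferentiableAt ℝ (fun w : ℂ => u (w : OnePoint ℂ)) w := by
    filter_upwards [self_mem_nhdsWithin] with w hw
    exact (hu.harmonic.1 w hw.1).1.differentiableAt two_ne_zero
  have hucl : Tendsto (fun w : ℂ => u (w : OnePoint ℂ)) (𝓝[finitePart C.cutDomain] z)
      (𝓝 (u (z : OnePoint ℂ))) := by
    have h1 := hu.continuousOn (z : OnePoint ℂ) (frontier_subset_closure hp.1)
    have h2 : Tendsto ((↑) : ℂ → OnePoint ℂ) (𝓝[finitePart C.cutDomain] z)
        (𝓝[closure (domain E)] (z : OnePoint ℂ)) := by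
      refine tendsto_nhdsWithin_iff.2
        ⟨(OnePoint.continuous_coe.tendsto z).mono_left nhdsWithin_le_nhds, ?_⟩
      filter_upwards [self_mem_nhdsWithin] with w hw using subset_closure hw.1
    exact Tendsto.comp h1 h2
  have hbot : (𝓝[finitePart C.cutDomain] z).NeBot :=
    mem_closure_iff_nhdsWithin_neBot.1 hcone.mem_closure
  have hrange : ∀ᶠ w in 𝓝[finitePart C.cutDomain] z, u ((w : ℂ) : OnePoint ℂ) ∈ Icc 0 1 := by
    filter_upwards [self_mem_nhdsWithin] with w hw
    exact hu.mem_Icc hE hne (subset_closure hw.1)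
  obtain ⟨κ, hκ⟩ := hcone.exists_hasExpansionAt hd hg'
  have hκu : κ = u (z : OnePoint ℂ) := tendsto_nhds_unique hκ.tendsto hucl
  rcases hu.eq_zero_or_one hpΩ with h0 | h1
  · refine hcone.inner_eq_zero_of_le hκ ?_
    filter_upwards [hrange] with w hw
    rw [hκu, h0]; exact hw.1
  · have hneg : HasExpansionAt (finitePart C.cutDomain) (fun w : ℂ => -u (w : OnePoint ℂ)) z (-κ) (-g) := by
      intro ε hε
      filter_upwards [hκ ε hε] with w hw
      rw [← abs_neg] at hw
      convert hw using 2
      rw [inner_neg_left]; ring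
    have := hcone.inner_eq_zero_of_le hneg (by
      filter_upwards [hrange] with w hw
      rw [hκu, h1]; linarith [hw.2])
    rw [inner_neg_left] at this
    linarith

end Setting

/-! ### Boundary values of the conjugate function -/

instance neBot_nhdsWithin_circlePt (t : ℝ) : (𝓝[ball (0 : ℂ) 1] circlePt t).NeBot := by
  rw [← mem_closure_iff_nhdsWithin_neBot, closure_ball 0 one_ne_zero]
  exact circlePt_mem_closedBall t

/-- Boundary limits that are locally constant along an arc of the circle are constant. -/
theorem exists_tendsto_const_of_locally {k : ℂ → ℝ} {a b : ℝ} (hab : a < b)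
    (h : ∀ t ∈ Ioo a b, ∃ c, ∃ r > 0, ∀ x, |x - t| < r →
      Tendsto k (𝓝[ball 0 1] circlePt x) (𝓝 c)) :
    ∃ c, ∀ t ∈ Ioo a b, Tendsto k (𝓝[ball 0 1] circlePt t) (𝓝 c) := by
  have hl : ∀ t ∈ Ioo a b, HasDerivAt (fun x => extendFrom (ball 0 1) k (circlePt x)) 0 t := by
    intro t ht
    obtain ⟨c, r, hr, H⟩ := h t ht
    refine (hasDerivAt_const t c).congr_of_eventuallyEq ?_
    filter_upwards [ball_mem_nhds t hr] with x hx
    exact extendFrom_eq (mem_closure_iff_nhdsWithin_neBot.2 (neBot_nhdsWithin_circlePt x))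
      (H x (by simpa [Real.dist_eq] using hx))
  obtain ⟨t₀, ht₀⟩ := nonempty_Ioo.2 hab
  refine ⟨extendFrom (ball 0 1) k (circlePt t₀), fun t ht => ?_⟩
  have e := isOpen_Ioo.is_const_of_deriv_eq_zero isPreconnected_Ioo
    (fun x hx => (hl x hx).differentiableAt.differentiableWithinAt) (fun x hx => (hl x hx).deriv)
    ht₀ ht
  obtain ⟨c, r, hr, H⟩ := h t ht
  simpa only [e] using tendsto_extendFrom ⟨c, H t (by simpa using hr)⟩

section Setting

variable {m : ℕ} {E : Fin (m + 1) → Set (OnePoint ℂ)} {u : OnePoint ℂ → ℝ}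

theorem OrientedBoundary.continuousOn_comp_potential (hu : IsPotential E u) {C : Cuts E u}
    (B : OrientedBoundary C) : ContinuousOn (fun ζ => u (B.ψ ζ)) (closedBall 0 1) :=
  hu.continuousOn.comp B.continuousOn fun _ hζ => B.mem_closure_domain hζ

theorem OrientedBoundary.tendsto_comp_potential (hu : IsPotential E u) {C : Cuts E u}
    (B : OrientedBoundary C) (t : ℝ) :
    Tendsto (fun ζ => u (B.ψ ζ)) (𝓝[ball 0 1] circlePt t) (𝓝 (u (B.ψ (circlePt t)))) :=
  (B.continuousOn_comp_potential hu _ (circlePt_mem_closedBall t)).mono_left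
    (nhdsWithin_mono _ ball_subset_closedBall)

/-- A boundary limit of the conjugate function gives one of the complex potential. -/
theorem OrientedBoundary.tendsto_chart (hu : IsPotential E u) {C : Cuts E u}
    (B : OrientedBoundary C) {v : OnePoint ℂ → ℝ} {t c : ℝ}
    (h : Tendsto (fun ζ => v (B.ψ ζ)) (𝓝[ball 0 1] circlePt t) (𝓝 c)) :
    Tendsto (fun z => complexPotential u v (B.ψ (discChart z))) (𝓝[upper] (t : ℂ))
      (𝓝 ((u (B.ψ (circlePt t)) : ℂ) + c * Complex.I)) := by
  rw [tendsto_comp_discChart (f := fun ζ => complexPotential u v (B.ψ ζ))]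
  exact ((Complex.continuous_ofReal.tendsto _).comp (B.tendsto_comp_potential hu t)).add
    (((Complex.continuous_ofReal.tendsto _).comp h).mul_const _)

theorem complexPotential_re (u v : OnePoint ℂ → ℝ) (p : OnePoint ℂ) :
    (complexPotential u v p).re = u p := by simp [complexPotential]

theorem complexPotential_im (u v : OnePoint ℂ → ℝ) (p : OnePoint ℂ) :
    (complexPotential u v p).im = v p := by simp [complexPotential]

theorem OrientedBoundary.θ_le {C : Cuts E u} (B : OrientedBoundary C) {k l : ℕ} (hkl : k ≤ l)
    (hl : l ≤ 2 * B.J + 2) : B.θ k ≤ B.θ l := by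
  induction l, hkl using Nat.le_induction with
  | base => exact le_rfl
  | succ n hn ih => exact (ih (by omega)).trans (B.θ_lt n (by omega)).le

theorem OrientedBoundary.exists_mem_Ico {C : Cuts E u} (B : OrientedBoundary C) {t : ℝ}
    (ht : t ∈ Ico (B.θ 0) (B.θ 0 + 2 * Real.pi)) :
    ∃ k ≤ 2 * B.J + 1, t ∈ Ico (B.θ k) (B.θ (k + 1)) := by
  have key : ∀ n, t < B.θ n → ∃ k < n, t ∈ Ico (B.θ k) (B.θ (k + 1)) := by
    intro n
    induction n with
    | zero => exact fun h => absurd ht.1 (not_le.2 h)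
    | succ n ih =>
      intro h
      by_cases hn : t < B.θ n
      · obtain ⟨k, hk, h'⟩ := ih hn
        exact ⟨k, by omega, h'⟩
      · exact ⟨n, by omega, not_lt.1 hn, h⟩
  obtain ⟨k, hk, h⟩ := key (2 * B.J + 2) (by rw [B.θ_close]; exact ht.2)
  exact ⟨k, by omega, h⟩

/-- The side of a cut or the boundary segment to which a boundary parameter belongs. -/
theorem OrientedBoundary.exists_side_or_segment {C : Cuts E u} (B : OrientedBoundary C) {t : ℝ}
    (ht : t ∈ Ico (B.θ 0) (B.θ 0 + 2 * Real.pi)) : ∃ p ≤ B.J,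
    t ∈ Icc (B.θ (2 * p)) (B.θ (2 * p + 1)) ∨ t ∈ Ioo (B.θ (2 * p + 1)) (B.θ (2 * p + 2)) := by
  obtain ⟨k, hk, h⟩ := B.exists_mem_Ico ht
  obtain ⟨p, rfl | rfl⟩ := Nat.even_or_odd' k
  · exact ⟨p, by omega, Or.inl ⟨h.1, h.2.le⟩⟩
  · refine ⟨p, by omega, ?_⟩
    rcases h.1.eq_or_lt with h' | h'
    · exact Or.inl ⟨h' ▸ (B.θ_lt (2 * p) (by omega)).le, h'.ge⟩
    · exact Or.inr ⟨h', h.2⟩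

/-- The potential is constant on a boundary segment. -/
theorem IsPotential.segment_eq (hu : IsPotential E u) {C : Cuts E u} (B : OrientedBoundary C)
    {p : ℕ} (hp : p ≤ B.J) {t : ℝ} (ht : t ∈ Icc (B.θ (2 * p + 1)) (B.θ (2 * p + 2))) :
    u (B.ψ (circlePt t)) = if p = B.J then 0 else 1 := by
  have h := B.segment p hp t ht
  split_ifs with hpJ
  · rw [hpJ, B.label_last] at h
    exact hu.eq_zero _ h
  · exact hu.eq_one _ (B.label_ne p (by omega)) _ h

/-- Along the side of a cut the boundary values of the conjugate function are locally constant: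
locally they are the boundary values of a conjugate function on both sides of the cut, and the
values of such a function on the cuts form a null set. -/
theorem OrientedBoundary.exists_tendsto_cut_local (hE : IsMultiplyConnected E)
    (hu : IsPotential E u) {C : Cuts E u} (B : OrientedBoundary C) {v : OnePoint ℂ → ℝ}
    (hv : IsHarmonicConjugate u v C.cutDomain) {p : ℕ} (hp : p ≤ B.J) {t : ℝ}
    (ht : t ∈ Ioo (B.θ (2 * p)) (B.θ (2 * p + 1))) :
    ∃ c, ∃ r > 0, ∀ x, |x - t| < r →
      Tendsto (fun ζ => v (B.ψ ζ)) (𝓝[ball 0 1] circlePt x) (𝓝 c) := by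
  obtain ⟨N, Φ, hN, hpN, hNS, hΦ, hΦre⟩ := hu.harmonic.exists_local_holomorphic hE.isOpen_domain
    (B.cut_side p hp t ht).1
  have hpre : B.ψ ⁻¹' N ∈ 𝓝[closedBall 0 1] circlePt t :=
    (B.continuousOn _ (circlePt_mem_closedBall t)).preimage_mem_nhdsWithin (hN.mem_nhds hpN)
  obtain ⟨δ, hδ, hball⟩ := Metric.mem_nhdsWithin_iff.1 hpre
  set A : Set ℂ := ball (circlePt t) δ ∩ ball 0 1 with hA
  have hAo : IsOpen A := isOpen_ball.inter isOpen_ball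
  have hAN : ∀ ζ ∈ A, B.ψ ζ ∈ N := fun ζ hζ => hball ⟨hζ.1, ball_subset_closedBall hζ.2⟩
  have hAne : A.Nonempty := by
    have : A ∈ 𝓝[ball 0 1] circlePt t :=
      inter_mem (mem_nhdsWithin_of_mem_nhds (ball_mem_nhds _ hδ)) self_mem_nhdsWithin
    exact nonempty_of_mem this
  have hd : DifferentiableOn ℂ (fun ζ => complexPotential u v (B.ψ ζ) - Φ (B.ψ ζ)) A := fun ζ hζ =>
    ((B.differentiableAt_comp (C.isOpen_cutDomain hE) hv hζ.2 (B.bijOn.mapsTo hζ.2)).sub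
      (B.differentiableAt_comp hN hΦ hζ.2 (hAN ζ hζ))).differentiableWithinAt
  obtain ⟨c, hc⟩ := (hd.analyticOnNhd hAo).eq_const_of_re_eq_const (c₀ := 0)
    (fun ζ hζ => by rw [Complex.sub_re, hΦre _ (hAN ζ hζ), complexPotential_re, sub_self])
    hAo (((convex_ball _ _).inter (convex_ball _ _)).isConnected hAne)
  have hvA : ∀ ζ ∈ A, v (B.ψ ζ) = (Φ (B.ψ ζ)).im + c.im := fun ζ hζ => by
    have := congrArg Complex.im (hc ζ hζ)
    rw [Complex.sub_im, complexPotential_im] at this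
    linarith
  have hnear : ∀ᶠ x in 𝓝 t, circlePt x ∈ ball (circlePt t) δ ∧
      x ∈ Ioo (B.θ (2 * p)) (B.θ (2 * p + 1)) :=
    (continuous_circlePt.continuousAt.eventually (ball_mem_nhds _ hδ)).and (Ioo_mem_nhds ht.1 ht.2)
  obtain ⟨r, hr, hrball⟩ := Metric.eventually_nhds_iff_ball.1 hnear
  have hΦc : ∀ x ∈ ball t r, ContinuousWithinAt (fun ζ => (Φ (B.ψ ζ)).im) (closedBall 0 1)
      (circlePt x) := fun x hx => by
    have h1 : ContinuousAt Φ (B.ψ (circlePt x)) :=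
      hΦ.continuousAt (hball ⟨(hrball x hx).1, circlePt_mem_closedBall x⟩)
    exact Complex.continuous_im.continuousAt.comp_continuousWithinAt
      (h1.comp_continuousWithinAt (B.continuousOn _ (circlePt_mem_closedBall x)))
  -- a continuous function on an interval with values in a null set is constant
  have hconst : ∀ x ∈ ball t r, (Φ (B.ψ (circlePt x))).im = (Φ (B.ψ (circlePt t))).im := by
    have hcont : ContinuousOn (fun x => (Φ (B.ψ (circlePt x))).im) (ball t r) := fun x hx =>
      ContinuousWithinAt.comp (g := fun ζ => (Φ (B.ψ ζ)).im) (t := closedBall 0 1) (hΦc x hx)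
        continuous_circlePt.continuousWithinAt fun y _ => circlePt_mem_closedBall y
    have hpc : IsPreconnected ((fun x => (Φ (B.ψ (circlePt x))).im) '' ball t r) :=
      (convex_ball t r).isPreconnected.image _ hcont
    have hnull : volume ((fun x => (Φ (B.ψ (circlePt x))).im) '' ball t r) = 0 := by
      refine measure_mono_null ?_ (C.volume_image_im_carrier hN hΦ hΦre)
      rintro _ ⟨x, hx, rfl⟩
      exact ⟨_, ⟨(B.cut_side p hp x (hrball x hx).2).2,
        hball ⟨(hrball x hx).1, circlePt_mem_closedBall x⟩⟩, rfl⟩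
    intro x hx
    by_contra hne
    have hx' := mem_image_of_mem (fun x => (Φ (B.ψ (circlePt x))).im) hx
    have ht' := mem_image_of_mem (fun x => (Φ (B.ψ (circlePt x))).im) (mem_ball_self hr : t ∈ ball t r)
    have hsub : uIcc (Φ (B.ψ (circlePt x))).im (Φ (B.ψ (circlePt t))).im ⊆ _ :=
      hpc.ordConnected.uIcc_subset hx' ht'
    have h0 := measure_mono_null hsub hnull
    rw [Real.volume_interval, ENNReal.ofReal_eq_zero] at h0
    exact hne (by
      have := abs_nonpos_iff.1 h0
      linarith)
  refine ⟨(Φ (B.ψ (circlePt t))).im + c.im, r, hr, fun x hx => ?_⟩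
  have hx' : x ∈ ball t r := by simpa [Real.dist_eq] using hx
  have h1 := ((hΦc x hx').mono_left (nhdsWithin_mono _ ball_subset_closedBall)).add_const c.im
  simp only [hconst x hx'] at h1
  refine h1.congr' ?_
  filter_upwards [self_mem_nhdsWithin,
    mem_nhdsWithin_of_mem_nhds (isOpen_ball.mem_nhds (hrball x hx').1)] with ζ h2 h3
  exact (hvA ζ ⟨h3, h2⟩).symm

/-- Limits at a finite boundary point of the cut domain, read in the disk. -/
theorem OrientedBoundary.tendsto_comp_of_finitePart {C : Cuts E u} (B : OrientedBoundary C)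
    {w : OnePoint ℂ → ℝ} {ζ z : ℂ} {c : ℝ} (hζ : ζ ∈ closedBall (0 : ℂ) 1) (hz : B.ψ ζ = z)
    (h : Tendsto (fun x : ℂ => w (x : OnePoint ℂ)) (𝓝[finitePart C.cutDomain] z) (𝓝 c)) :
    Tendsto (fun ξ => w (B.ψ ξ)) (𝓝[ball 0 1] ζ) (𝓝 c) := by
  have h1 : Tendsto w (𝓝[C.cutDomain] (z : OnePoint ℂ)) (𝓝 c) := by
    rw [OnePoint.nhdsWithin_coe, tendsto_map'_iff]
    exact h
  have h2 : Tendsto B.ψ (𝓝[ball 0 1] ζ) (𝓝[C.cutDomain] (z : OnePoint ℂ)) :=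
    tendsto_nhdsWithin_iff.2 ⟨hz ▸ (B.continuousOn ζ hζ).mono_left
      (nhdsWithin_mono _ ball_subset_closedBall),
      by filter_upwards [self_mem_nhdsWithin] with ξ hξ using B.bijOn.mapsTo hξ⟩
  exact h1.comp h2

/-- The gradient of the conjugate function is the rotated gradient of the potential. -/
theorem IsHarmonicConjugate.grad_eq {S : Set (OnePoint ℂ)} {v : OnePoint ℂ → ℝ}
    (hv : IsHarmonicConjugate u v S) {z : ℂ} (hz : (z : OnePoint ℂ) ∈ S) :
    grad v z = Complex.I * grad u z ∧ DifferentiableAt ℝ (fun w : ℂ => v (w : OnePoint ℂ)) z :=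
  (grad_of_holomorphic (hv.1 z hz) (Eventually.of_forall fun _ => complexPotential_re u v _)
    (Eventually.of_forall fun _ => complexPotential_im u v _)).2

/-- At a regular boundary point the conjugate function has a limit. -/
theorem OrientedBoundary.exists_tendsto_regular {C : Cuts E u}
    (B : OrientedBoundary C) {v : OnePoint ℂ → ℝ} (hv : IsHarmonicConjugate u v C.cutDomain)
    {ζ z n g : ℂ} (hζ : ζ ∈ closedBall (0 : ℂ) 1) (hz : B.ψ ζ = z)
    (hcone : HasConeAt (finitePart C.cutDomain) z n)
    (hg : Tendsto (grad u) (𝓝[finitePart C.cutDomain] z) (𝓝 g)) :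
    ∃ c, Tendsto (fun ξ => v (B.ψ ξ)) (𝓝[ball 0 1] ζ) (𝓝 c) := by
  have hgv : Tendsto (∇ fun w : ℂ => v (w : OnePoint ℂ)) (𝓝[finitePart C.cutDomain] z)
      (𝓝 (Complex.I * g)) := by
    refine (hg.const_mul Complex.I).congr' ?_
    filter_upwards [self_mem_nhdsWithin] with w hw using (hv.grad_eq hw).1.symm
  obtain ⟨κ, hκ⟩ := hcone.exists_hasExpansionAt (by
    filter_upwards [self_mem_nhdsWithin] with w hw using (hv.grad_eq hw).2) hgv
  exact ⟨κ, B.tendsto_comp_of_finitePart hζ hz hκ.tendsto⟩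

theorem OrientedBoundary.finite_segment_preimage {C : Cuts E u} (B : OrientedBoundary C)
    {S : Set (OnePoint ℂ)} (hS : S.Finite) {p : ℕ} (hp : p ≤ B.J) :
    {t ∈ Ioo (B.θ (2 * p + 1)) (B.θ (2 * p + 2)) | B.ψ (circlePt t) ∈ S}.Finite :=
  Set.Finite.of_finite_image (hS.subset (by rintro _ ⟨t, ht, rfl⟩; exact ht.2))
    (f := fun t => B.ψ (circlePt t))
    fun s hs t ht hst => B.segment_inj p hp p hp s hs.1 t ht.1 hst

/-- Near a parameter in a boundary segment all others belong to the segment and avoid a finite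
exceptional set. -/
theorem OrientedBoundary.exists_punctured {C : Cuts E u} (B : OrientedBoundary C)
    {S : Set (OnePoint ℂ)} (hS : S.Finite) {p : ℕ} (hp : p ≤ B.J) {t : ℝ}
    (ht : t ∈ Ioo (B.θ (2 * p + 1)) (B.θ (2 * p + 2))) :
    ∃ r > 0, ∀ x, |x - t| < r → x ∈ Ioo (B.θ (2 * p + 1)) (B.θ (2 * p + 2)) ∧
      (x ≠ t → B.ψ (circlePt x) ∉ S) := by
  have h1 : ∀ᶠ x in 𝓝 t, x ∉
      {t ∈ Ioo (B.θ (2 * p + 1)) (B.θ (2 * p + 2)) | B.ψ (circlePt t) ∈ S} \ {t} :=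
    ((B.finite_segment_preimage hS hp).sdiff.isClosed.isOpen_compl).mem_nhds (by simp)
  obtain ⟨r, hr, H⟩ := Metric.eventually_nhds_iff_ball.1 (h1.and (Ioo_mem_nhds ht.1 ht.2))
  refine ⟨r, hr, fun x hx => ?_⟩
  obtain ⟨h2, h3⟩ := H x (by simpa [Real.dist_eq] using hx)
  exact ⟨h3, fun hne hS => h2 ⟨⟨h3, hS⟩, hne⟩⟩

/-- The complex potential in the half-plane chart is holomorphic with real part in `[0, 1]`. -/
theorem OrientedBoundary.chart_properties (hE : IsMultiplyConnected E) (hu : IsPotential E u)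
    {C : Cuts E u} (B : OrientedBoundary C) {v : OnePoint ℂ → ℝ}
    (hv : IsHarmonicConjugate u v C.cutDomain) :
    DifferentiableOn ℂ (fun z => complexPotential u v (B.ψ (discChart z))) upper ∧
    ∀ z ∈ upper, (complexPotential u v (B.ψ (discChart z))).re ∈ Icc 0 1 := by
  refine ⟨differentiableOn_comp_discChart (B.differentiableOn_comp hE hv), fun z hz => ?_⟩
  rw [complexPotential_re]
  exact hu.mem_Icc hE (B.frontier_nonempty hE)
    (B.mem_closure_domain (ball_subset_closedBall (discChart_mem_ball.2 hz)))

/-- The conjugate function has limits at all points of the open boundary segments. -/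
theorem OrientedBoundary.exists_tendsto_segment (hE : IsMultiplyConnected E) (hu : IsPotential E u)
    {C : Cuts E u} (B : OrientedBoundary C) {v : OnePoint ℂ → ℝ}
    (hv : IsHarmonicConjugate u v C.cutDomain) {p : ℕ} (hp : p ≤ B.J) {t : ℝ}
    (ht : t ∈ Ioo (B.θ (2 * p + 1)) (B.θ (2 * p + 2))) :
    ∃ c, Tendsto (fun ζ => v (B.ψ ζ)) (𝓝[ball 0 1] circlePt t) (𝓝 c) := by
  obtain ⟨S, hS, HS⟩ := C.exists_finite_regular hE hu (B.frontier_nonempty hE)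
  obtain ⟨r, hr, H⟩ := B.exists_punctured hS hp ht
  obtain ⟨hd, h01⟩ := B.chart_properties hE hu hv
  set u₀ := u (B.ψ (circlePt t)) with hu₀
  obtain ⟨l, hl⟩ := exists_tendsto_of_re_eq_zero (x₀ := t) hr (M := 1 + |u₀|)
    (f := fun z => complexPotential u v (B.ψ (discChart z)) - u₀)
    ((hd.mono inter_subset_right).sub_const _)
    (fun z hz => by
      have := h01 z hz.2
      rw [Complex.sub_re, Complex.ofReal_re]
      refine (abs_sub _ _).trans ?_
      rw [abs_of_nonneg this.1]
      linarith [this.2])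
    (fun x hx hxr => by
      obtain ⟨hxI, hxS⟩ := H x hxr
      obtain ⟨z, n, g, hz, hn, hcone, hg, -⟩ :=
        HS _ ⟨B.segment_mem_frontier hE hp (Ioo_subset_Icc_self hxI), hxS hx⟩
      obtain ⟨c, hc⟩ := B.exists_tendsto_regular hv (circlePt_mem_closedBall x) hz (hcone n hn) hg
      refine ⟨_, (B.tendsto_chart hu hc).sub_const _, ?_⟩
      rw [hu.segment_eq B hp (Ioo_subset_Icc_self hxI), hu₀,
        hu.segment_eq B hp (Ioo_subset_Icc_self ht)]
      simp)
  refine ⟨l.im, ?_⟩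
  rw [← tendsto_comp_discChart]
  refine ((Complex.continuous_im.tendsto l).comp hl).congr fun z => ?_
  simp [complexPotential]

/-- At an end point of a cut side the conjugate function has the limit which it has on the side. -/
theorem OrientedBoundary.tendsto_corner (hE : IsMultiplyConnected E) (hu : IsPotential E u)
    {C : Cuts E u} (B : OrientedBoundary C) {v : OnePoint ℂ → ℝ}
    (hv : IsHarmonicConjugate u v C.cutDomain) {t r c : ℝ} (hr : 0 < r)
    (h : ∀ x, x ≠ t → |x - t| < r →
      Tendsto (fun ζ => v (B.ψ ζ)) (𝓝[ball 0 1] circlePt x) (𝓝 c) ∨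
      u (B.ψ (circlePt x)) = u (B.ψ (circlePt t)) ∧
        ∃ c', Tendsto (fun ζ => v (B.ψ ζ)) (𝓝[ball 0 1] circlePt x) (𝓝 c'))
    {s : Set ℝ} (hs : ∃ᶠ x in 𝓝[s] t,
      Tendsto (fun ζ => v (B.ψ ζ)) (𝓝[ball 0 1] circlePt x) (𝓝 c)) :
    Tendsto (fun ζ => v (B.ψ ζ)) (𝓝[ball 0 1] circlePt t) (𝓝 c) := by
  obtain ⟨hd, h01⟩ := B.chart_properties hE hu hv
  set u₀ := u (B.ψ (circlePt t)) with hu₀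
  have hf := tendsto_zero_of_corner (x₀ := t) hr (M := 1 + |u₀|)
    (f := fun z => complexPotential u v (B.ψ (discChart z)) - ((u₀ : ℂ) + c * Complex.I))
    ((hd.mono inter_subset_right).sub_const _)
    (fun z hz => by
      have := h01 z hz.2
      have e : ((u₀ : ℂ) + c * Complex.I).re = u₀ := by simp
      rw [Complex.sub_re, e]
      refine (abs_sub _ _).trans ?_
      rw [abs_of_nonneg this.1]
      linarith [this.2])
    (fun x hx hxr => by
      rcases h x hx hxr with h' | ⟨h1, c', hc'⟩
      · exact ⟨_, (B.tendsto_chart hu h').sub_const _, Or.inr (by simp)⟩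
      · exact ⟨_, (B.tendsto_chart hu hc').sub_const _, Or.inl (by simp [h1])⟩)
    (by
      have := (tendsto_comp_discChart.2 (B.tendsto_comp_potential hu t)).sub_const u₀
      rw [hu₀, sub_self] at this
      refine this.congr fun z => ?_
      simp [complexPotential, hu₀])
    (s := s) (hs.mono fun x hx => by
      have := (tendsto_comp_discChart.2 hx).sub_const c
      rw [sub_self] at this
      refine this.congr fun z => ?_
      simp [complexPotential])
  have := ((Complex.continuous_im.tendsto _).comp hf).add_const c
  rw [← tendsto_comp_discChart]
  simp only [Complex.zero_im, zero_add] at this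
  refine this.congr fun z => ?_
  simp [complexPotential]

/-- On each side of a cut, including its end points, the conjugate function has constant boundary
values. The starting point of `γ₀⁺`, where the limit is prescribed, is left out. -/
theorem OrientedBoundary.exists_tendsto_side (hE : IsMultiplyConnected E) (hu : IsPotential E u)
    {C : Cuts E u} (B : OrientedBoundary C) {v : OnePoint ℂ → ℝ}
    (hv : IsHarmonicConjugate u v C.cutDomain) {p : ℕ} (hp : p ≤ B.J) :
    ∃ c, ∀ t ∈ Icc (B.θ (2 * p)) (B.θ (2 * p + 1)), t ≠ B.θ 0 →
      Tendsto (fun ζ => v (B.ψ ζ)) (𝓝[ball 0 1] circlePt t) (𝓝 c) := by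
  have hlt := B.θ_lt (2 * p) (by omega)
  obtain ⟨c, hc⟩ := exists_tendsto_const_of_locally hlt
    fun t ht => B.exists_tendsto_cut_local hE hu hv hp ht
  refine ⟨c, fun t ht h0 => ?_⟩
  rcases ht.1.eq_or_lt with hl | hl
  · -- the segment before the side ends at the corner
    subst hl
    obtain ⟨q, rfl⟩ : ∃ q, p = q + 1 := ⟨p - 1, by
      have : p ≠ 0 := fun h => h0 (by rw [h])
      omega⟩
    have hq : q ≤ B.J := by omega
    have e : 2 * (q + 1) = 2 * q + 2 := by ring
    rw [e] at hlt hc ⊢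
    have hlt' := B.θ_lt (2 * q + 1) (by omega)
    refine B.tendsto_corner hE hu hv (r := min (B.θ (2 * q + 2) - B.θ (2 * q + 1))
      (B.θ (2 * q + 2 + 1) - B.θ (2 * q + 2))) (lt_min (sub_pos.2 hlt') (sub_pos.2 hlt)) ?_
      (s := Ioi (B.θ (2 * q + 2))) ?_
    · intro x hx hxr
      obtain ⟨h1, h2⟩ := lt_min_iff.1 hxr
      rw [abs_lt] at h1 h2
      rcases lt_or_gt_of_ne hx with h | h
      · have hxI : x ∈ Ioo (B.θ (2 * q + 1)) (B.θ (2 * q + 2)) := ⟨by linarith, h⟩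
        refine Or.inr ⟨?_, B.exists_tendsto_segment hE hu hv hq hxI⟩
        rw [hu.segment_eq B hq (Ioo_subset_Icc_self hxI), hu.segment_eq B hq ⟨hlt'.le, le_rfl⟩]
      · exact Or.inl (hc x ⟨h, by linarith⟩)
    · refine Eventually.frequently ?_
      filter_upwards [Ioo_mem_nhdsGT hlt] with x hx using hc x hx
  rcases ht.2.eq_or_lt with hr | hr
  · subst hr
    have hlt' := B.θ_lt (2 * p + 1) (by omega)
    refine B.tendsto_corner hE hu hv (r := min (B.θ (2 * p + 2) - B.θ (2 * p + 1))
      (B.θ (2 * p + 1) - B.θ (2 * p))) (lt_min (sub_pos.2 hlt') (sub_pos.2 hlt)) ?_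
      (s := Iio (B.θ (2 * p + 1))) ?_
    · intro x hx hxr
      obtain ⟨h1, h2⟩ := lt_min_iff.1 hxr
      rw [abs_lt] at h1 h2
      rcases lt_or_gt_of_ne hx with h | h
      · exact Or.inl (hc x ⟨by linarith, h⟩)
      · have hxI : x ∈ Ioo (B.θ (2 * p + 1)) (B.θ (2 * p + 2)) := ⟨h, by linarith⟩
        refine Or.inr ⟨?_, B.exists_tendsto_segment hE hu hv hp hxI⟩
        rw [hu.segment_eq B hp (Ioo_subset_Icc_self hxI), hu.segment_eq B hp ⟨le_rfl, hlt'.le⟩]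
    · refine Eventually.frequently ?_
      filter_upwards [Ioo_mem_nhdsLT hlt] with x hx using hc x hx
  · exact hc t ⟨hl, hr⟩

/-- The conjugate function extends continuously to the closed disk; its boundary values are
constant on the sides of the cuts, increase along the segments on `∂E_j` with `j ≥ 1`, where the
potential has its maximum, and decrease along the segment on `∂E₀`, where it has its minimum. -/
theorem OrientedBoundary.exists_extension (hE : IsMultiplyConnected E) (hu : IsPotential E u)
    {C : Cuts E u} (B : OrientedBoundary C) {v : OnePoint ℂ → ℝ}
    (hv : IsHarmonicConjugate u v C.cutDomain)
    (hv₀ : Tendsto (fun ζ => v (B.ψ ζ)) (𝓝[ball 0 1] (circlePt (B.θ 0))) (𝓝 0)) :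
    ∃ V : ℂ → ℝ, ContinuousOn V (closedBall 0 1) ∧ (∀ ζ ∈ ball (0 : ℂ) 1, V ζ = v (B.ψ ζ)) ∧
      V (circlePt (B.θ 0)) = 0 ∧
      (∀ p ≤ B.J, ∀ t ∈ Icc (B.θ (2 * p)) (B.θ (2 * p + 1)),
        V (circlePt t) = V (circlePt (B.θ (2 * p)))) ∧
      (∀ p < B.J, MonotoneOn (fun t => V (circlePt t)) (Icc (B.θ (2 * p + 1)) (B.θ (2 * p + 2)))) ∧
      AntitoneOn (fun t => V (circlePt t)) (Icc (B.θ (2 * B.J + 1)) (B.θ (2 * B.J + 2))) := by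
  have hcl : ∀ t, circlePt t ∈ closure (ball (0 : ℂ) 1) := fun t =>
    mem_closure_iff_nhdsWithin_neBot.2 (neBot_nhdsWithin_circlePt t)
  have hdiff := B.differentiableOn_comp hE hv
  have hball : ∀ ζ ∈ ball (0 : ℂ) 1,
      Tendsto (fun ζ => v (B.ψ ζ)) (𝓝[ball 0 1] ζ) (𝓝 (v (B.ψ ζ))) := fun ζ hζ => by
    have := (Complex.continuous_im.tendsto _).comp (hdiff.continuousOn ζ hζ)
    simpa only [Function.comp_def, complexPotential_im] using this
  have hlimI : ∀ t ∈ Ico (B.θ 0) (B.θ 0 + 2 * Real.pi),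
      ∃ c, Tendsto (fun ζ => v (B.ψ ζ)) (𝓝[ball 0 1] circlePt t) (𝓝 c) := by
    intro t ht
    by_cases h0 : t = B.θ 0
    · exact ⟨0, h0 ▸ hv₀⟩
    obtain ⟨p, hp, h | h⟩ := B.exists_side_or_segment ht
    · obtain ⟨c, hc⟩ := B.exists_tendsto_side hE hu hv hp
      exact ⟨c, hc t h h0⟩
    · exact B.exists_tendsto_segment hE hu hv hp h
  have hlim : ∀ ζ ∈ closedBall (0 : ℂ) 1,
      ∃ c, Tendsto (fun ζ => v (B.ψ ζ)) (𝓝[ball 0 1] ζ) (𝓝 c) := by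
    intro ζ hζ
    rcases (mem_closedBall_zero_iff.1 hζ).lt_or_eq with h | h
    · exact ⟨_, hball ζ (mem_ball_zero_iff.2 h)⟩
    · obtain ⟨t, ht, rfl⟩ := exists_circlePt_eq_Ico h (B.θ 0)
      exact hlimI t ht
  set V : ℂ → ℝ := extendFrom (ball 0 1) (fun ζ => v (B.ψ ζ)) with hV
  have hVc : ContinuousOn V (closedBall 0 1) :=
    continuousOn_extendFrom (closure_ball (0 : ℂ) one_ne_zero).ge hlim
  have hVt : ∀ t, Tendsto (fun ζ => v (B.ψ ζ)) (𝓝[ball 0 1] circlePt t) (𝓝 (V (circlePt t))) :=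
    fun t => tendsto_extendFrom (hlim _ (circlePt_mem_closedBall t))
  have hVcirc : Continuous fun t => V (circlePt t) :=
    hVc.comp_continuous continuous_circlePt circlePt_mem_closedBall
  obtain ⟨hd, h01⟩ := B.chart_properties hE hu hv
  have hder : ∀ p ≤ B.J, ∀ t ∈ Ioo (B.θ (2 * p + 1)) (B.θ (2 * p + 2)),
      if p = B.J then ∃ V', V' ≤ 0 ∧ HasDerivAt (fun t => V (circlePt t)) V' t
      else ∃ V', 0 ≤ V' ∧ HasDerivAt (fun t => V (circlePt t)) V' t := by
    intro p hp t ht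
    obtain ⟨r, hr, H⟩ := B.exists_punctured finite_empty hp ht
    have hut : ∀ x, |x - t| < r → u (B.ψ (circlePt x)) = if p = B.J then 0 else 1 := fun x hx =>
      hu.segment_eq B hp (Ioo_subset_Icc_self (H x hx).1)
    split_ifs with hpJ
    · obtain ⟨V', h1, h2⟩ := hasDerivAt_im_boundary_nonneg (x₀ := t) hr
        (f := fun z => -complexPotential u v (B.ψ (discChart z))) (V := fun t => -V (circlePt t))
        (hd.mono inter_subset_right).neg
        (fun z hz => by rw [Complex.neg_re]; linarith [(h01 z hz.2).1])
        (fun x hx => by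
          have := (B.tendsto_chart hu (hVt x)).neg
          rw [hut x hx, if_pos hpJ] at this
          simpa using this)
      exact ⟨-V', by linarith, by simpa using h2.fun_neg⟩
    · exact hasDerivAt_im_boundary_nonneg (x₀ := t) hr
        (f := fun z => complexPotential u v (B.ψ (discChart z)) - 1)
        ((hd.mono inter_subset_right).sub_const _)
        (fun z hz => by rw [Complex.sub_re, Complex.one_re]; linarith [(h01 z hz.2).2])
        (fun x hx => by
          have := (B.tendsto_chart hu (hVt x)).sub_const 1
          rw [hut x hx, if_neg hpJ] at this
          simpa using this)
  refine ⟨V, hVc, fun ζ hζ => extendFrom_eq (subset_closure hζ) (hball ζ hζ),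
    extendFrom_eq (hcl _) hv₀, fun p hp t ht => ?_, fun p hp => ?_, ?_⟩
  · obtain ⟨c, hc⟩ := B.exists_tendsto_side hE hu hv hp
    have hlt := B.θ_lt (2 * p) (by omega)
    have hk : B.θ 0 ≤ B.θ (2 * p) := B.θ_le (Nat.zero_le _) (by omega)
    have h1 : EqOn (fun t => V (circlePt t)) (fun _ => c) (Ioo (B.θ (2 * p)) (B.θ (2 * p + 1))) :=
      fun x hx => tendsto_nhds_unique (hVt x)
        (hc x (Ioo_subset_Icc_self hx) (hk.trans_lt hx.1).ne')
    have h2 := h1.closure hVcirc continuous_const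
    rw [closure_Ioo hlt.ne] at h2
    exact (h2 ht).trans (h2 (left_mem_Icc.2 hlt.le)).symm
  · have key := hder p hp.le
    simp only [hp.ne, if_false] at key
    refine monotoneOn_of_deriv_nonneg (convex_Icc _ _) hVcirc.continuousOn ?_ ?_
    · rw [interior_Icc]
      intro t ht
      obtain ⟨V', -, h⟩ := key t ht
      exact h.differentiableAt.differentiableWithinAt
    · rw [interior_Icc]
      intro t ht
      obtain ⟨V', h0, h⟩ := key t ht
      rwa [h.deriv]
  · have key := hder B.J le_rfl
    simp only [if_true] at key
    refine antitoneOn_of_deriv_nonpos (convex_Icc _ _) hVcirc.continuousOn ?_ ?_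
    · rw [interior_Icc]
      intro t ht
      obtain ⟨V', -, h⟩ := key t ht
      exact h.differentiableAt.differentiableWithinAt
    · rw [interior_Icc]
      intro t ht
      obtain ⟨V', h0, h⟩ := key t ht
      rwa [h.deriv]

/-- A function on the oriented boundary that is constant on the sides of the cuts and increases along
the segments other than the last increases from the start of `γ₀⁺` to the end of `γ₀⁻`. -/
theorem OrientedBoundary.monotoneOn_of_pieces {C : Cuts E u} (B : OrientedBoundary C) {V : ℝ → ℝ}
    (hside : ∀ p ≤ B.J, ∀ t ∈ Icc (B.θ (2 * p)) (B.θ (2 * p + 1)), V t = V (B.θ (2 * p)))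
    (hseg : ∀ p < B.J, MonotoneOn V (Icc (B.θ (2 * p + 1)) (B.θ (2 * p + 2)))) :
    MonotoneOn V (Icc (B.θ 0) (B.θ (2 * B.J + 1))) := by
  have key : ∀ k ≤ 2 * B.J + 1, MonotoneOn V (Icc (B.θ 0) (B.θ k)) := by
    intro k
    induction k with
    | zero => intro _; simp
    | succ k ih =>
      intro hk
      have h0 : B.θ 0 ≤ B.θ k := B.θ_le (Nat.zero_le _) (by omega)
      have h1 := (B.θ_lt k (by omega)).le
      rw [← Icc_union_Icc_eq_Icc h0 h1]
      refine (ih (by omega)).union_right ?_ (isGreatest_Icc h0) (isLeast_Icc h1)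
      obtain ⟨p, rfl | rfl⟩ := Nat.even_or_odd' k
      · intro s hs t ht _
        rw [hside p (by omega) s hs, hside p (by omega) t ht]
      · exact hseg p (by omega)
  exact key _ le_rfl

end Setting

/-! ### Jumps -/

theorem HarmonicOn.continuousAt_grad {u : OnePoint ℂ → ℝ} {S : Set (OnePoint ℂ)}
    (hu : HarmonicOn u S) {z : ℂ} (hz : (z : OnePoint ℂ) ∈ S) : ContinuousAt (grad u) z :=
  (InnerProductSpace.toDual ℝ ℂ).symm.continuous.continuousAt.comp
    ((hu.1 z hz).1.fderiv_right (m := 1) (by norm_num)).continuousAt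

theorem grad_const_mul {u : OnePoint ℂ → ℝ} {z : ℂ} (c : ℝ)
    (hu : DifferentiableAt ℝ (fun w : ℂ => u (w : OnePoint ℂ)) z) :
    grad (fun p => c * u p) z = c • grad u z := by
  simp only [grad, gradient]
  rw [fderiv_const_mul hu, map_smul]

section Setting

variable {m : ℕ} {E : Fin (m + 1) → Set (OnePoint ℂ)} {u : OnePoint ℂ → ℝ}

theorem ContourSegment.mem_domain {C : Cuts E u} {B : OrientedBoundary C} {p q : ℕ}
    (Γ : ContourSegment B p q) (hp : p ≤ B.J) (hq : q ≤ B.J) {t : ℝ} (ht : t ∈ Icc (0 : ℝ) 1) :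
    (Γ.σ t : OnePoint ℂ) ∈ domain E := by
  rw [← Γ.ψ_τ t ht]
  rcases ht.1.eq_or_lt with h | h
  · obtain ⟨a, ha, h'⟩ := Γ.τ_zero
    rw [← h, h']
    exact (B.cut_side p hp a ha).1
  rcases ht.2.eq_or_lt with h1 | h1
  · obtain ⟨a, ha, h'⟩ := Γ.τ_one
    rw [h1, h']
    exact (B.cut_side q hq a ha).1
  · exact C.cutDomain_subset (B.bijOn.mapsTo (Γ.τ_mem t ⟨h, h1⟩))

/-- Along a contour line the conjugate function is strictly monotone, and its increment is the
flux through the contour segment. -/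
theorem ContourSegment.abs_sub_eq_flux (hu : IsPotential E u)
    {C : Cuts E u} {B : OrientedBoundary C} {v : OnePoint ℂ → ℝ}
    (hv : IsHarmonicConjugate u v C.cutDomain) {V : ℂ → ℝ} (hVc : ContinuousOn V (closedBall 0 1))
    (hV : ∀ ζ ∈ ball (0 : ℂ) 1, V ζ = v (B.ψ ζ)) {p q : ℕ} (Γ : ContourSegment B p q)
    (hp : p ≤ B.J) (hq : q ≤ B.J) :
    |V (Γ.τ 1) - V (Γ.τ 0)| = Γ.flux ∧ 0 < Γ.flux := by
  set w : ℝ → ℝ := fun t => ‖grad u (Γ.σ t)‖ * ‖derivWithin Γ.σ (Icc 0 1) t‖ with hw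
  have hσcut : ∀ t ∈ Ioo (0 : ℝ) 1, (Γ.σ t : OnePoint ℂ) ∈ C.cutDomain := fun t ht => by
    rw [← Γ.ψ_τ t (Ioo_subset_Icc_self ht)]
    exact B.bijOn.mapsTo (Γ.τ_mem t ht)
  have hwc : ContinuousOn w (Icc 0 1) := by
    refine ContinuousOn.mul (ContinuousOn.norm fun t ht => ?_)
      (Γ.smooth.continuousOn_derivWithin (uniqueDiffOn_Icc zero_lt_one) le_rfl).norm
    exact (hu.harmonic.continuousAt_grad (Γ.mem_domain hp hq ht)).comp_continuousWithinAt
      (Γ.smooth.continuousOn t ht)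
  have hwint : IntervalIntegrable w volume 0 1 :=
    ContinuousOn.intervalIntegrable (by rwa [uIcc_of_le zero_le_one])
  have hwpos : ∀ t ∈ Ioo (0 : ℝ) 1, 0 < w t := fun t ht =>
    mul_pos (norm_pos_iff.2 (C.grad_ne_zero (hσcut t ht)))
      (norm_pos_iff.2 (Γ.regular t (Ioo_subset_Icc_self ht)))
  have hflux : 0 < Γ.flux := intervalIntegral.intervalIntegral_pos_of_pos_on hwint hwpos zero_lt_one
  refine ⟨?_, hflux⟩
  set k : ℝ → ℝ := fun t => V (Γ.τ t) with hk
  have hτ : MapsTo Γ.τ (Icc 0 1) (closedBall 0 1) := by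
    intro t ht
    rcases ht.1.eq_or_lt with h | h
    · obtain ⟨a, -, h'⟩ := Γ.τ_zero
      rw [← h, h']
      exact circlePt_mem_closedBall a
    rcases ht.2.eq_or_lt with h1 | h1
    · obtain ⟨a, -, h'⟩ := Γ.τ_one
      rw [h1, h']
      exact circlePt_mem_closedBall a
    · exact ball_subset_closedBall (Γ.τ_mem t ⟨h, h1⟩)
  have hkc : ContinuousOn k (Icc 0 1) := hVc.comp Γ.τ_continuousOn hτ
  set k' : ℝ → ℝ := fun t =>
    (deriv (fun z : ℂ => complexPotential u v z) (Γ.σ t) * derivWithin Γ.σ (Icc 0 1) t).im with hk'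
  have hder : ∀ t ∈ Ioo (0 : ℝ) 1, HasDerivAt k (k' t) t ∧ |k' t| = w t := by
    intro t ht
    have hφ := (hv.1 _ (hσcut t ht)).hasDerivAt
    have hσ : HasDerivAt Γ.σ (derivWithin Γ.σ (Icc 0 1) t) t :=
      ((Γ.smooth.differentiableOn one_ne_zero t
        (Ioo_subset_Icc_self ht)).hasDerivWithinAt).hasDerivAt (Icc_mem_nhds ht.1 ht.2)
    have hcomp := hφ.scomp t hσ
    rw [smul_eq_mul, mul_comm] at hcomp
    have him := Complex.imCLM.hasFDerivAt.comp_hasDerivAt t hcomp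
    have hre := Complex.reCLM.hasFDerivAt.comp_hasDerivAt t hcomp
    have hre0 : (deriv (fun z : ℂ => complexPotential u v z) (Γ.σ t) *
        derivWithin Γ.σ (Icc 0 1) t).re = 0 := by
      refine hre.unique ((hasDerivAt_const t Γ.level).congr_of_eventuallyEq ?_)
      filter_upwards [Icc_mem_nhds ht.1 ht.2] with s hs
      simp only [Function.comp_apply, Complex.reCLM_apply, complexPotential_re]
      exact Γ.on_level s hs
    refine ⟨him.congr_of_eventuallyEq ?_, ?_⟩
    · filter_upwards [Ioo_mem_nhds ht.1 ht.2] with s hs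
      simp only [Function.comp_apply, Complex.imCLM_apply, complexPotential_im, hk]
      rw [hV _ (Γ.τ_mem s hs), Γ.ψ_τ s (Ioo_subset_Icc_self hs)]
    · have hg := (grad_of_holomorphic (hv.1 _ (hσcut t ht))
        (Eventually.of_forall fun _ => complexPotential_re u v _)
        (Eventually.of_forall fun _ => complexPotential_im u v _)).1
      rw [hw]
      simp only
      rw [hg, Complex.norm_conj, ← norm_mul, ← Complex.abs_im_eq_norm.2 hre0]
  have hsign : (∀ t ∈ Ioo (0 : ℝ) 1, k' t < 0) ∨ ∀ t ∈ Ioo (0 : ℝ) 1, 0 < k' t :=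
    hasDerivWithinAt_forall_lt_or_forall_gt_of_forall_ne (convex_Ioo 0 1)
      (fun t ht => (hder t ht).1.hasDerivWithinAt) fun t ht h0 => by
        have := (hder t ht).2
        rw [h0, abs_zero] at this
        exact (hwpos t ht).ne this
  rcases hsign with hs | hs
  · have h1 := intervalIntegral.integral_eq_sub_of_hasDerivAt_of_le zero_le_one hkc
      (f' := fun t => -w t) (fun t ht => by
        rw [← (hder t ht).2, abs_of_neg (hs t ht), neg_neg]
        exact (hder t ht).1) hwint.neg
    rw [intervalIntegral.integral_neg] at h1
    change |k 1 - k 0| = ∫ t in (0 : ℝ)..1, w t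
    rw [← h1, abs_neg]
    exact abs_of_pos hflux
  · have h1 := intervalIntegral.integral_eq_sub_of_hasDerivAt_of_le zero_le_one hkc
      (f' := w) (fun t ht => by
        rw [← (hder t ht).2, abs_of_pos (hs t ht)]
        exact (hder t ht).1) hwint
    change |k 1 - k 0| = ∫ t in (0 : ℝ)..1, w t
    rw [← h1]
    exact abs_of_pos hflux

/-- The boundary values of the conjugate function on the sides of the cuts are the cumulative sums
of the jumps. -/
theorem OrientedBoundary.side_eq_dirichletData (hu : IsPotential E u)
    {C : Cuts E u} (B : OrientedBoundary C) {v : OnePoint ℂ → ℝ}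
    (hv : IsHarmonicConjugate u v C.cutDomain) {V : ℂ → ℝ} (hVc : ContinuousOn V (closedBall 0 1))
    (hV : ∀ ζ ∈ ball (0 : ℂ) 1, V ζ = v (B.ψ ζ)) (hV₀ : V (circlePt (B.θ 0)) = 0)
    (hside : ∀ p ≤ B.J, ∀ t ∈ Icc (B.θ (2 * p)) (B.θ (2 * p + 1)),
        V (circlePt t) = V (circlePt (B.θ (2 * p))))
    (hmono : MonotoneOn (fun t => V (circlePt t)) (Icc (B.θ 0) (B.θ (2 * B.J + 1))))
    (Γ₀ : ContourSegment B 0 B.J) (Γ : ∀ i : Fin B.J, ContourSegment B i (i + 1)) :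
    0 < Γ₀.flux ∧ ∀ p ≤ B.J, V (circlePt (B.θ (2 * p))) =
      Γ₀.flux * dirichletData (fun i => (Γ i).flux) Γ₀.flux p := by
  have hflux : ∀ {p q : ℕ} (Γ : ContourSegment B p q), p ≤ q → q ≤ B.J →
      V (circlePt (B.θ (2 * q))) - V (circlePt (B.θ (2 * p))) = Γ.flux ∧ 0 < Γ.flux := by
    intro p q Γ hpq hq
    obtain ⟨h1, h2⟩ := Γ.abs_sub_eq_flux hu hv hVc hV (hpq.trans hq) hq
    refine ⟨?_, h2⟩
    obtain ⟨a, ha, ha'⟩ := Γ.τ_zero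
    obtain ⟨b, hb, hb'⟩ := Γ.τ_one
    rw [ha', hb', hside q hq b (Ioo_subset_Icc_self hb),
      hside p (hpq.trans hq) a (Ioo_subset_Icc_self ha)] at h1
    rw [← h1, abs_of_nonneg (sub_nonneg.2 ?_)]
    have hmem : ∀ n ≤ B.J, B.θ (2 * n) ∈ Icc (B.θ 0) (B.θ (2 * B.J + 1)) := fun n hn =>
      ⟨B.θ_le (Nat.zero_le _) (by omega), B.θ_le (by omega) (by omega)⟩
    exact hmono (hmem p (hpq.trans hq)) (hmem q hq) (B.θ_le (by omega) (by omega))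
  obtain ⟨hd, hdpos⟩ := hflux Γ₀ (Nat.zero_le _) le_rfl
  rw [mul_zero, hV₀, sub_zero] at hd
  have hsum : ∀ p ≤ B.J, V (circlePt (B.θ (2 * p))) =
      ∑ i ∈ Finset.univ.filter (fun i : Fin B.J => (i : ℕ) < p), (Γ i).flux := by
    intro p
    induction p with
    | zero => intro _; simp [hV₀]
    | succ p ih =>
      intro hp
      have e : Finset.univ.filter (fun i : Fin B.J => (i : ℕ) < p + 1) =
          insert ⟨p, hp⟩ (Finset.univ.filter (fun i : Fin B.J => (i : ℕ) < p)) := by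
        ext i
        simp only [Finset.mem_filter, Finset.mem_univ, true_and, Finset.mem_insert, Fin.ext_iff]
        omega
      rw [e, Finset.sum_insert (by simp), ← ih (by omega)]
      have := (hflux (Γ ⟨p, hp⟩) (Nat.le_succ p) hp).1
      simp only at this
      linarith
  refine ⟨hdpos, fun p hp => ?_⟩
  rw [dirichletData]
  split_ifs with h0 hJ
  · rw [h0, mul_zero, mul_zero, hV₀]
  · rw [hJ, hd, mul_one]
  · rw [hsum p hp, mul_div_cancel₀ _ hdpos.ne']

/-! ### The conjugate problem -/

theorem HarmonicOn.const_mul {u : OnePoint ℂ → ℝ} {S : Set (OnePoint ℂ)} (hu : HarmonicOn u S)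
    (c : ℝ) : HarmonicOn (fun p => c * u p) S := by
  refine ⟨fun z hz => (hu.1 z hz).const_smul (c := c), fun h => ?_⟩
  have := (hu.2 h).const_smul (c := c)
  convert this using 1
  simp only [atInfty_eq]; rfl

/-- A multiple of the conjugate function solves the conjugate problem. -/
theorem OrientedBoundary.isConjugateSolution (hE : IsMultiplyConnected E) (hu : IsPotential E u)
    {C : Cuts E u} (B : OrientedBoundary C) {v : OnePoint ℂ → ℝ}
    (hv : IsHarmonicConjugate u v C.cutDomain) {V : ℂ → ℝ} (hVc : ContinuousOn V (closedBall 0 1))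
    (hV : ∀ ζ ∈ ball (0 : ℂ) 1, V ζ = v (B.ψ ζ)) {c : ℝ} {data : ℕ → ℝ}
    (hdata : ∀ p ≤ B.J, ∀ t ∈ Icc (B.θ (2 * p)) (B.θ (2 * p + 1)),
      c * V (circlePt t) = data p) :
    IsConjugateSolution B data fun p => c * v p := by
  have hharm : HarmonicOn v C.cutDomain := by
    simpa only [complexPotential_im] using harmonicOn_im (C.isOpen_cutDomain hE) hv
  refine ⟨hharm.const_mul c, ⟨fun ζ => c * V ζ, hVc.const_smul c,
    fun ζ hζ => by simp only [hV ζ hζ], hdata⟩, ?_⟩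
  obtain ⟨S, hS, HS⟩ := C.exists_finite_regular hE hu (B.frontier_nonempty hE)
  refine ⟨S, hS, fun p hp => ?_⟩
  obtain ⟨z, n, g, hz, hn, -, hg, hgn⟩ := HS p hp
  refine ⟨z, n, c • (Complex.I * g), hz, hn, ?_, ?_⟩
  · refine ((hg.const_mul Complex.I).const_smul c).congr' ?_
    filter_upwards [self_mem_nhdsWithin] with w hw
    rw [grad_const_mul c (hv.grad_eq hw).2, (hv.grad_eq hw).1]
  · rw [real_inner_smul_left, inner_I_mul_left, hgn, neg_zero, mul_zero]

/-- A harmonic conjugate of a function with vanishing normal derivative has boundary limits which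
are locally constant along the segments on the curves `∂E_j`, away from finitely many points. -/
theorem OrientedBoundary.exists_locally_const (hE : IsMultiplyConnected E) (hu : IsPotential E u)
    {C : Cuts E u} (B : OrientedBoundary C) {data : ℕ → ℝ} {w : OnePoint ℂ → ℝ}
    (hw : IsConjugateSolution B data w) {G : ℂ → ℂ} (hG : DifferentiableOn ℂ G (ball 0 1))
    (hre : ∀ ζ ∈ ball (0 : ℂ) 1, (G ζ).re = w (B.ψ ζ)) {p : ℕ} (hp : p ≤ B.J) {t : ℝ}
    (ht : t ∈ Ioo (B.θ (2 * p + 1)) (B.θ (2 * p + 2))) :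
    ∃ r > 0, ∃ c₁ c₂,
      (∀ x < t, |x - t| < r → x ∈ Ioo (B.θ (2 * p + 1)) (B.θ (2 * p + 2)) ∧
        Tendsto (fun ζ => (G ζ).im) (𝓝[ball 0 1] circlePt x) (𝓝 c₁)) ∧
      ∀ x, t < x → |x - t| < r → x ∈ Ioo (B.θ (2 * p + 1)) (B.θ (2 * p + 2)) ∧
        Tendsto (fun ζ => (G ζ).im) (𝓝[ball 0 1] circlePt x) (𝓝 c₂) := by
  obtain ⟨S₁, hS₁, H₁⟩ := C.exists_finite_regular hE hu (B.frontier_nonempty hE)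
  obtain ⟨S₂, hS₂, H₂⟩ := hw.neumann
  have hS := hS₁.union hS₂
  set A := finitePart C.cutDomain with hA
  set k : OnePoint ℂ → ℝ := fun q => (G (Function.invFunOn B.ψ (ball 0 1) q)).im with hk
  set I : Set ℝ := {x ∈ Ioo (B.θ (2 * p + 1)) (B.θ (2 * p + 2)) | B.ψ (circlePt x) ∉ S₁ ∪ S₂}
    with hI
  have hIo : IsOpen I := by
    have : I = Ioo (B.θ (2 * p + 1)) (B.θ (2 * p + 2)) \
        {x ∈ Ioo (B.θ (2 * p + 1)) (B.θ (2 * p + 2)) | B.ψ (circlePt x) ∈ S₁ ∪ S₂} := by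
      ext x
      simp only [hI, mem_ofPred_eq, Set.mem_sdiff]
      tauto
    rw [this]
    exact isOpen_Ioo.sdiff (B.finite_segment_preimage hS hp).isClosed
  have hreg : ∀ x ∈ I, ∃ z n g : ℂ, B.ψ (circlePt x) = z ∧ HasConeAt A z n ∧
      Tendsto (grad w) (𝓝[A] z) (𝓝 g) ∧ inner ℝ g n = 0 := by
    intro x hx
    have hf := B.segment_mem_frontier hE hp (Ioo_subset_Icc_self hx.1)
    obtain ⟨z, n, g, hz, hn, hg, hgn⟩ := H₂ _ ⟨hf, fun h => hx.2 (Or.inr h)⟩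
    obtain ⟨z', n', g', hz', -, hcone, -⟩ := H₁ _ ⟨hf, fun h => hx.2 (Or.inl h)⟩
    rw [hz, OnePoint.coe_eq_coe] at hz'
    subst hz'
    exact ⟨z, n, g, hz, hcone n hn, hg, hgn⟩
  have hex : ∀ x : ℝ, ∃ z : ℂ, x ∈ I → B.ψ (circlePt x) = z := fun x => by
    by_cases hx : x ∈ I
    · obtain ⟨z, -, -, hz, -⟩ := hreg x hx
      exact ⟨z, fun _ => hz⟩
    · exact ⟨0, fun h => absurd h hx⟩
  choose β hβ using hex
  have hβc : ContinuousOn β I := by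
    rw [OnePoint.isOpenEmbedding_coe.isInducing.continuousOn_iff]
    refine ContinuousOn.congr (f := fun x => B.ψ (circlePt x)) ?_ fun x hx => (hβ x hx).symm
    exact B.continuousOn.comp continuous_circlePt.continuousOn fun x _ => circlePt_mem_closedBall x
  have hcone : ∀ x ∈ I, ∃ n g κ, HasConeAt A (β x) n ∧
      HasExpansionAt A (fun z => k (z : OnePoint ℂ)) (β x) κ g ∧
      inner ℝ g (Complex.I * n) = 0 := by
    intro x hx
    obtain ⟨z, n, g, hz, hc, hg, hgn⟩ := hreg x hx
    have hzβ : z = β x := by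
      rw [← OnePoint.coe_eq_coe, ← hz, hβ x hx]
    subst hzβ
    have hgrad : ∀ y ∈ A, grad k y = Complex.I * grad w y ∧
        DifferentiableAt ℝ (fun z : ℂ => k (z : OnePoint ℂ)) y := by
      intro y hy
      refine (grad_of_holomorphic (B.exists_differentiableAt_invFunOn hE hw.harmonic hG hre hy)
        ?_ (Eventually.of_forall fun _ => rfl)).2
      have hop : IsOpen A := (C.isOpen_cutDomain hE).preimage OnePoint.continuous_coe
      filter_upwards [hop.mem_nhds hy] with y' hy'
      rw [hre _ (Function.invFunOn_mem (B.bijOn.surjOn hy')),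
        Function.invFunOn_eq (B.bijOn.surjOn hy')]
    have hgk : Tendsto (∇ fun z : ℂ => k (z : OnePoint ℂ)) (𝓝[A] (β x)) (𝓝 (Complex.I * g)) := by
      refine (hg.const_mul Complex.I).congr' ?_
      filter_upwards [self_mem_nhdsWithin] with y hy using (hgrad y hy).1.symm
    obtain ⟨κ, hκ⟩ := hc.exists_hasExpansionAt (by
      filter_upwards [self_mem_nhdsWithin] with y hy using (hgrad y hy).2) hgk
    refine ⟨n, _, κ, hc, hκ, ?_⟩
    -- multiplication by `I` is an isometry
    rw [inner_I_mul_left, ← mul_assoc, Complex.I_mul_I, neg_one_mul, inner_neg_right, neg_neg, hgn]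
  have hloc : ∀ x ∈ I, ∃ c, ∃ r > 0, ∀ y, |y - x| < r →
      Tendsto (fun ζ => (G ζ).im) (𝓝[ball 0 1] circlePt y) (𝓝 c) := by
    intro x hx
    obtain ⟨c, r, hr, H⟩ := exists_tendsto_const_of_normal_gradient hIo hβc hcone hx
    obtain ⟨r', hr', H'⟩ := Metric.isOpen_iff.1 hIo x hx
    refine ⟨c, min r r', lt_min hr hr', fun y hy => ?_⟩
    obtain ⟨h1, h2⟩ := lt_min_iff.1 hy
    have hyI : y ∈ I := H' (by simpa [Real.dist_eq] using h2)
    refine (B.tendsto_comp_of_finitePart (circlePt_mem_closedBall y) (hβ y hyI) (H y h1)).congr' ?_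
    filter_upwards [self_mem_nhdsWithin] with ζ hζ
    simp only [hk]
    rw [B.bijOn.injOn.leftInvOn_invFunOn hζ]
  obtain ⟨r, hr, H⟩ := B.exists_punctured hS hp ht
  obtain ⟨c₁, h₁⟩ := exists_tendsto_const_of_locally (a := t - r) (b := t) (by linarith)
    fun x hx => hloc x (by
      have hxr : |x - t| < r := by rw [abs_lt]; constructor <;> linarith [hx.1, hx.2]
      exact ⟨(H x hxr).1, (H x hxr).2 hx.2.ne⟩)
  obtain ⟨c₂, h₂⟩ := exists_tendsto_const_of_locally (a := t) (b := t + r) (by linarith)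
    fun x hx => hloc x (by
      have hxr : |x - t| < r := by rw [abs_lt]; constructor <;> linarith [hx.1, hx.2]
      exact ⟨(H x hxr).1, (H x hxr).2 hx.1.ne'⟩)
  refine ⟨r, hr, c₁, c₂, fun x hx hxr => ⟨(H x hxr).1, h₁ x ⟨?_, hx⟩⟩,
    fun x hx hxr => ⟨(H x hxr).1, h₂ x ⟨hx, ?_⟩⟩⟩ <;>
  · rw [abs_lt] at hxr
    linarith [hxr.1, hxr.2]

theorem circlePt_add_of_eq {s t : ℝ} (h : circlePt s = circlePt t) (x : ℝ) :
    circlePt (x + (s - t)) = circlePt x := by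
  have ht : circlePt t ≠ 0 := by
    rw [← norm_pos_iff, norm_circlePt]; exact one_pos
  have e : circlePt (x + (s - t)) * circlePt t = circlePt x * circlePt s := by
    simp only [circlePt, ← Complex.exp_add]
    congr 1
    push_cast
    ring
  rw [h] at e
  exact mul_right_cancel₀ ht e

/-- Uniqueness: the difference of the conjugate function and a multiple of a solution vanishes on
the sides of the cuts, and its own conjugate is piecewise constant on the remaining boundary. -/
theorem OrientedBoundary.eq_mul_of_isConjugateSolution (hE : IsMultiplyConnected E)
    (hu : IsPotential E u) {C : Cuts E u} (B : OrientedBoundary C) {v : OnePoint ℂ → ℝ}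
    (hv : IsHarmonicConjugate u v C.cutDomain) {V : ℂ → ℝ} (hVc : ContinuousOn V (closedBall 0 1))
    (hV : ∀ ζ ∈ ball (0 : ℂ) 1, V ζ = v (B.ψ ζ)) {d : ℝ} {data : ℕ → ℝ}
    (hdata : ∀ p ≤ B.J, ∀ t ∈ Icc (B.θ (2 * p)) (B.θ (2 * p + 1)), V (circlePt t) = d * data p)
    {w : OnePoint ℂ → ℝ} (hw : IsConjugateSolution B data w) {p : OnePoint ℂ}
    (hp : p ∈ C.cutDomain) : v p = d * w p := by
  obtain ⟨W, hWc, hW, hWd⟩ := hw.dirichlet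
  obtain ⟨G, hG, hre⟩ := B.exists_re_eq_comp hE hw.harmonic
  set F : ℂ → ℂ := fun ζ => complexPotential u v (B.ψ ζ) with hF
  have hFd : DifferentiableOn ℂ F (ball 0 1) := B.differentiableOn_comp hE hv
  set f : ℂ → ℂ := fun ζ => -(Complex.I * F ζ) - d * G ζ with hf
  set h : ℂ → ℝ := fun ζ => V ζ - d * W ζ with hh
  have hfd : DifferentiableOn ℂ f (ball 0 1) := (hFd.const_mul _).neg.sub (hG.const_mul _)
  have hhc : ContinuousOn h (closedBall 0 1) := hVc.sub (hWc.const_smul d)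
  have hfre : ∀ ζ ∈ ball (0 : ℂ) 1, (f ζ).re = h ζ := by
    intro ζ hζ
    have : (F ζ).im = V ζ := by rw [hF, hV ζ hζ]; exact complexPotential_im u v _
    simp [hf, hh, hre ζ hζ, hW ζ hζ, this]
  have hfim : ∀ ζ, (f ζ).im = -u (B.ψ ζ) - d * (G ζ).im := by
    intro ζ
    have : (F ζ).re = u (B.ψ ζ) := complexPotential_re u v _
    simp [hf, this]
  have hside : ∀ q ≤ B.J, ∀ t ∈ Icc (B.θ (2 * q)) (B.θ (2 * q + 1)), h (circlePt t) = 0 := by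
    intro q hq t ht
    simp only [hh]
    rw [hdata q hq t ht, hWd q hq t ht, sub_self]
  have hbd : ∀ t, h (circlePt t) = 0 ∨ ∃ r > 0, ∃ c₁ c₂,
      (∀ x < t, |x - t| < r →
        Tendsto (fun ζ => (f ζ).im) (𝓝[ball 0 1] circlePt x) (𝓝 c₁)) ∧
      ∀ x, t < x → |x - t| < r →
        Tendsto (fun ζ => (f ζ).im) (𝓝[ball 0 1] circlePt x) (𝓝 c₂) := by
    intro t
    obtain ⟨s, hs, hst⟩ := exists_circlePt_eq_Ico (norm_circlePt t) (B.θ 0)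
    obtain ⟨q, hq, h' | h'⟩ := B.exists_side_or_segment hs
    · exact Or.inl (hst ▸ hside q hq s h')
    · obtain ⟨r, hr, c₁, c₂, h₁, h₂⟩ := B.exists_locally_const hE hu hw hG hre hq h'
      set u₀ := u (B.ψ (circlePt s)) with hu₀
      have key : ∀ x ∈ Ioo (B.θ (2 * q + 1)) (B.θ (2 * q + 2)), ∀ c,
          Tendsto (fun ζ => (G ζ).im) (𝓝[ball 0 1] circlePt x) (𝓝 c) →
          Tendsto (fun ζ => (f ζ).im) (𝓝[ball 0 1] circlePt x) (𝓝 (-u₀ - d * c)) := by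
        intro x hx c hc
        have hux : u (B.ψ (circlePt x)) = u₀ := by
          rw [hu₀, hu.segment_eq B hq (Ioo_subset_Icc_self hx),
            hu.segment_eq B hq (Ioo_subset_Icc_self h')]
        simp only [hfim]
        exact hux ▸ (B.tendsto_comp_potential hu x).neg.sub (hc.const_mul d)
      refine Or.inr ⟨r, hr, -u₀ - d * c₁, -u₀ - d * c₂, fun x hx hxr => ?_, fun x hx hxr => ?_⟩
      · have e : x + (s - t) - s = x - t := by ring
        obtain ⟨h3, h4⟩ := h₁ (x + (s - t)) (by linarith) (by rwa [e])
        have := key _ h3 _ h4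
        rwa [circlePt_add_of_eq hst] at this
      · have e : x + (s - t) - s = x - t := by ring
        obtain ⟨h3, h4⟩ := h₂ (x + (s - t)) (by linarith) (by rwa [e])
        have := key _ h3 _ h4
        rwa [circlePt_add_of_eq hst] at this
  have h0 : h (circlePt (B.θ 0)) = 0 :=
    hside 0 (Nat.zero_le _) _ (left_mem_Icc.2 (B.θ_lt 0 (by omega)).le)
  obtain ⟨ζ, hζ, rfl⟩ := B.bijOn.surjOn hp
  have hle := nonpos_of_mixed_boundary hfd hhc hfre hbd ⟨_, h0⟩ ζ (ball_subset_closedBall hζ)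
  have hge := nonpos_of_mixed_boundary (f := fun ζ => -f ζ) (h := fun ζ => -h ζ) hfd.neg hhc.neg
    (fun ζ hζ => by rw [Complex.neg_re, hfre ζ hζ])
    (fun t => by
      rcases hbd t with h' | ⟨r, hr, c₁, c₂, h₁, h₂⟩
      · exact Or.inl (by rw [h', neg_zero])
      · exact Or.inr ⟨r, hr, -c₁, -c₂, fun x hx hxr => (h₁ x hx hxr).neg,
          fun x hx hxr => (h₂ x hx hxr).neg⟩)
    ⟨_, by rw [h0, neg_zero]⟩ ζ (ball_subset_closedBall hζ)
  simp only [hh] at hle hge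
  rw [hV ζ hζ, hW ζ hζ] at hle hge
  linarith

end Setting

end MultConn

end

theorem mainTheorem2 {m : ℕ} (hm : 1 ≤ m) (E : Fin (m + 1) → Set (OnePoint ℂ))
    (hE : MultConn.IsMultiplyConnected E)
    (u : OnePoint ℂ → ℝ) (hu : MultConn.IsPotential E u)
    (C : MultConn.Cuts E u) (B : MultConn.OrientedBoundary C)
    (Γ₀ : MultConn.ContourSegment B 0 B.J) (hΓ₀ : Γ₀.σ 0 = Γ₀.σ 1)
    (Γ : ∀ i : Fin B.J, MultConn.ContourSegment B i (i + 1))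
    (d : ℝ) (hd : d = Γ₀.flux)
    (v : OnePoint ℂ → ℝ) (hv : MultConn.IsHarmonicConjugate u v C.cutDomain)
    (hv₀ : Tendsto (fun ζ => v (B.ψ ζ)) (𝓝[ball 0 1] (MultConn.circlePt (B.θ 0))) (𝓝 0)) :
    (∃ ũ : OnePoint ℂ → ℝ, MultConn.IsConjugateSolution B
      (MultConn.dirichletData (fun i => (Γ i).flux) d) ũ) ∧
    (∀ ũ : OnePoint ℂ → ℝ, MultConn.IsConjugateSolution B
      (MultConn.dirichletData (fun i => (Γ i).flux) d) ũ →
        ∀ p ∈ C.cutDomain, v p = d * ũ p) ∧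
    InjOn (MultConn.complexPotential u v) C.cutDomain := by
  obtain ⟨V, hVc, hV, hV₀, hside, hseg, hanti⟩ := B.exists_extension hE hu hv hv₀
  have hmono := B.monotoneOn_of_pieces (V := fun t => V (MultConn.circlePt t)) hside hseg
  obtain ⟨hdpos, hdata⟩ := B.side_eq_dirichletData hu hv hVc hV hV₀ hside hmono Γ₀ Γ
  rw [← hd] at hdpos hdata
  have hdata' : ∀ p ≤ B.J, ∀ t ∈ Icc (B.θ (2 * p)) (B.θ (2 * p + 1)),
      V (MultConn.circlePt t) = d * MultConn.dirichletData (fun i => (Γ i).flux) d p :=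
    fun p hp t ht => (hside p hp t ht).trans (hdata p hp)
  refine ⟨⟨_, B.isConjugateSolution hE hu hv hVc hV (c := d⁻¹) fun p hp t ht => ?_⟩,
    fun ũ hũ p hp => B.eq_mul_of_isConjugateSolution hE hu hv hVc hV hdata' hũ hp, ?_⟩
  · rw [hdata' p hp t ht, inv_mul_cancel_left₀ hdpos.ne']
  have hFc : ContinuousOn (fun ζ => (u (B.ψ ζ) : ℂ) + (V ζ : ℂ) * Complex.I) (closedBall 0 1) :=
    (Complex.continuous_ofReal.comp_continuousOn (B.continuousOn_comp_potential hu)).add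
      ((Complex.continuous_ofReal.comp_continuousOn hVc).mul continuousOn_const)
  have hFeq : EqOn (fun ζ => (u (B.ψ ζ) : ℂ) + (V ζ : ℂ) * Complex.I)
      (fun ζ => MultConn.complexPotential u v (B.ψ ζ)) (ball 0 1) := fun ζ hζ => by
    simp only [hV ζ hζ, MultConn.complexPotential]
  have him : ∀ ζ, ((u (B.ψ ζ) : ℂ) + (V ζ : ℂ) * Complex.I).im = V ζ := fun ζ => by simp
  have hlt := B.θ_lt (2 * B.J + 1) le_rfl
  have hinj := MultConn.injOn_of_unimodal_boundary hFc
    ((B.differentiableOn_comp hE hv).congr hFeq) (a := B.θ 0) (b := B.θ (2 * B.J + 1))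
    ((B.θ_lt 0 (by omega)).trans_le (B.θ_le (by omega) (by omega)))
    (by rw [← B.θ_close]; exact hlt)
    (by simpa only [him] using hmono)
    (by rw [← B.θ_close]; simpa only [him] using hanti)
    (by
      rw [him, him, hV₀, hdata' B.J le_rfl _ ⟨(B.θ_lt (2 * B.J) (by omega)).le, le_rfl⟩,
        MultConn.dirichletData, if_neg (Nat.one_le_iff_ne_zero.1 B.J_pos), if_pos rfl, mul_one]
      exact hdpos)
  intro p hp q hq hpq
  obtain ⟨ζ, hζ, rfl⟩ := B.bijOn.surjOn hp
  obtain ⟨ξ, hξ, rfl⟩ := B.bijOn.surjOn hq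
  rw [hinj hζ hξ (by rw [hFeq hζ, hFeq hξ]; exact hpq)]
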